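/- Let $n\in\mathbb N$, write points of $\mathbb R^{2n}$ as $(x,\xi)$, put $\langle x\rangle=(1+|x|^2)^{1/2}$, $\mathbb 1=(1,1)$ and $$\{f,g\}=\sum_{i=1}^n\Big(\frac{\partial f}{\partial\xi_i}\frac{\partial g}{\partial x^i}-\frac{\partial f}{\partial x^i}\frac{\partial g}{\partial\xi_i}\Big).$$ **Symbols.** For $m=(m_e,m_\psi)\in\mathbb R^2$ let $S^m$ be the space of $a\in C^\infty(\mathbb R^{2n};\mathbb C)$ with $|\partial_x^\alpha\partial_\xi^\beta a|\le C_{\alpha\beta}\langle x\rangle^{m_e-|\alpha|}\langle\xi\rangle^{m_\psi-|\beta|}$ for all $\alpha,\beta$. A bracketed order, as in $S^{[m_e],m_\psi}$, $S^{m_e,[m_\psi]}$, $S^{[m_e],[m_\psi]}$, means that in addition, for some $c>0$ and all $\lambda,\mu\ge1$, respectively, $a(\lambda x,\xi)=\lambda^{m_e}a(x,\xi)$ if $|x|>c$; $a(x,\mu\xi)=\mu^{m_\psi}a(x,\xi)$ if $|\xi|>c$; $a(\lambda x,\mu\xi)=\lambda^{m_e}\mu^{m_\psi}a(x,\xi)$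 if $|x|,|\xi|>c$. The space $S^{m}_{cl(e)}$ (resp. $S^{m_e,[m_\psi]}_{cl(e)}$) consists of those $a\in S^m$ (resp. $a\in S^{m_e,[m_\psi]}$) for which there are $a_k\in S^{[m_e-k],m_\psi}$ (resp. $a_k\in S^{[m_e-k],[m_\psi]}$), $k\ge0$, with $a-\sum_{k\le N}a_k\in S^{m_e-N-1,m_\psi}$ for all $N$; the spaces $S^m_{cl(\psi)}$ and $S^{[m_e],m_\psi}_{cl(\psi)}$ are defined in the same way with the roles of the two orders exchanged. The space $SG^m$ of classical symbols consists of the $a\in S^m$ for which there are $a^\psi_k\in S^{m_e,[m_\psi-k]}_{cl(e)}$ and $a^e_k\in S^{[m_e-k],m_\psi}_{cl(\psi)}$ with $a-\sum_{k\le N}a_k^\psi\in S^{m_e,m_\psi-N-1}_{cl(e)}$ and $a-\sum_{k\le N}a^e_k\in S^{m_e-N-1,m_\psi}_{cl(\psi)}$ for all $N$. Let $SG=\bigcup_{m\in\mathbb Z^2}SG^m$, $SG_{\mathbb R}=\sum_{m\in\mathbb R^2}SG^m$ and $\mathrm{SymG}^m=SG^m/(SG^m\cap SG^{m-\mathbb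 1})$. **Principal symbols.** For $a\in SG^m$ put $\sigma_e^{m_e}(a)(x,\xi)=\lim_{\mu\to\infty}\mu^{-m_e}a(\mu x,\xi)$ for $x\ne0$, $\sigma_\psi^{m_\psi}(a)(x,\xi)=\lim_{\mu\to\infty}\mu^{-m_\psi}a(x,\mu\xi)$ for $\xi\ne0$, and $\sigma_{\psi e}^m(a)=\sigma_e^{m_e}(\sigma_\psi^{m_\psi}(a))$ for $x\ne0\neq\xi$. **Operators.** For $a\in SG^m$ and $u\in\mathcal S(\mathbb R^n)$ put $\mathrm{Op}(a)u(x)=(2\pi)^{-n}\int\!\big(\int e^{i(x-y)\cdot\xi}a(x,\xi)u(y)\,dy\big)d\xi$, and $LG^m=\{\mathrm{Op}(a):a\in SG^m\}$, a space of linear operators on $\mathcal S(\mathbb R^n)$. Then the following hold. 1. $SG$ and $SG_{\mathbb R}$ are unital commutative subalgebras of $C^\infty(\mathbb R^{2n})$ for the pointwise product. For all $m,k\in\mathbb R^2$ we have $SG^m\cdot SG^k\subset SG^{m+k}$, and $SG^{m-(i,j)}\subset SG^m$ for $i,j\in\mathbb N$. 2. The Poisson bracket is a Lie bracket on $SG$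 and on $SG_{\mathbb R}$, it is a derivation of the product in each argument, and $\{SG^m,SG^k\}\subset SG^{m+k-\mathbb 1}$ for all $m,k\in\mathbb R^2$. 3. $SG^0$ is a subalgebra and a Lie subalgebra, and the bracket that $\{\cdot,\cdot\}$ induces on $\mathrm{SymG}^0$ is well defined and zero. 4. For $a\in SG^m$, $m\in\mathbb R^2$, the limits defining $\sigma_e^{m_e}(a),\sigma_\psi^{m_\psi}(a),\sigma_{\psi e}^m(a)$ exist. They are smooth on their domains $\{x\ne0\}$, $\{\xi\neq0\}$, $\{x\ne0,\xi\ne0\}$, homogeneous of degree $m_e$ in $x$, of degree $m_\psi$ in $\xi$, and bi-homogeneous of degree $m$, respectively. $\sigma_e^{m_e}(a)$ coincides for large $|x|$ with some $b\in S^{[m_e],m_\psi}_{cl(\psi)}$ such that $a-b\in S^{m_e-1,m_\psi}_{cl(\psi)}$, and likewise $\sigma_\psi^{m_\psi}(a)$ coincides for large $|\xi|$ with some $b\in S^{m_e,[m_\psi]}_{cl(e)}$ such that $a-b\in S^{m_e,m_\psi-1}_{cl(e)}$. All three vanish if $a\in SG^{m-\mathbb 1}$, so they depend only on the class of $a$ in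 $\mathrm{SymG}^m$. The Poisson bracket induces Lie algebra structures on $SG^{\mathbb 1}$ and on $\mathrm{SymG}^{\mathbb 1}$, for which the quotient map $SG^{\mathbb 1}\to\mathrm{SymG}^{\mathbb 1}$ is a homomorphism, and for $a,b\in SG^{\mathbb 1}$ $$\sigma_\psi^1(\{a,b\})=\{\sigma_\psi^1(a),\sigma_\psi^1(b)\},\quad \sigma_e^1(\{a,b\})=\{\sigma_e^1(a),\sigma_e^1(b)\},\quad \sigma_{\psi e}^{\mathbb 1}(\{a,b\})=\{\sigma_{\psi e}^{\mathbb 1}(a),\sigma_{\psi e}^{\mathbb 1}(b)\}$$ on the respective domains. 5. For every $m\in\mathbb R^2$ and $a\in SG^m$, $\mathrm{Op}(a)$ is a well-defined operator $\mathcal S(\mathbb R^n)\to\mathcal S(\mathbb R^n)$. $LG^{\mathbb 1}$ is a Lie algebra under the commutator, $LG^0\subset LG^{\mathbb 1}$, the commutator induces a Lie bracket on $LG^{\mathbb 1}/LG^0$, and there is an isomorphism of complex Lie algebras $$(LG^{\mathbb 1}/LG^0,[\cdot,\cdot])\;\cong\;(\mathrm{SymG}^{\mathbb 1},\,i\{\cdot,\cdot\}),$$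 which sends the class of $\mathrm{Op}(a)$ to minus the class of $a$, for every $a\in SG^{\mathbb 1}$. -/

import Mathlib

open Filter Topology MeasureTheory Complex
open scoped ContDiff SchwartzMap

namespace SGCalc

/-! ### Phase space, derivatives, Poisson bracket -/

/-- The configuration space `ℝⁿ`. -/
abbrev Pos (n : ℕ) : Type := EuclideanSpace ℝ (Fin n)

/-- The phase space `T*ℝⁿ = ℝⁿ × ℝⁿ`, with points `(x, ξ)`. -/
abbrev Phase (n : ℕ) : Type := Pos n × Pos n

/-- The pair of orders `𝟙 = (1, 1)`. -/
abbrev oneOne : ℝ × ℝ := (1, 1)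

/-- `∂f/∂xⁱ`. -/
noncomputable def dX {n : ℕ} (i : Fin n) (f : Phase n → ℂ) : Phase n → ℂ :=
  fun p => fderiv ℝ f p (EuclideanSpace.single i (1 : ℝ), 0)

/-- `∂f/∂ξᵢ`. -/
noncomputable def dXi {n : ℕ} (i : Fin n) (f : Phase n → ℂ) : Phase n → ℂ :=
  fun p => fderiv ℝ f p (0, EuclideanSpace.single i (1 : ℝ))

/-- The iterated derivative `∂_{x^{i₁}} ⋯ ∂_{x^{iᵣ}} ∂_{ξ_{j₁}} ⋯ ∂_{ξ_{jₛ}} f`, for words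
`I = [i₁, …, iᵣ]`, `J = [j₁, …, jₛ]` of coordinate indices.  On smooth functions these are exactly
the derivatives `∂_x^α ∂_ξ^β f`, with `|α| = I.length` and `|β| = J.length`. -/
noncomputable def iterD {n : ℕ} (I J : List (Fin n)) (f : Phase n → ℂ) : Phase n → ℂ :=
  I.foldr dX (J.foldr dXi f)

/-- `{f, g} = ∑ᵢ (∂f/∂ξᵢ ∂g/∂xⁱ - ∂f/∂xⁱ ∂g/∂ξᵢ)`. -/
noncomputable def poisson {n : ℕ} (f g : Phase n → ℂ) : Phase n → ℂ :=
  fun p => ∑ i, (dXi i f p * dX i g p - dX i f p * dXi i g p)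

/-- `⟨x⟩ = (1 + |x|²)^{1/2}`. -/
noncomputable def jap {n : ℕ} (x : Pos n) : ℝ := Real.sqrt (1 + ‖x‖ ^ 2)

lemma jap_pos {n : ℕ} (x : Pos n) : 0 < jap x := Real.sqrt_pos.2 (by positivity)

lemma dX_contDiff {n : ℕ} (i : Fin n) {f : Phase n → ℂ} (hf : ContDiff ℝ ∞ f) :
    ContDiff ℝ ∞ (dX i f) :=
  (hf.fderiv_right (m := ∞) (by simp)).clm_apply contDiff_const

lemma dXi_contDiff {n : ℕ} (i : Fin n) {f : Phase n → ℂ} (hf : ContDiff ℝ ∞ f) :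
    ContDiff ℝ ∞ (dXi i f) :=
  (hf.fderiv_right (m := ∞) (by simp)).clm_apply contDiff_const

lemma foldr_contDiff {n : ℕ} {d : Fin n → (Phase n → ℂ) → (Phase n → ℂ)}
    (hd : ∀ i f, ContDiff ℝ ∞ f → ContDiff ℝ ∞ (d i f)) (I : List (Fin n)) {f : Phase n → ℂ}
    (hf : ContDiff ℝ ∞ f) : ContDiff ℝ ∞ (I.foldr d f) := by
  induction I with
  | nil => exact hf
  | cons i I ih => exact hd i _ ih

lemma foldr_add {n : ℕ} {d : Fin n → (Phase n → ℂ) → (Phase n → ℂ)}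
    (hd : ∀ i f, ContDiff ℝ ∞ f → ContDiff ℝ ∞ (d i f))
    (hadd : ∀ i f g, ContDiff ℝ ∞ f → ContDiff ℝ ∞ g → d i (f + g) = d i f + d i g)
    (I : List (Fin n)) {f g : Phase n → ℂ}
    (hf : ContDiff ℝ ∞ f) (hg : ContDiff ℝ ∞ g) :
    I.foldr d (f + g) = I.foldr d f + I.foldr d g := by
  induction I with
  | nil => rfl
  | cons i I ih =>
    simp only [List.foldr_cons, ih]
    exact hadd i _ _ (foldr_contDiff hd I hf) (foldr_contDiff hd I hg)

lemma foldr_smul {n : ℕ} {d : Fin n → (Phase n → ℂ) → (Phase n → ℂ)}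
    (hd : ∀ i f, ContDiff ℝ ∞ f → ContDiff ℝ ∞ (d i f))
    (hsmul : ∀ i (z : ℂ) f, ContDiff ℝ ∞ f → d i (z • f) = z • d i f)
    (I : List (Fin n)) (z : ℂ) {f : Phase n → ℂ} (hf : ContDiff ℝ ∞ f) :
    I.foldr d (z • f) = z • I.foldr d f := by
  induction I with
  | nil => rfl
  | cons i I ih =>
    simp only [List.foldr_cons, ih]
    exact hsmul i z _ (foldr_contDiff hd I hf)

lemma smooth_diffAt {n : ℕ} {f : Phase n → ℂ} (hf : ContDiff ℝ ∞ f) (p : Phase n) :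
    DifferentiableAt ℝ f p := (hf.differentiable (by simp)) p

lemma iterD_add {n : ℕ} (I J : List (Fin n)) {f g : Phase n → ℂ}
    (hf : ContDiff ℝ ∞ f) (hg : ContDiff ℝ ∞ g) :
    iterD I J (f + g) = iterD I J f + iterD I J g := by
  unfold iterD
  rw [foldr_add (fun i f => dXi_contDiff i) _ J hf hg,
    foldr_add (fun i f => dX_contDiff i) _ I
      (foldr_contDiff (fun i f => dXi_contDiff i) J hf)
      (foldr_contDiff (fun i f => dXi_contDiff i) J hg)]
  all_goals
    intro i f g hf hg
    ext p
    simp [dX, dXi, fderiv_add (smooth_diffAt hf p) (smooth_diffAt hg p)]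

lemma iterD_smul {n : ℕ} (I J : List (Fin n)) (z : ℂ) {f : Phase n → ℂ}
    (hf : ContDiff ℝ ∞ f) : iterD I J (z • f) = z • iterD I J f := by
  unfold iterD
  rw [foldr_smul (fun i f => dXi_contDiff i) _ J z hf,
    foldr_smul (fun i f => dX_contDiff i) _ I z
      (foldr_contDiff (fun i f => dXi_contDiff i) J hf)]
  all_goals
    intro i z f hf
    ext p
    simp [dX, dXi, fderiv_const_smul (smooth_diffAt hf p) z]

/-! ### Symbol classes -/

/-- The (not necessarily classical) SG-symbols of order `m = (m_e, m_ψ)`. -/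
noncomputable def Symb (n : ℕ) (m : ℝ × ℝ) : Submodule ℂ (Phase n → ℂ) where
  carrier := {a | ContDiff ℝ ∞ a ∧ ∀ I J : List (Fin n), ∃ C : ℝ, ∀ x ξ : Pos n,
    ‖iterD I J a (x, ξ)‖ ≤ C * jap x ^ (m.1 - I.length) * jap ξ ^ (m.2 - J.length)}
  add_mem' := by
    rintro a b ⟨ha, ha'⟩ ⟨hb, hb'⟩
    refine ⟨ha.add hb, fun I J => ?_⟩
    obtain ⟨C, hC⟩ := ha' I J
    obtain ⟨D, hD⟩ := hb' I J
    refine ⟨C + D, fun x ξ => ?_⟩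
    rw [iterD_add I J ha hb, add_mul, add_mul]
    exact (norm_add_le _ _).trans (add_le_add (hC x ξ) (hD x ξ))
  zero_mem' := by
    refine ⟨contDiff_const, fun I J => ⟨0, fun x ξ => ?_⟩⟩
    have h : iterD I J (0 : Phase n → ℂ) = 0 := by
      have := iterD_smul I J 0 (f := (0 : Phase n → ℂ)) contDiff_const
      simpa using this
    simp [h]
  smul_mem' := by
    rintro z a ⟨ha, ha'⟩
    refine ⟨ha.const_smul z, fun I J => ?_⟩
    obtain ⟨C, hC⟩ := ha' I J
    refine ⟨‖z‖ * C, fun x ξ => ?_⟩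
    rw [iterD_smul I J z ha, Pi.smul_apply, norm_smul, mul_assoc, mul_assoc, ← mul_assoc C]
    exact mul_le_mul_of_nonneg_left (hC x ξ) (norm_nonneg z)

/-- Functions that are homogeneous of degree `s` in `x` for large `|x|`. -/
def EvHomE (n : ℕ) (s : ℝ) : Submodule ℂ (Phase n → ℂ) where
  carrier := {a | ∃ c > (0 : ℝ), ∀ t : ℝ, 1 ≤ t → ∀ x ξ : Pos n, c < ‖x‖ →
    a (t • x, ξ) = ((t ^ s : ℝ) : ℂ) * a (x, ξ)}
  add_mem' := by
    rintro a b ⟨c, hc, ha⟩ ⟨d, hd, hb⟩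
    refine ⟨max c d, lt_max_of_lt_left hc, fun t ht x ξ hx => ?_⟩
    simp only [Pi.add_apply]
    rw [ha t ht x ξ ((le_max_left _ _).trans_lt hx), hb t ht x ξ ((le_max_right _ _).trans_lt hx)]
    ring
  zero_mem' := ⟨1, one_pos, by simp⟩
  smul_mem' := by
    rintro z a ⟨c, hc, ha⟩
    refine ⟨c, hc, fun t ht x ξ hx => ?_⟩
    simp only [Pi.smul_apply, smul_eq_mul]
    rw [ha t ht x ξ hx]
    ring

/-- Functions that are homogeneous of degree `s` in `ξ` for large `|ξ|`. -/
def EvHomPsi (n : ℕ) (s : ℝ) : Submodule ℂ (Phase n → ℂ) where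
  carrier := {a | ∃ c > (0 : ℝ), ∀ t : ℝ, 1 ≤ t → ∀ x ξ : Pos n, c < ‖ξ‖ →
    a (x, t • ξ) = ((t ^ s : ℝ) : ℂ) * a (x, ξ)}
  add_mem' := by
    rintro a b ⟨c, hc, ha⟩ ⟨d, hd, hb⟩
    refine ⟨max c d, lt_max_of_lt_left hc, fun t ht x ξ hx => ?_⟩
    simp only [Pi.add_apply]
    rw [ha t ht x ξ ((le_max_left _ _).trans_lt hx), hb t ht x ξ ((le_max_right _ _).trans_lt hx)]
    ring
  zero_mem' := ⟨1, one_pos, by simp⟩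
  smul_mem' := by
    rintro z a ⟨c, hc, ha⟩
    refine ⟨c, hc, fun t ht x ξ hx => ?_⟩
    simp only [Pi.smul_apply, smul_eq_mul]
    rw [ha t ht x ξ hx]
    ring

/-- Functions that are bi-homogeneous of degree `m` where `|x|` and `|ξ|` are both large. -/
def EvHomBi (n : ℕ) (m : ℝ × ℝ) : Submodule ℂ (Phase n → ℂ) where
  carrier := {a | ∃ c > (0 : ℝ), ∀ s t : ℝ, 1 ≤ s → 1 ≤ t → ∀ x ξ : Pos n, c < ‖x‖ → c < ‖ξ‖ →
    a (s • x, t • ξ) = ((s ^ m.1 * t ^ m.2 : ℝ) : ℂ) * a (x, ξ)}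
  add_mem' := by
    rintro a b ⟨c, hc, ha⟩ ⟨d, hd, hb⟩
    refine ⟨max c d, lt_max_of_lt_left hc, fun s t hs ht x ξ hx hξ => ?_⟩
    simp only [Pi.add_apply]
    rw [ha s t hs ht x ξ ((le_max_left _ _).trans_lt hx) ((le_max_left _ _).trans_lt hξ),
      hb s t hs ht x ξ ((le_max_right _ _).trans_lt hx) ((le_max_right _ _).trans_lt hξ)]
    ring
  zero_mem' := ⟨1, one_pos, by simp⟩
  smul_mem' := by
    rintro z a ⟨c, hc, ha⟩
    refine ⟨c, hc, fun s t hs ht x ξ hx hξ => ?_⟩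
    simp only [Pi.smul_apply, smul_eq_mul]
    rw [ha s t hs ht x ξ hx hξ]
    ring

/-- The elements `a` of `P` that have an asymptotic expansion with `k`-th term in `T k` and with
remainder `a - ∑_{k ≤ N} a_k` in `R N` for every `N`. -/
def Expands {n : ℕ} (P : Submodule ℂ (Phase n → ℂ)) (T R : ℕ → Submodule ℂ (Phase n → ℂ)) :
    Submodule ℂ (Phase n → ℂ) where
  carrier := {a | a ∈ P ∧ ∃ s : ℕ → Phase n → ℂ, (∀ k, s k ∈ T k) ∧
    ∀ N : ℕ, a - ∑ k ∈ Finset.range (N + 1), s k ∈ R N}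
  add_mem' := by
    rintro a b ⟨ha, s, hs, hs'⟩ ⟨hb, t, ht, ht'⟩
    refine ⟨P.add_mem ha hb, s + t, fun k => (T k).add_mem (hs k) (ht k), fun N => ?_⟩
    have : a + b - ∑ k ∈ Finset.range (N + 1), (s + t) k
        = (a - ∑ k ∈ Finset.range (N + 1), s k) + (b - ∑ k ∈ Finset.range (N + 1), t k) := by
      simp only [Pi.add_apply, Finset.sum_add_distrib]
      abel
    rw [this]
    exact (R N).add_mem (hs' N) (ht' N)
  zero_mem' := ⟨P.zero_mem, 0, fun k => (T k).zero_mem, fun N => by simp⟩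
  smul_mem' := by
    rintro z a ⟨ha, s, hs, hs'⟩
    refine ⟨P.smul_mem z ha, z • s, fun k => (T k).smul_mem z (hs k), fun N => ?_⟩
    have : z • a - ∑ k ∈ Finset.range (N + 1), (z • s) k
        = z • (a - ∑ k ∈ Finset.range (N + 1), s k) := by
      simp only [Pi.smul_apply, smul_sub, Finset.smul_sum]
    rw [this]
    exact (R N).smul_mem z (hs' N)

/-- `SG^{[m_e], m_ψ}_{cl(ψ)}`. -/
noncomputable def SGHomEClPsi (n : ℕ) (m : ℝ × ℝ) : Submodule ℂ (Phase n → ℂ) :=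
  Expands (EvHomE n m.1 ⊓ Symb n m)
    (fun k => EvHomBi n (m.1, m.2 - k) ⊓ Symb n (m.1, m.2 - k))
    (fun N => Symb n (m.1, m.2 - N - 1))

/-- `SG^{m_e, m_ψ}_{cl(ψ)}`. -/
noncomputable def SGClPsi (n : ℕ) (m : ℝ × ℝ) : Submodule ℂ (Phase n → ℂ) :=
  Expands (Symb n m)
    (fun k => EvHomPsi n (m.2 - k) ⊓ Symb n (m.1, m.2 - k))
    (fun N => Symb n (m.1, m.2 - N - 1))

/-- `SG^{m_e, [m_ψ]}_{cl(e)}`. -/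
noncomputable def SGHomPsiClE (n : ℕ) (m : ℝ × ℝ) : Submodule ℂ (Phase n → ℂ) :=
  Expands (EvHomPsi n m.2 ⊓ Symb n m)
    (fun k => EvHomBi n (m.1 - k, m.2) ⊓ Symb n (m.1 - k, m.2))
    (fun N => Symb n (m.1 - N - 1, m.2))

/-- `SG^{m_e, m_ψ}_{cl(e)}`. -/
noncomputable def SGClE (n : ℕ) (m : ℝ × ℝ) : Submodule ℂ (Phase n → ℂ) :=
  Expands (Symb n m)
    (fun k => EvHomE n (m.1 - k) ⊓ Symb n (m.1 - k, m.2))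
    (fun N => Symb n (m.1 - N - 1, m.2))

/-- The space `SG^m` of classical SG-symbols of order `m = (m_e, m_ψ)`. -/
noncomputable def SG (n : ℕ) (m : ℝ × ℝ) : Submodule ℂ (Phase n → ℂ) :=
  Expands (Symb n m) (fun k => SGHomPsiClE n (m.1, m.2 - k)) (fun N => SGClE n (m.1, m.2 - N - 1))
  ⊓
  Expands (Symb n m) (fun k => SGHomEClPsi n (m.1 - k, m.2)) (fun N => SGClPsi n (m.1 - N - 1, m.2))

/-- The space spanned by the classical symbols of orders in `ℤ²`. -/
noncomputable def SGInt (n : ℕ) : Submodule ℂ (Phase n → ℂ) :=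
  ⨆ m : ℤ × ℤ, SG n ((m.1 : ℝ), (m.2 : ℝ))

/-- The space spanned by the classical symbols of all orders in `ℝ²`. -/
noncomputable def SGReal (n : ℕ) : Submodule ℂ (Phase n → ℂ) :=
  ⨆ m : ℝ × ℝ, SG n m

/-- `SymG^m = SG^m / SG^{m - 𝟙}`. -/
abbrev SymG (n : ℕ) (m : ℝ × ℝ) : Type :=
  (SG n m) ⧸ (SG n (m - oneOne)).submoduleOf (SG n m)

/-- The class of a symbol in `SymG^m` (the principal symbol map). -/
noncomputable def symCls {n : ℕ} {m : ℝ × ℝ} (a : SG n m) : SymG n m :=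
  Submodule.Quotient.mk a

/-! ### Principal symbols -/

/-- `𝓗_e^{(s)}`: smooth for `x ≠ 0` and homogeneous of degree `s` in `x`. -/
def IsHomE {n : ℕ} (s : ℝ) (f : Phase n → ℂ) : Prop :=
  ContDiffOn ℝ ∞ f {p | p.1 ≠ 0} ∧ ∀ t : ℝ, 0 < t → ∀ x ξ : Pos n, x ≠ 0 →
    f (t • x, ξ) = ((t ^ s : ℝ) : ℂ) * f (x, ξ)

/-- `𝓗_ψ^{(s)}`: smooth for `ξ ≠ 0` and homogeneous of degree `s` in `ξ`. -/
def IsHomPsi {n : ℕ} (s : ℝ) (f : Phase n → ℂ) : Prop :=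
  ContDiffOn ℝ ∞ f {p | p.2 ≠ 0} ∧ ∀ t : ℝ, 0 < t → ∀ x ξ : Pos n, ξ ≠ 0 →
    f (x, t • ξ) = ((t ^ s : ℝ) : ℂ) * f (x, ξ)

/-- `𝓗^{(m)}`: smooth for `x ≠ 0`, `ξ ≠ 0` and bi-homogeneous of degree `m`. -/
def IsHomBi {n : ℕ} (m : ℝ × ℝ) (f : Phase n → ℂ) : Prop :=
  ContDiffOn ℝ ∞ f {p | p.1 ≠ 0 ∧ p.2 ≠ 0} ∧
    ∀ s t : ℝ, 0 < s → 0 < t → ∀ x ξ : Pos n, x ≠ 0 → ξ ≠ 0 →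
      f (s • x, t • ξ) = ((s ^ m.1 * t ^ m.2 : ℝ) : ℂ) * f (x, ξ)

/-- `σ_e^s(a)(x, ξ) = lim_{μ → ∞} μ^{-s} a(μ x, ξ)`; meaningful for `x ≠ 0` only. -/
noncomputable def sigmaE {n : ℕ} (s : ℝ) (a : Phase n → ℂ) : Phase n → ℂ :=
  fun p => limUnder atTop fun μ : ℝ => ((μ ^ (-s) : ℝ) : ℂ) * a (μ • p.1, p.2)

/-- `σ_ψ^s(a)(x, ξ) = lim_{μ → ∞} μ^{-s} a(x, μ ξ)`; meaningful for `ξ ≠ 0` only. -/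
noncomputable def sigmaPsi {n : ℕ} (s : ℝ) (a : Phase n → ℂ) : Phase n → ℂ :=
  fun p => limUnder atTop fun μ : ℝ => ((μ ^ (-s) : ℝ) : ℂ) * a (p.1, μ • p.2)

/-- `σ_{ψe}^m = σ_e^{m_e} ∘ σ_ψ^{m_ψ}`; meaningful for `x ≠ 0`, `ξ ≠ 0` only. -/
noncomputable def sigmaPsiE {n : ℕ} (m : ℝ × ℝ) (a : Phase n → ℂ) : Phase n → ℂ :=
  sigmaE m.1 (sigmaPsi m.2 a)

/-- `f` is the exit principal symbol of `a`: it is homogeneous of degree `m_e` in `x`, and for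
large `|x|` it coincides with a leading term of the exit expansion of `a`. -/
def HasExitSymbol {n : ℕ} (m : ℝ × ℝ) (a f : Phase n → ℂ) : Prop :=
  IsHomE m.1 f ∧ ∃ b ∈ SGHomEClPsi n m, a - b ∈ SGClPsi n (m.1 - 1, m.2) ∧
    ∃ c > (0 : ℝ), ∀ x ξ : Pos n, c < ‖x‖ → b (x, ξ) = f (x, ξ)

/-- `f` is the pseudo-differential principal symbol of `a`: it is homogeneous of degree `m_ψ` in
`ξ`, and for large `|ξ|` it coincides with a leading term of the `ψ`-expansion of `a`. -/
def HasPsiSymbol {n : ℕ} (m : ℝ × ℝ) (a f : Phase n → ℂ) : Prop :=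
  IsHomPsi m.2 f ∧ ∃ b ∈ SGHomPsiClE n m, a - b ∈ SGClE n (m.1, m.2 - 1) ∧
    ∃ c > (0 : ℝ), ∀ x ξ : Pos n, c < ‖ξ‖ → b (x, ξ) = f (x, ξ)

/-! ### Lie brackets -/

/-- A bilinear map is a Lie bracket: it is alternating and satisfies the Jacobi identity. -/
def IsLieBracket {V : Type*} [AddCommGroup V] [Module ℂ V] (B : V →ₗ[ℂ] V →ₗ[ℂ] V) : Prop :=
  (∀ v, B v v = 0) ∧ ∀ u v w, B u (B v w) + B v (B w u) + B w (B u v) = 0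

/-- The Poisson bracket restricts to a Lie algebra structure on the space `S`. -/
def IsPoissonLie {n : ℕ} (S : Submodule ℂ (Phase n → ℂ)) : Prop :=
  ∃ B : S →ₗ[ℂ] S →ₗ[ℂ] S, (∀ a b : S, (B a b : Phase n → ℂ) = poisson (a : Phase n → ℂ) b) ∧
    IsLieBracket B

/-- `S` is a (unital) subalgebra of `C^∞(ℝⁿ × ℝⁿ)` for the pointwise product. -/
def IsSmoothSubalgebra {n : ℕ} (S : Submodule ℂ (Phase n → ℂ)) : Prop :=
  (∀ a ∈ S, ContDiff ℝ ∞ a) ∧ (1 : Phase n → ℂ) ∈ S ∧ ∀ a ∈ S, ∀ b ∈ S, a * b ∈ S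

/-- The Poisson bracket is a derivation of the pointwise product in both arguments, on `S`. -/
def IsPoissonBiderivation {n : ℕ} (S : Submodule ℂ (Phase n → ℂ)) : Prop :=
  ∀ a ∈ S, ∀ b ∈ S, ∀ c ∈ S,
    poisson a (b * c) = poisson a b * c + b * poisson a c ∧
    poisson (a * b) c = poisson a c * b + a * poisson b c

/-- `B` is the Lie bracket on `SymG^m` that is induced by the Poisson bracket of `SG^m`. -/
def IsInducedPoisson {n : ℕ} {m : ℝ × ℝ} (B : SymG n m →ₗ[ℂ] SymG n m →ₗ[ℂ] SymG n m) : Prop :=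
  IsLieBracket B ∧ ∀ a b : SG n m, ∃ h : poisson (a : Phase n → ℂ) b ∈ SG n m,
    B (symCls a) (symCls b) = symCls ⟨poisson (a : Phase n → ℂ) b, h⟩

/-! ### Pseudo-differential operators -/

/-- `Op(a)u(x) = (2π)^{-n} ∫ (∫ e^{i(x-y)·ξ} a(x, ξ) u(y) dy) dξ`. -/
noncomputable def opApply {n : ℕ} (a : Phase n → ℂ) (u : 𝓢(Pos n, ℂ)) (x : Pos n) : ℂ :=
  ((2 * Real.pi : ℝ) : ℂ)⁻¹ ^ n *
    ∫ ξ : Pos n, ∫ y : Pos n, cexp (I * ((inner ℝ (x - y) ξ : ℝ) : ℂ)) * a (x, ξ) * u y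

/-- `A = Op(a)` as an operator on the Schwartz space. -/
def IsOp {n : ℕ} (a : Phase n → ℂ) (A : Module.End ℂ 𝓢(Pos n, ℂ)) : Prop :=
  ∀ (u : 𝓢(Pos n, ℂ)) (x : Pos n), A u x = opApply a u x

lemma inner_integral {n : ℕ} (a : Phase n → ℂ) (u : 𝓢(Pos n, ℂ)) (x ξ : Pos n) :
    ∫ y : Pos n, cexp (I * ((inner ℝ (x - y) ξ : ℝ) : ℂ)) * a (x, ξ) * u y =
      cexp (I * ((inner ℝ x ξ : ℝ) : ℂ)) * a (x, ξ) *
        FourierTransform.fourier u ((2 * Real.pi)⁻¹ • ξ) := by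
  rw [SchwartzMap.fourier_coe, Real.fourier_eq', ← integral_const_mul]
  refine integral_congr_ae (Eventually.of_forall fun y => ?_)
  simp only [smul_eq_mul, inner_sub_left, inner_smul_right]
  have h : ((-2 * Real.pi * ((2 * Real.pi)⁻¹ * inner ℝ y ξ) : ℝ) : ℂ) = -((inner ℝ y ξ : ℝ) : ℂ) := by
    have : (2 * Real.pi : ℝ) ≠ 0 := by positivity
    rw [← Complex.ofReal_neg]
    congr 1
    field_simp
  rw [h, Complex.ofReal_sub, mul_sub, sub_eq_add_neg, Complex.exp_add]
  have h' : -(I * ((inner ℝ y ξ : ℝ) : ℂ)) = -((inner ℝ y ξ : ℝ) : ℂ) * I := by ring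
  rw [h']
  ring

lemma jap_rpow_le {n : ℕ} (s : ℝ) : ∃ k : ℕ, ∀ ξ : Pos n, jap ξ ^ s ≤ 2 ^ k * (1 + ‖ξ‖ ^ k) := by
  obtain ⟨k, hk⟩ := exists_nat_ge s
  refine ⟨k, fun ξ => ?_⟩
  have h1 : 1 ≤ jap ξ := by
    rw [jap, Real.one_le_sqrt]
    nlinarith [sq_nonneg ‖ξ‖]
  have h2 : jap ξ ≤ 1 + ‖ξ‖ := by
    rw [jap, Real.sqrt_le_left (by positivity)]
    nlinarith [norm_nonneg ξ]
  have h3 : jap ξ ^ s ≤ jap ξ ^ k := by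
    rw [← Real.rpow_natCast]
    exact Real.rpow_le_rpow_of_exponent_le h1 hk
  refine h3.trans ((pow_le_pow_left₀ (by linarith) h2 k).trans ?_)
  rcases le_total 1 ‖ξ‖ with h | h
  · calc (1 + ‖ξ‖) ^ k ≤ (2 * ‖ξ‖) ^ k := pow_le_pow_left₀ (by positivity) (by linarith) k
      _ = 2 ^ k * ‖ξ‖ ^ k := mul_pow _ _ _
      _ ≤ 2 ^ k * (1 + ‖ξ‖ ^ k) := by gcongr; linarith
  · calc (1 + ‖ξ‖) ^ k ≤ 2 ^ k := pow_le_pow_left₀ (by positivity) (by linarith) k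
      _ ≤ 2 ^ k * (1 + ‖ξ‖ ^ k) := le_mul_of_one_le_right (by positivity)
          (by have := pow_nonneg (norm_nonneg ξ) k; linarith)

lemma op_integrable {n : ℕ} {m : ℝ × ℝ} {a : Phase n → ℂ} (ha : a ∈ Symb n m)
    (u : 𝓢(Pos n, ℂ)) (x : Pos n) :
    Integrable fun ξ : Pos n =>
      ∫ y : Pos n, cexp (I * ((inner ℝ (x - y) ξ : ℝ) : ℂ)) * a (x, ξ) * u y := by
  simp_rw [inner_integral]
  obtain ⟨hs, hb⟩ := ha
  obtain ⟨C, hC⟩ := hb [] []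
  obtain ⟨k, hk⟩ := jap_rpow_le (n := n) m.2
  have hπ : ((2 * Real.pi)⁻¹ : ℝ) ≠ 0 := by positivity
  let g : Pos n ≃L[ℝ] Pos n := ContinuousLinearEquiv.smulLeft (Units.mk0 ((2 * Real.pi)⁻¹ : ℝ) hπ)
  let v : 𝓢(Pos n, ℂ) :=
    SchwartzMap.compCLMOfContinuousLinearEquiv ℂ g (FourierTransform.fourier u)
  have hv : ∀ ξ, FourierTransform.fourier u ((2 * Real.pi)⁻¹ • ξ) = v ξ := fun ξ => rfl
  simp_rw [hv]
  have hi : Integrable fun ξ : Pos n =>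
      (|C| * jap x ^ m.1 * 2 ^ k) * (‖ξ‖ ^ 0 * ‖v ξ‖ + ‖ξ‖ ^ k * ‖v ξ‖) :=
    ((v.integrable_pow_mul volume 0).add (v.integrable_pow_mul volume k)).const_mul _
  refine hi.mono' ?_ (Eventually.of_forall fun ξ => ?_)
  · have hc : Continuous fun ξ : Pos n => a (x, ξ) := hs.continuous.comp (by fun_prop)
    have hvc : Continuous fun ξ : Pos n => v ξ := v.continuous
    exact (by fun_prop : Continuous _).aestronglyMeasurable
  · have hn : ‖cexp (I * ((inner ℝ x ξ : ℝ) : ℂ))‖ = 1 := by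
      rw [mul_comm]; exact Complex.norm_exp_ofReal_mul_I _
    rw [norm_mul, norm_mul, hn, one_mul]
    have h1 : ‖a (x, ξ)‖ ≤ |C| * jap x ^ m.1 * (2 ^ k * (1 + ‖ξ‖ ^ k)) := by
      have h := hC x ξ
      simp only [iterD, List.foldr_nil, List.length_nil, Nat.cast_zero, sub_zero] at h
      have hx : 0 ≤ jap x ^ m.1 := Real.rpow_nonneg (jap_pos x).le _
      have hξ : 0 ≤ jap ξ ^ m.2 := Real.rpow_nonneg (jap_pos ξ).le _
      calc ‖a (x, ξ)‖ ≤ C * jap x ^ m.1 * jap ξ ^ m.2 := h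
        _ ≤ |C| * jap x ^ m.1 * jap ξ ^ m.2 := by gcongr; exact le_abs_self C
        _ ≤ _ := by gcongr; exact hk ξ
    calc ‖a (x, ξ)‖ * ‖v ξ‖ ≤ |C| * jap x ^ m.1 * (2 ^ k * (1 + ‖ξ‖ ^ k)) * ‖v ξ‖ := by gcongr
      _ = _ := by ring

lemma opApply_add {n : ℕ} {m : ℝ × ℝ} {a b : Phase n → ℂ} (ha : a ∈ Symb n m) (hb : b ∈ Symb n m)
    (u : 𝓢(Pos n, ℂ)) (x : Pos n) :
    opApply (a + b) u x = opApply a u x + opApply b u x := by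
  unfold opApply
  rw [← mul_add, ← integral_add (op_integrable ha u x) (op_integrable hb u x)]
  congr 2
  ext ξ
  simp_rw [inner_integral, Pi.add_apply]
  ring

lemma opApply_smul {n : ℕ} (z : ℂ) (a : Phase n → ℂ) (u : 𝓢(Pos n, ℂ)) (x : Pos n) :
    opApply (z • a) u x = z * opApply a u x := by
  unfold opApply
  simp_rw [inner_integral]
  rw [mul_left_comm z, ← integral_const_mul z]
  simp only [Pi.smul_apply, smul_eq_mul, mul_assoc, mul_left_comm _ z]

lemma SG_le_Symb {n : ℕ} {m : ℝ × ℝ} {a : Phase n → ℂ} (ha : a ∈ SG n m) : a ∈ Symb n m :=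
  ha.1.1

/-- The space `LG^m` of operators `Op(a)`, `a ∈ SG^m`, on the Schwartz space. -/
noncomputable def LG (n : ℕ) (m : ℝ × ℝ) : Submodule ℂ (Module.End ℂ 𝓢(Pos n, ℂ)) where
  carrier := {A | ∃ a ∈ SG n m, IsOp a A}
  add_mem' := by
    rintro A B ⟨a, ha, hA⟩ ⟨b, hb, hB⟩
    refine ⟨a + b, (SG n m).add_mem ha hb, fun u x => ?_⟩
    rw [opApply_add (SG_le_Symb ha) (SG_le_Symb hb), ← hA, ← hB]
    rfl
  zero_mem' := ⟨0, (SG n m).zero_mem, fun u x => by simp [opApply]⟩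
  smul_mem' := by
    rintro z A ⟨a, ha, hA⟩
    refine ⟨z • a, (SG n m).smul_mem z ha, fun u x => ?_⟩
    rw [opApply_smul, ← hA]
    rfl

/-- The commutator restricts to a Lie algebra structure on the space `S` of operators. -/
def IsCommutatorLie {n : ℕ} (S : Submodule ℂ (Module.End ℂ 𝓢(Pos n, ℂ))) : Prop :=
  ∃ B : S →ₗ[ℂ] S →ₗ[ℂ] S, (∀ P Q : S, (B P Q).1 = P.1 * Q.1 - Q.1 * P.1) ∧ IsLieBracket B

/-- `LG^𝟙 / LG^0`. -/
abbrev LGQuot (n : ℕ) : Type := (LG n oneOne) ⧸ (LG n 0).submoduleOf (LG n oneOne)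

/-- The class of an operator in `LG^𝟙 / LG^0`. -/
noncomputable def opCls {n : ℕ} (A : LG n oneOne) : LGQuot n := Submodule.Quotient.mk A

/-- `B` is the Lie bracket on `LG^𝟙 / LG^0` that is induced by the commutator of `LG^𝟙`. -/
def IsInducedCommutator {n : ℕ} (B : LGQuot n →ₗ[ℂ] LGQuot n →ₗ[ℂ] LGQuot n) : Prop :=
  IsLieBracket B ∧ ∀ P Q : LG n oneOne,
    ∃ h : P.1 * Q.1 - Q.1 * P.1 ∈ LG n oneOne,
      B (opCls P) (opCls Q) = opCls ⟨P.1 * Q.1 - Q.1 * P.1, h⟩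

end SGCalc

/-! ### Symbol estimates, one derivative at a time -/

namespace SGCalc

variable {n : ℕ}

/-! ### The bracket `⟨x⟩` -/

/-! On the symbol side the argument is formal once expansions are treated abstractly. `ExpF P T R d`
consists of elements of `P` with terms in `T` and remainders in `R`, with orders falling along `d`.
Cauchy products and termwise differentiation show that it inherits stability under products and
coordinate derivatives from `P`, `T` and `R`. The four auxiliary classical spaces are of this form,
and `SG` is an intersection of two such spaces built on them, so two passes give `SG.mulMaps` and
`SG.allDerivMaps`. One point needs care: the terms of a `ψ`-expansion in `SG` are not visibly
classical in `x`. They are differences of consecutive remainders, which are (`SG_eq`). A Poisson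
bracket is a sum of products of one `x`- and one `ξ`-derivative, so its order falls by `(1, 1)`.

For principal symbols, write `a = b + r` with `b` homogeneous for large argument and `r` one order
lower. The limit then equals `μ^{-s} b(μ x, ξ)` for every sufficiently large finite `μ`, locally
uniformly in the point. So a principal symbol is locally a rescaled smooth symbol, and smoothness
and compatibility with brackets follow without differentiating a limit.

On the operator side, the key object is the interpolation `comp a b (t, (x, ξ)) = ∬ e^{-2πi y·η}
a(x, ξ + 2πη) b(x + t y, ξ) dy dη`. It is made convergent by inserting `⟨y⟩^{-2L}` and compensating
with `(1 - Δ_ξ)^L` on `a`. At `t = 1` it is the symbol of `Op(a) Op(b)` (`opApply_comp`), at `t = 0`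
it is `a b` (`comp_zero`), and `∂_t comp a b = -i ∑ⱼ comp (∂_{ξⱼ} a) (∂_{xⱼ} b)`
(`comp_hasDerivAt`). Taylor expansion in `t` thus has remainders of the same kind with both orders
lowered. The mean value inequality bounds their size, and the Leibniz rule (`IsLeibniz.symb`) turns
size bounds into full symbol estimates. By `SG.asymptotic` the composite is classical.

Consequently `[Op(a), Op(b)]` has symbol `-i {a, b}` modulo `SG^0` for orders `(1, 1)`. Quantisation
is injective (`eq_zero_of_opApply`), so symbols and operators may be identified, and the sign in
`Op(a) ↦ -a` turns `-i` into `i`. -/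

lemma one_le_jap (x : Pos n) : 1 ≤ jap x := by
  rw [jap, Real.one_le_sqrt]
  nlinarith [sq_nonneg ‖x‖]

lemma jap_sq (x : Pos n) : jap x ^ 2 = 1 + ‖x‖ ^ 2 := Real.sq_sqrt (by positivity)

lemma jap_nonneg (x : Pos n) : 0 ≤ jap x := (jap_pos x).le

lemma jap_rpow_pos (x : Pos n) (s : ℝ) : 0 < jap x ^ s := Real.rpow_pos_of_pos (jap_pos x) s

lemma norm_le_jap (x : Pos n) : ‖x‖ ≤ jap x :=
  Real.le_sqrt_of_sq_le (by linarith)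

lemma jap_le_one_add (x : Pos n) : jap x ≤ 1 + ‖x‖ := by
  rw [jap, Real.sqrt_le_left (by positivity)]
  nlinarith [norm_nonneg x]

lemma jap_rpow_mono (x : Pos n) {s t : ℝ} (h : s ≤ t) : jap x ^ s ≤ jap x ^ t :=
  Real.rpow_le_rpow_of_exponent_le (one_le_jap x) h

lemma jap_continuous : Continuous (jap : Pos n → ℝ) := by
  unfold jap; fun_prop

lemma jap_rpow_continuous (s : ℝ) : Continuous fun x : Pos n => jap x ^ s :=
  jap_continuous.rpow_const fun x => Or.inl (jap_pos x).ne'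

/-! ### Directional derivatives on phase space -/

/-- The derivative in the direction of `v`. -/
noncomputable def dV (v : Phase n) (f : Phase n → ℂ) : Phase n → ℂ := fun p => fderiv ℝ f p v

lemma dX_eq_dV (i : Fin n) : (dX i : (Phase n → ℂ) → _) = dV (EuclideanSpace.single i 1, 0) := rfl

lemma dXi_eq_dV (i : Fin n) : (dXi i : (Phase n → ℂ) → _) = dV (0, EuclideanSpace.single i 1) := rfl

lemma dV_contDiff (v : Phase n) {f : Phase n → ℂ} (hf : ContDiff ℝ ∞ f) : ContDiff ℝ ∞ (dV v f) :=
  (hf.fderiv_right (m := ∞) (by simp)).clm_apply contDiff_const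

lemma dV_mul (v : Phase n) {f g : Phase n → ℂ} (hf : ContDiff ℝ ∞ f) (hg : ContDiff ℝ ∞ g) :
    dV v (f * g) = dV v f * g + f * dV v g := by
  ext p
  simp [dV, fderiv_mul (smooth_diffAt hf p) (smooth_diffAt hg p)]
  ring

lemma dV_add (v : Phase n) {f g : Phase n → ℂ} (hf : ContDiff ℝ ∞ f) (hg : ContDiff ℝ ∞ g) :
    dV v (f + g) = dV v f + dV v g := by
  ext p
  simp [dV, fderiv_add (smooth_diffAt hf p) (smooth_diffAt hg p)]

lemma dV_sub (v : Phase n) {f g : Phase n → ℂ} (hf : ContDiff ℝ ∞ f) (hg : ContDiff ℝ ∞ g) :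
    dV v (f - g) = dV v f - dV v g := by
  ext p
  simp [dV, fderiv_sub (smooth_diffAt hf p) (smooth_diffAt hg p)]

lemma dV_smul (v : Phase n) (z : ℂ) {f : Phase n → ℂ} (hf : ContDiff ℝ ∞ f) :
    dV v (z • f) = z • dV v f := by
  ext p
  simp [dV, fderiv_const_smul (smooth_diffAt hf p) z]

lemma dV_zero (v : Phase n) : dV v (0 : Phase n → ℂ) = 0 := by
  ext p
  have : (0 : Phase n → ℂ) = fun _ => (0 : ℂ) := rfl
  simp [dV, this]

lemma dV_sum {ι : Type*} (s : Finset ι) (v : Phase n) {f : ι → Phase n → ℂ}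
    (hf : ∀ i, ContDiff ℝ ∞ (f i)) : dV v (∑ i ∈ s, f i) = ∑ i ∈ s, dV v (f i) := by
  ext p
  simp only [dV, Finset.sum_apply]
  rw [fderiv_sum fun i _ => smooth_diffAt (hf i) p]
  simp

lemma dV_comm (v w : Phase n) {f : Phase n → ℂ} (hf : ContDiff ℝ ∞ f) :
    dV v (dV w f) = dV w (dV v f) := by
  ext p
  have hd : DifferentiableAt ℝ (fderiv ℝ f) p :=
    ((hf.fderiv_right (m := ∞) (by simp)).differentiable (by simp)) p
  have h : ∀ v w : Phase n, dV v (dV w f) p = fderiv ℝ (fderiv ℝ f) p v w := by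
    intro v w
    change fderiv ℝ (fun y => fderiv ℝ f y w) p v = _
    rw [fderiv_clm_apply hd (differentiableAt_const w)]
    simp
  rw [h, h]
  refine (hf.contDiffAt.isSymmSndFDerivAt ?_) v w
  rw [minSmoothness_of_isRCLikeNormedField]
  exact WithTop.coe_le_coe.2 (le_top (a := (2 : ℕ∞)))

lemma smooth_sum {ι : Type*} (s : Finset ι) {f : ι → Phase n → ℂ}
    (hf : ∀ i, ContDiff ℝ ∞ (f i)) : ContDiff ℝ ∞ (∑ i ∈ s, f i) := by
  have : (∑ i ∈ s, f i) = fun p => ∑ i ∈ s, f i p := by ext p; simp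
  rw [this]
  exact ContDiff.sum fun i _ => hf i

/-! ### Symbols through first derivatives -/

/-- The shift `(1, 0)` of orders. -/
abbrev e₁ : ℝ × ℝ := (1, 0)

/-- The shift `(0, 1)` of orders. -/
abbrev e₂ : ℝ × ℝ := (0, 1)

/-- The zeroth symbol estimate of order `m`. -/
def SymbBound (m : ℝ × ℝ) (a : Phase n → ℂ) : Prop :=
  ∃ C : ℝ, ∀ x ξ : Pos n, ‖a (x, ξ)‖ ≤ C * jap x ^ m.1 * jap ξ ^ m.2

/-- The symbol estimates of order `m` for up to `N` derivatives. -/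
def SymbBounds : ℕ → ℝ × ℝ → (Phase n → ℂ) → Prop
  | 0, m, a => SymbBound m a
  | N + 1, m, a => SymbBound m a ∧
      ∀ i, SymbBounds N (m - e₁) (dX i a) ∧ SymbBounds N (m - e₂) (dXi i a)

lemma SymbBound.exists_nonneg {m : ℝ × ℝ} {a : Phase n → ℂ} (h : SymbBound m a) :
    ∃ C : ℝ, 0 ≤ C ∧ ∀ x ξ : Pos n, ‖a (x, ξ)‖ ≤ C * jap x ^ m.1 * jap ξ ^ m.2 := by
  obtain ⟨C, hC⟩ := h
  refine ⟨|C|, abs_nonneg C, fun x ξ => (hC x ξ).trans ?_⟩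
  have := (jap_rpow_pos x m.1).le
  have := (jap_rpow_pos ξ m.2).le
  gcongr
  exact le_abs_self C

lemma SymbBound.add {m : ℝ × ℝ} {a b : Phase n → ℂ} (ha : SymbBound m a) (hb : SymbBound m b) :
    SymbBound m (a + b) := by
  obtain ⟨C, hC⟩ := ha
  obtain ⟨D, hD⟩ := hb
  refine ⟨C + D, fun x ξ => ?_⟩
  rw [add_mul, add_mul]
  exact (norm_add_le _ _).trans (add_le_add (hC x ξ) (hD x ξ))

lemma SymbBound.mul {m k : ℝ × ℝ} {a b : Phase n → ℂ} (ha : SymbBound m a) (hb : SymbBound k b) :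
    SymbBound (m + k) (a * b) := by
  obtain ⟨C, hC0, hC⟩ := ha.exists_nonneg
  obtain ⟨D, hD0, hD⟩ := hb.exists_nonneg
  refine ⟨C * D, fun x ξ => ?_⟩
  rw [Pi.mul_apply, norm_mul, Prod.fst_add, Prod.snd_add, Real.rpow_add (jap_pos x),
    Real.rpow_add (jap_pos ξ)]
  have := (jap_rpow_pos x m.1).le
  have := (jap_rpow_pos ξ m.2).le
  calc ‖a (x, ξ)‖ * ‖b (x, ξ)‖
      ≤ (C * jap x ^ m.1 * jap ξ ^ m.2) * (D * jap x ^ k.1 * jap ξ ^ k.2) := by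
        gcongr
        · exact hC x ξ
        · exact hD x ξ
    _ = _ := by ring

lemma SymbBound.mono {m k : ℝ × ℝ} (h : m ≤ k) {a : Phase n → ℂ} (ha : SymbBound m a) :
    SymbBound k a := by
  obtain ⟨C, hC0, hC⟩ := ha.exists_nonneg
  refine ⟨C, fun x ξ => (hC x ξ).trans ?_⟩
  have := (jap_rpow_pos x k.1).le
  have := (jap_rpow_pos ξ m.2).le
  exact mul_le_mul (mul_le_mul_of_nonneg_left (jap_rpow_mono x h.1) hC0)
    (jap_rpow_mono ξ h.2) this (by positivity)

lemma SymbBounds.add {N : ℕ} {m : ℝ × ℝ} {a b : Phase n → ℂ} (ha : ContDiff ℝ ∞ a)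
    (hb : ContDiff ℝ ∞ b) (h : SymbBounds N m a) (h' : SymbBounds N m b) :
    SymbBounds N m (a + b) := by
  induction N generalizing m a b with
  | zero => exact SymbBound.add h h'
  | succ N ih =>
    refine ⟨h.1.add h'.1, fun i => ⟨?_, ?_⟩⟩
    · rw [dX_eq_dV, dV_add _ ha hb]
      exact ih (dV_contDiff _ ha) (dV_contDiff _ hb) (h.2 i).1 (h'.2 i).1
    · rw [dXi_eq_dV, dV_add _ ha hb]
      exact ih (dV_contDiff _ ha) (dV_contDiff _ hb) (h.2 i).2 (h'.2 i).2

/-- The innermost `x`-derivative must be moved past all `ξ`-derivatives, by symmetry of second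
derivatives. Splitting off the innermost derivative lets the remaining word act on the symbol `dX i
a`. -/
lemma iterD_concat_left (I J : List (Fin n)) (i : Fin n) {a : Phase n → ℂ}
    (ha : ContDiff ℝ ∞ a) : iterD (I ++ [i]) J a = iterD I J (dX i a) := by
  simp only [iterD, List.foldr_append, List.foldr_cons, List.foldr_nil]
  congr 1
  induction J with
  | nil => rfl
  | cons j J ih =>
    simp only [List.foldr_cons]
    rw [← ih]
    exact dV_comm _ _ (foldr_contDiff (fun i f => dXi_contDiff i) J ha)

lemma iterD_concat_right (J : List (Fin n)) (I : List (Fin n)) (j : Fin n) (a : Phase n → ℂ) :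
    iterD I (J ++ [j]) a = iterD I J (dXi j a) := by
  simp [iterD, List.foldr_append]

lemma Symb.smooth {m : ℝ × ℝ} {a : Phase n → ℂ} (ha : a ∈ Symb n m) : ContDiff ℝ ∞ a := ha.1

lemma Symb.bound {m : ℝ × ℝ} {a : Phase n → ℂ} (ha : a ∈ Symb n m) : SymbBound m a := by
  obtain ⟨C, hC⟩ := ha.2 [] []
  exact ⟨C, fun x ξ => by simpa [iterD] using hC x ξ⟩

lemma Symb.dX {m : ℝ × ℝ} {a : Phase n → ℂ} (ha : a ∈ Symb n m) (i : Fin n) :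
    dX i a ∈ Symb n (m - e₁) := by
  refine ⟨dX_contDiff i ha.1, fun I J => ?_⟩
  obtain ⟨C, hC⟩ := ha.2 (I ++ [i]) J
  refine ⟨C, fun x ξ => ?_⟩
  have := hC x ξ
  rw [iterD_concat_left _ _ _ ha.1] at this
  convert this using 3 <;> simp; ring_nf

lemma Symb.dXi {m : ℝ × ℝ} {a : Phase n → ℂ} (ha : a ∈ Symb n m) (i : Fin n) :
    dXi i a ∈ Symb n (m - e₂) := by
  refine ⟨dXi_contDiff i ha.1, fun I J => ?_⟩
  obtain ⟨C, hC⟩ := ha.2 I (J ++ [i])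
  refine ⟨C, fun x ξ => ?_⟩
  have := hC x ξ
  rw [iterD_concat_right] at this
  convert this using 2
  · simp
  · simp; ring_nf

lemma Symb.bounds {m : ℝ × ℝ} {a : Phase n → ℂ} (ha : a ∈ Symb n m) (N : ℕ) :
    SymbBounds N m a := by
  induction N generalizing m a with
  | zero => exact Symb.bound ha
  | succ N ih => exact ⟨Symb.bound ha, fun i => ⟨ih (Symb.dX ha i), ih (Symb.dXi ha i)⟩⟩

/-- With `Symb.bounds`, this replaces estimates over words by a recursion over single derivatives.
Later symbol estimates become inductions on `N` in which the orders and the symbol are generalised.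
-/
lemma Symb.of_bounds {m : ℝ × ℝ} {a : Phase n → ℂ} (ha : ContDiff ℝ ∞ a)
    (h : ∀ N, SymbBounds N m a) : a ∈ Symb n m := by
  refine ⟨ha, fun I => ?_⟩
  induction I using List.reverseRecOn generalizing m a with
  | nil =>
    intro J
    induction J using List.reverseRecOn generalizing m a with
    | nil =>
      obtain ⟨C, hC⟩ := h 0
      exact ⟨C, fun x ξ => by simpa [iterD] using hC x ξ⟩
    | append_singleton J j ih =>
      obtain ⟨C, hC⟩ := ih (dXi_contDiff j ha) fun N => ((h (N + 1)).2 j).2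
      refine ⟨C, fun x ξ => ?_⟩
      rw [iterD_concat_right]
      convert hC x ξ using 2
      · simp
      · simp; ring_nf
  | append_singleton I i ih =>
    intro J
    obtain ⟨C, hC⟩ := ih (dX_contDiff i ha) (fun N => ((h (N + 1)).2 i).1) J
    refine ⟨C, fun x ξ => ?_⟩
    rw [iterD_concat_left _ _ _ ha]
    convert hC x ξ using 3 <;> simp; ring_nf

/-- The factors are full symbols and not merely bounded to level `N`: after the product rule one
factor is undifferentiated, and the induction hypothesis must apply to it as well. -/
lemma SymbBounds.mul {N : ℕ} {m k : ℝ × ℝ} {a b : Phase n → ℂ} (ha : a ∈ Symb n m)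
    (hb : b ∈ Symb n k) : SymbBounds N (m + k) (a * b) := by
  induction N generalizing m k a b with
  | zero => exact (Symb.bound ha).mul (Symb.bound hb)
  | succ N ih =>
    refine ⟨(Symb.bound ha).mul (Symb.bound hb), fun i => ⟨?_, ?_⟩⟩
    · rw [dX_eq_dV, dV_mul _ ha.1 hb.1]
      refine SymbBounds.add ((dV_contDiff _ ha.1).mul hb.1) (ha.1.mul (dV_contDiff _ hb.1)) ?_ ?_
      · rw [add_sub_right_comm]; exact ih (Symb.dX ha i) hb
      · rw [add_sub_assoc]; exact ih ha (Symb.dX hb i)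
    · rw [dXi_eq_dV, dV_mul _ ha.1 hb.1]
      refine SymbBounds.add ((dV_contDiff _ ha.1).mul hb.1) (ha.1.mul (dV_contDiff _ hb.1)) ?_ ?_
      · rw [add_sub_right_comm]; exact ih (Symb.dXi ha i) hb
      · rw [add_sub_assoc]; exact ih ha (Symb.dXi hb i)

lemma Symb.mul {m k : ℝ × ℝ} {a b : Phase n → ℂ} (ha : a ∈ Symb n m) (hb : b ∈ Symb n k) :
    a * b ∈ Symb n (m + k) :=
  Symb.of_bounds (ha.1.mul hb.1) fun _ => SymbBounds.mul ha hb

lemma Symb.mono {m k : ℝ × ℝ} (h : m ≤ k) : Symb n m ≤ Symb n k := by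
  intro a ha
  refine Symb.of_bounds ha.1 fun N => ?_
  induction N generalizing m k a with
  | zero => exact (Symb.bound ha).mono h
  | succ N ih =>
    exact ⟨(Symb.bound ha).mono h, fun i =>
      ⟨ih (sub_le_sub_right h e₁) (Symb.dX ha i), ih (sub_le_sub_right h e₂) (Symb.dXi ha i)⟩⟩

lemma dV_const (v : Phase n) (z : ℂ) : dV v (fun _ => z) = 0 := by
  ext p
  simp [dV]

lemma Symb.one_mem : (1 : Phase n → ℂ) ∈ Symb n 0 := by
  have h0 : ∀ m, (0 : Phase n → ℂ) ∈ Symb n m := fun m => (Symb n m).zero_mem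
  refine Symb.of_bounds contDiff_const fun N => ?_
  have hb : SymbBound 0 (1 : Phase n → ℂ) := ⟨1, fun x ξ => by simp⟩
  cases N with
  | zero => exact hb
  | succ N =>
    refine ⟨hb, fun i => ⟨?_, ?_⟩⟩
    · rw [dX_eq_dV, show (1 : Phase n → ℂ) = fun _ => 1 from rfl, dV_const]
      exact Symb.bounds (h0 _) N
    · rw [dXi_eq_dV, show (1 : Phase n → ℂ) = fun _ => 1 from rfl, dV_const]
      exact Symb.bounds (h0 _) N

end SGCalc

/-! ### Abstract asymptotic expansions and the classical symbol spaces -/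

namespace SGCalc

variable {n : ℕ}

/-! ### Asymptotic expansions in filtered families of function spaces -/

/-- A family of function spaces that is indexed by orders. -/
abbrev OrderFamily (n : ℕ) : Type := ℝ × ℝ → Submodule ℂ (Phase n → ℂ)

/-- The product maps `F^m × G^k` to `H^{m+k}`. -/
def MulMaps (F G H : OrderFamily n) : Prop :=
  ∀ ⦃m k a b⦄, a ∈ F m → b ∈ G k → a * b ∈ H (m + k)

/-- The derivative in the direction of `v` lowers orders by `δ`. -/
def DerivMaps (v : Phase n) (δ : ℝ × ℝ) (F : OrderFamily n) : Prop :=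
  ∀ ⦃m a⦄, a ∈ F m → dV v a ∈ F (m - δ)

/-- Lowering the order by `δ` makes the spaces smaller. -/
def ShiftLe (δ : ℝ × ℝ) (F : OrderFamily n) : Prop := ∀ m, F (m - δ) ≤ F m

/-- All elements are smooth. -/
def AllSmooth (F : OrderFamily n) : Prop := ∀ ⦃m a⦄, a ∈ F m → ContDiff ℝ ∞ a

/-- Expansions in the direction `d` of the orders. -/
noncomputable def ExpF (P T R : OrderFamily n) (d : ℝ × ℝ) : OrderFamily n := fun m =>
  Expands (P m) (fun k => T (m - (k : ℝ) • d)) (fun N => R (m - ((N : ℝ) + 1) • d))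

lemma mem_ExpF {P T R : OrderFamily n} {d m : ℝ × ℝ} {a : Phase n → ℂ} :
    a ∈ ExpF P T R d m ↔ a ∈ P m ∧ ∃ s : ℕ → Phase n → ℂ, (∀ k : ℕ, s k ∈ T (m - (k : ℝ) • d)) ∧
      ∀ N : ℕ, a - ∑ k ∈ Finset.range (N + 1), s k ∈ R (m - ((N : ℝ) + 1) • d) := Iff.rfl

lemma ShiftLe.nat {δ : ℝ × ℝ} {F : OrderFamily n} (h : ShiftLe δ F) (j : ℕ) (m : ℝ × ℝ) :
    F (m - (j : ℝ) • δ) ≤ F m := by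
  induction j with
  | zero => simp
  | succ j ih =>
    refine le_trans ?_ ih
    have : m - ((j + 1 : ℕ) : ℝ) • δ = m - (j : ℝ) • δ - δ := by push_cast; module
    rw [this]
    exact h _

lemma ShiftLe.inf {δ : ℝ × ℝ} {F G : OrderFamily n} (hF : ShiftLe δ F) (hG : ShiftLe δ G) :
    ShiftLe δ fun m => F m ⊓ G m := fun m => inf_le_inf (hF m) (hG m)

lemma MulMaps.inf {F G : OrderFamily n} (hF : MulMaps F F F) (hG : MulMaps G G G) :
    MulMaps (fun m => F m ⊓ G m) (fun m => F m ⊓ G m) fun m => F m ⊓ G m :=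
  fun _ _ _ _ ha hb => ⟨hF ha.1 hb.1, hG ha.2 hb.2⟩

lemma DerivMaps.inf {v : Phase n} {δ : ℝ × ℝ} {F G : OrderFamily n} (hF : DerivMaps v δ F)
    (hG : DerivMaps v δ G) : DerivMaps v δ fun m => F m ⊓ G m :=
  fun _ _ ha => ⟨hF ha.1, hG ha.2⟩

section ExpF

variable {P T R : OrderFamily n} {d : ℝ × ℝ}

lemma ExpF.mono_families {P' T' R' : OrderFamily n} (hP : ∀ m, P m ≤ P' m) (hT : ∀ m, T m ≤ T' m)
    (hR : ∀ m, R m ≤ R' m) (m : ℝ × ℝ) : ExpF P T R d m ≤ ExpF P' T' R' d m := by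
  rintro a ⟨ha, s, hs, hr⟩
  exact ⟨hP _ ha, s, fun k => hT _ (hs k), fun N => hR _ (hr N)⟩

lemma ExpF.of_leading {m : ℝ × ℝ} {a : Phase n → ℂ} (hP : a ∈ P m) (hT : a ∈ T m) :
    a ∈ ExpF P T R d m := by
  refine ⟨hP, fun k => if k = 0 then a else 0, fun k => ?_, fun N => ?_⟩
  · rcases Nat.eq_zero_or_pos k with rfl | hk
    · simpa using hT
    · simp [hk.ne']
  · rw [Finset.sum_range_succ']
    simp

/-- Cauchy product. The remainder at level `N` is (remainder of `a`) times `b`, plus the sum over `i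
≤ N` of `s i` times the remainder of `b` at level `N - i`. Hence only the products `R · P` and `T ·
R` have to be remainders. -/
lemma ExpF.mulMaps (hP : MulMaps P P P) (hT : MulMaps T T T) (hRP : MulMaps R P R)
    (hTR : MulMaps T R R) : MulMaps (ExpF P T R d) (ExpF P T R d) (ExpF P T R d) := by
  rintro m k a b ⟨ha, s, hs, hsr⟩ ⟨hb, t, ht, htr⟩
  refine ⟨hP ha hb, fun l => ∑ i ∈ Finset.range (l + 1), s i * t (l - i), fun l => ?_, fun N => ?_⟩
  · refine Submodule.sum_mem _ fun i hi => ?_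
    have hil : i ≤ l := Nat.lt_succ_iff.1 (Finset.mem_range.1 hi)
    have := hT (hs i) (ht (l - i))
    have e : m - (i : ℝ) • d + (k - ((l - i : ℕ) : ℝ) • d) = m + k - (l : ℝ) • d := by
      rw [Nat.cast_sub hil]; module
    rwa [e] at this
  · rw [Finset.sum_range_diag_flip (N + 1) fun i j => s i * t j]
    have e : a * b - ∑ i ∈ Finset.range (N + 1), ∑ j ∈ Finset.range (N + 1 - i), s i * t j
        = (a - ∑ i ∈ Finset.range (N + 1), s i) * b
          + ∑ i ∈ Finset.range (N + 1), s i * (b - ∑ j ∈ Finset.range (N + 1 - i), t j) := by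
      simp only [mul_sub, Finset.sum_sub_distrib, ← Finset.sum_mul, sub_mul, Finset.mul_sum]
      ring
    rw [e]
    refine Submodule.add_mem _ ?_ (Submodule.sum_mem _ fun i hi => ?_)
    · have := hRP (hsr N) hb
      rwa [sub_add_eq_add_sub] at this
    · have hiN : i ≤ N := Nat.lt_succ_iff.1 (Finset.mem_range.1 hi)
      have := hTR (hs i) (htr (N - i))
      have e : m - (i : ℝ) • d + (k - (((N - i : ℕ) : ℝ) + 1) • d) = m + k - ((N : ℝ) + 1) • d := by
        rw [Nat.cast_sub hiN]; module
      rw [e] at this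
      rwa [show N + 1 - i = N - i + 1 by omega]

lemma ExpF.derivMaps {v : Phase n} {δ : ℝ × ℝ} (hP : DerivMaps v δ P) (hT : DerivMaps v δ T)
    (hR : DerivMaps v δ R) (hPs : AllSmooth P) (hTs : AllSmooth T) :
    DerivMaps v δ (ExpF P T R d) := by
  intro m a h
  obtain ⟨ha, s, hs, hr⟩ := mem_ExpF.1 h
  refine mem_ExpF.2 ⟨hP ha, fun k => dV v (s k), fun k => ?_, fun N => ?_⟩
  · rw [sub_right_comm]; exact hT (hs k)
  · rw [sub_right_comm, ← dV_sum _ _ fun i => hTs (hs i),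
      ← dV_sub _ (hPs ha) (smooth_sum _ fun i => hTs (hs i))]
    exact hR (hr N)

/-- Prepend a zero leading term to the expansion. This asks nothing of `T`, which is essential:
homogeneity of degree `s - 1` does not give homogeneity of degree `s`. The price is `hPR`, because
the zeroth remainder is now the element itself. -/
lemma ExpF.shift (hP : ShiftLe d P) (hPR : ∀ m, P m ≤ R m) : ShiftLe d (ExpF P T R d) := by
  intro m a h
  obtain ⟨ha, s, hs, hr⟩ := mem_ExpF.1 h
  refine mem_ExpF.2 ⟨hP m ha, fun k => k.casesOn 0 s, fun k => ?_, fun N => ?_⟩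
  · cases k with
    | zero => exact Submodule.zero_mem _
    | succ k =>
      have := hs k
      rwa [show m - d - (k : ℝ) • d = m - ((k + 1 : ℕ) : ℝ) • d by push_cast; module] at this
  · rw [Finset.sum_range_succ']
    cases N with
    | zero => simpa using hPR _ ha
    | succ N =>
      have := hr N
      rw [show m - d - ((N : ℝ) + 1) • d = m - (((N + 1 : ℕ) : ℝ) + 1) • d by
        push_cast; module] at this
      simpa using this

lemma ExpF.shift_families {δ : ℝ × ℝ} (hP : ShiftLe δ P) (hT : ShiftLe δ T) (hR : ShiftLe δ R) :
    ShiftLe δ (ExpF P T R d) := by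
  rintro m a ⟨ha, s, hs, hr⟩
  refine ⟨hP m ha, s, fun k => hT _ ?_, fun N => hR _ ?_⟩
  · rw [sub_right_comm]; exact hs k
  · rw [sub_right_comm]; exact hr N

/-- The terms of an expansion are differences of remainders. -/
lemma ExpF.refine (hR : ShiftLe d R) {m : ℝ × ℝ} {a : Phase n → ℂ} (ha : a ∈ ExpF P T R d m)
    (haR : a ∈ R m) : a ∈ ExpF R (fun m => T m ⊓ R m) R d m := by
  obtain ⟨-, s, hs, hr⟩ := ha
  refine ⟨haR, s, fun k => ⟨hs k, ?_⟩, hr⟩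
  have hr' : ∀ k : ℕ, a - ∑ i ∈ Finset.range k, s i ∈ R (m - (k : ℝ) • d) := by
    intro k
    cases k with
    | zero => simpa using haR
    | succ k => simpa using hr k
  have e : s k = (a - ∑ i ∈ Finset.range k, s i) - (a - ∑ i ∈ Finset.range (k + 1), s i) := by
    rw [Finset.sum_range_succ]; abel
  rw [e]
  refine Submodule.sub_mem _ (hr' k) (hR _ ?_)
  have := hr' (k + 1)
  rwa [show m - ((k + 1 : ℕ) : ℝ) • d = m - (k : ℝ) • d - d by push_cast; module] at this

/-- Resummation along diagonals: the `k`-th term collects the `(k - j)`-th term of `c j` for `j ≤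
k`. It has order `m - k d - j d'`; the surplus drop `j d'` is transverse to `d` and is discarded by
the shift property, so homogeneity along `d` is kept. -/
lemma ExpF.asymptotic {d' : ℝ × ℝ} (hT : ShiftLe d' T) (hR : ShiftLe d' R) {m : ℝ × ℝ}
    {a : Phase n → ℂ} {c : ℕ → Phase n → ℂ} (ha : a ∈ P m)
    (hc : ∀ j : ℕ, c j ∈ ExpF P T R d (m - (j : ℝ) • (d + d')))
    (hr : ∀ N : ℕ, a - ∑ j ∈ Finset.range N, c j ∈ R (m - (N : ℝ) • (d + d'))) :
    a ∈ ExpF P T R d m := by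
  choose hcP s hs hsr using fun j => mem_ExpF.1 (hc j)
  refine mem_ExpF.2 ⟨ha, fun k => ∑ j ∈ Finset.range (k + 1), s j (k - j), fun k => ?_, fun N => ?_⟩
  · refine Submodule.sum_mem _ fun j hj => ?_
    have hjk : j ≤ k := Nat.lt_succ_iff.1 (Finset.mem_range.1 hj)
    have := hs j (k - j)
    have e : m - (j : ℝ) • (d + d') - ((k - j : ℕ) : ℝ) • d = m - (k : ℝ) • d - (j : ℝ) • d' := by
      rw [Nat.cast_sub hjk]; module
    rw [e] at this
    exact hT.nat j _ this
  · rw [Finset.sum_range_diag_flip (N + 1) fun i j => s i j]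
    have e : a - ∑ i ∈ Finset.range (N + 1), ∑ j ∈ Finset.range (N + 1 - i), s i j
        = (a - ∑ i ∈ Finset.range (N + 1), c i)
          + ∑ i ∈ Finset.range (N + 1), (c i - ∑ j ∈ Finset.range (N + 1 - i), s i j) := by
      simp only [Finset.sum_sub_distrib]
      abel
    rw [e]
    refine Submodule.add_mem _ ?_ (Submodule.sum_mem _ fun i hi => ?_)
    · have := hr (N + 1)
      rw [show m - ((N + 1 : ℕ) : ℝ) • (d + d') = m - ((N : ℝ) + 1) • d - ((N + 1 : ℕ) : ℝ) • d' by
        push_cast; module] at this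
      exact hR.nat _ _ this
    · have hiN : i ≤ N := Nat.lt_succ_iff.1 (Finset.mem_range.1 hi)
      have := hsr i (N - i)
      have e : m - (i : ℝ) • (d + d') - (((N - i : ℕ) : ℝ) + 1) • d
          = m - ((N : ℝ) + 1) • d - (i : ℝ) • d' := by
        rw [Nat.cast_sub hiN]; module
      rw [e] at this
      rw [show N + 1 - i = N - i + 1 by omega]
      exact hR.nat _ _ this

end ExpF

/-! ### Eventually homogeneous symbols -/

/-- The dilation `(x, ξ) ↦ (s x, t ξ)`. -/
noncomputable def dil (s t : ℝ) : Phase n →L[ℝ] Phase n :=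
  (s • ContinuousLinearMap.id ℝ (Pos n)).prodMap (t • ContinuousLinearMap.id ℝ (Pos n))

@[simp] lemma dil_apply (s t : ℝ) (p : Phase n) : dil s t p = (s • p.1, t • p.2) := rfl

/-- Chain rule for a scaling relation that holds only near `p`. Homogeneity for large argument is
such a relation, since the region where it holds is open. -/
lemma dV_dil {s t : ℝ} {z : ℂ} {f g : Phase n → ℂ} {p : Phase n}
    (hf : DifferentiableAt ℝ f (dil s t p)) (h : ∀ᶠ q in 𝓝 p, f (dil s t q) = z * g q)
    (hg : DifferentiableAt ℝ g p) (v : Phase n) :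
    dV (dil s t v) f (dil s t p) = z * dV v g p := by
  have h1 : fderiv ℝ (f ∘ dil s t) p = (fderiv ℝ f (dil s t p)).comp (dil s t) := by
    rw [fderiv_comp _ hf (dil s t).differentiableAt, ContinuousLinearMap.fderiv]
  have h2 : fderiv ℝ (f ∘ dil s t) p = z • fderiv ℝ g p := by
    have : f ∘ dil s t =ᶠ[𝓝 p] z • g := h
    rw [this.fderiv_eq, fderiv_const_smul hg]
  have := congrArg (fun L : Phase n →L[ℝ] ℂ => L v) (h1.symm.trans h2)
  simpa [dV] using this

lemma dX_dil {s t : ℝ} {z : ℂ} {f g : Phase n → ℂ} {p : Phase n}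
    (hf : DifferentiableAt ℝ f (dil s t p)) (h : ∀ᶠ q in 𝓝 p, f (dil s t q) = z * g q)
    (hg : DifferentiableAt ℝ g p) (i : Fin n) :
    (s : ℂ) * dX i f (dil s t p) = z * dX i g p := by
  rw [dX_eq_dV, ← dV_dil hf h hg]
  have : dil s t ((EuclideanSpace.single i (1 : ℝ), 0) : Phase n)
      = s • ((EuclideanSpace.single i (1 : ℝ), 0) : Phase n) := by
    rw [dil_apply, Prod.smul_mk]; simp
  rw [this]
  simp only [dV, map_smul, Complex.real_smul]

lemma dXi_dil {s t : ℝ} {z : ℂ} {f g : Phase n → ℂ} {p : Phase n}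
    (hf : DifferentiableAt ℝ f (dil s t p)) (h : ∀ᶠ q in 𝓝 p, f (dil s t q) = z * g q)
    (hg : DifferentiableAt ℝ g p) (i : Fin n) :
    (t : ℂ) * dXi i f (dil s t p) = z * dXi i g p := by
  rw [dXi_eq_dV, ← dV_dil hf h hg]
  have : dil s t ((0, EuclideanSpace.single i (1 : ℝ)) : Phase n)
      = t • ((0, EuclideanSpace.single i (1 : ℝ)) : Phase n) := by
    rw [dil_apply, Prod.smul_mk]; simp
  rw [this]
  simp only [dV, map_smul, Complex.real_smul]

/-- Symbols that are homogeneous in `x` for large `|x|`. -/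
noncomputable def HomE (n : ℕ) : OrderFamily n := fun m => EvHomE n m.1 ⊓ Symb n m

/-- Symbols that are homogeneous in `ξ` for large `|ξ|`. -/
noncomputable def HomPsi (n : ℕ) : OrderFamily n := fun m => EvHomPsi n m.2 ⊓ Symb n m

/-- Symbols that are bi-homogeneous for large `|x|` and `|ξ|`. -/
noncomputable def HomBi (n : ℕ) : OrderFamily n := fun m => EvHomBi n m ⊓ Symb n m

lemma isOpen_norm_fst (c : ℝ) : IsOpen {p : Phase n | c < ‖p.1‖} :=
  isOpen_lt continuous_const (by fun_prop)

lemma isOpen_norm_snd (c : ℝ) : IsOpen {p : Phase n | c < ‖p.2‖} :=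
  isOpen_lt continuous_const (by fun_prop)

lemma ofReal_rpow_sub_one {t : ℝ} (ht : 0 < t) (s : ℝ) :
    ((t ^ (s - 1) : ℝ) : ℂ) = (t : ℂ)⁻¹ * ((t ^ s : ℝ) : ℂ) := by
  rw [Real.rpow_sub_one ht.ne']
  push_cast
  field_simp

lemma eventually_large_fst {c : ℝ} {p : Phase n} (h : c < ‖p.1‖) : ∀ᶠ q in 𝓝 p, c < ‖q.1‖ :=
  (isOpen_norm_fst c).mem_nhds h

lemma eventually_large_snd {c : ℝ} {p : Phase n} (h : c < ‖p.2‖) : ∀ᶠ q in 𝓝 p, c < ‖q.2‖ :=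
  (isOpen_norm_snd c).mem_nhds h

lemma HomE.dX_mem {m : ℝ × ℝ} {a : Phase n → ℂ} (ha : a ∈ HomE n m) (i : Fin n) :
    dX i a ∈ HomE n (m - e₁) := by
  obtain ⟨⟨c, hc, h⟩, hs⟩ := ha
  refine ⟨⟨c, hc, fun t ht x ξ hx => ?_⟩, Symb.dX hs i⟩
  have ht0 : 0 < t := by linarith
  have htC : (t : ℂ) ≠ 0 := by exact_mod_cast ht0.ne'
  have := dX_dil (s := t) (t := 1) (p := (x, ξ))
    (z := ((t ^ m.1 : ℝ) : ℂ)) (smooth_diffAt hs.1 _)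
    ((eventually_large_fst (p := (x, ξ)) hx).mono fun q hq => by simpa using h t ht q.1 q.2 hq)
    (smooth_diffAt hs.1 _) i
  simp only [dil_apply, one_smul] at this
  rw [Prod.fst_sub, ofReal_rpow_sub_one ht0, mul_assoc, ← this, inv_mul_cancel_left₀ htC]

lemma HomE.dXi_mem {m : ℝ × ℝ} {a : Phase n → ℂ} (ha : a ∈ HomE n m) (i : Fin n) :
    dXi i a ∈ HomE n (m - e₂) := by
  obtain ⟨⟨c, hc, h⟩, hs⟩ := ha
  refine ⟨⟨c, hc, fun t ht x ξ hx => ?_⟩, Symb.dXi hs i⟩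
  have := dXi_dil (s := t) (t := 1) (p := (x, ξ))
    (z := ((t ^ m.1 : ℝ) : ℂ)) (smooth_diffAt hs.1 _)
    ((eventually_large_fst (p := (x, ξ)) hx).mono fun q hq => by simpa using h t ht q.1 q.2 hq)
    (smooth_diffAt hs.1 _) i
  simpa using this

lemma HomPsi.dX_mem {m : ℝ × ℝ} {a : Phase n → ℂ} (ha : a ∈ HomPsi n m) (i : Fin n) :
    dX i a ∈ HomPsi n (m - e₁) := by
  obtain ⟨⟨c, hc, h⟩, hs⟩ := ha
  refine ⟨⟨c, hc, fun t ht x ξ hx => ?_⟩, Symb.dX hs i⟩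
  have := dX_dil (s := 1) (t := t) (p := (x, ξ))
    (z := ((t ^ m.2 : ℝ) : ℂ)) (smooth_diffAt hs.1 _)
    ((eventually_large_snd (p := (x, ξ)) hx).mono fun q hq => by simpa using h t ht q.1 q.2 hq)
    (smooth_diffAt hs.1 _) i
  simpa using this

lemma HomPsi.dXi_mem {m : ℝ × ℝ} {a : Phase n → ℂ} (ha : a ∈ HomPsi n m) (i : Fin n) :
    dXi i a ∈ HomPsi n (m - e₂) := by
  obtain ⟨⟨c, hc, h⟩, hs⟩ := ha
  refine ⟨⟨c, hc, fun t ht x ξ hx => ?_⟩, Symb.dXi hs i⟩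
  have ht0 : 0 < t := by linarith
  have htC : (t : ℂ) ≠ 0 := by exact_mod_cast ht0.ne'
  have := dXi_dil (s := 1) (t := t) (p := (x, ξ))
    (z := ((t ^ m.2 : ℝ) : ℂ)) (smooth_diffAt hs.1 _)
    ((eventually_large_snd (p := (x, ξ)) hx).mono fun q hq => by simpa using h t ht q.1 q.2 hq)
    (smooth_diffAt hs.1 _) i
  simp only [dil_apply, one_smul] at this
  rw [Prod.snd_sub, ofReal_rpow_sub_one ht0, mul_assoc, ← this, inv_mul_cancel_left₀ htC]

lemma HomBi.dX_mem {m : ℝ × ℝ} {a : Phase n → ℂ} (ha : a ∈ HomBi n m) (i : Fin n) :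
    dX i a ∈ HomBi n (m - e₁) := by
  obtain ⟨⟨c, hc, h⟩, hs⟩ := ha
  refine ⟨⟨c, hc, fun s t hs1 ht x ξ hx hξ => ?_⟩, Symb.dX hs i⟩
  have hs0 : 0 < s := by linarith
  have hsC : (s : ℂ) ≠ 0 := by exact_mod_cast hs0.ne'
  have := dX_dil (s := s) (t := t) (p := (x, ξ))
    (z := ((s ^ m.1 * t ^ m.2 : ℝ) : ℂ)) (smooth_diffAt hs.1 _)
    (((eventually_large_fst (p := (x, ξ)) hx).and (eventually_large_snd (p := (x, ξ)) hξ)).mono fun q hq => by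
      simpa using h s t hs1 ht q.1 q.2 hq.1 hq.2)
    (smooth_diffAt hs.1 _) i
  simp only [dil_apply] at this
  rw [Prod.fst_sub, Prod.snd_sub, sub_zero, ofReal_mul, ofReal_rpow_sub_one hs0]
  rw [ofReal_mul] at this
  rw [mul_assoc, mul_assoc, ← mul_assoc (Complex.ofReal _), ← this, inv_mul_cancel_left₀ hsC]

lemma HomBi.dXi_mem {m : ℝ × ℝ} {a : Phase n → ℂ} (ha : a ∈ HomBi n m) (i : Fin n) :
    dXi i a ∈ HomBi n (m - e₂) := by
  obtain ⟨⟨c, hc, h⟩, hs⟩ := ha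
  refine ⟨⟨c, hc, fun s t hs1 ht x ξ hx hξ => ?_⟩, Symb.dXi hs i⟩
  have ht0 : 0 < t := by linarith
  have htC : (t : ℂ) ≠ 0 := by exact_mod_cast ht0.ne'
  have := dXi_dil (s := s) (t := t) (p := (x, ξ))
    (z := ((s ^ m.1 * t ^ m.2 : ℝ) : ℂ)) (smooth_diffAt hs.1 _)
    (((eventually_large_fst (p := (x, ξ)) hx).and (eventually_large_snd (p := (x, ξ)) hξ)).mono fun q hq => by
      simpa using h s t hs1 ht q.1 q.2 hq.1 hq.2)
    (smooth_diffAt hs.1 _) i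
  simp only [dil_apply] at this
  rw [Prod.fst_sub, Prod.snd_sub, sub_zero, ofReal_mul, ofReal_rpow_sub_one ht0]
  rw [ofReal_mul] at this
  rw [mul_left_comm, mul_assoc, ← this, inv_mul_cancel_left₀ htC]

lemma HomE.mulMaps : MulMaps (HomE n) (HomE n) (HomE n) := by
  rintro m k a b ⟨⟨c, hc, h⟩, hs⟩ ⟨⟨c', hc', h'⟩, hs'⟩
  refine ⟨⟨max c c', lt_max_of_lt_left hc, fun t ht x ξ hx => ?_⟩, Symb.mul hs hs'⟩
  rw [Pi.mul_apply, h t ht x ξ ((le_max_left _ _).trans_lt hx),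
    h' t ht x ξ ((le_max_right _ _).trans_lt hx), Prod.fst_add, Real.rpow_add (by linarith)]
  push_cast [Pi.mul_apply]
  ring

lemma HomPsi.mulMaps : MulMaps (HomPsi n) (HomPsi n) (HomPsi n) := by
  rintro m k a b ⟨⟨c, hc, h⟩, hs⟩ ⟨⟨c', hc', h'⟩, hs'⟩
  refine ⟨⟨max c c', lt_max_of_lt_left hc, fun t ht x ξ hx => ?_⟩, Symb.mul hs hs'⟩
  rw [Pi.mul_apply, h t ht x ξ ((le_max_left _ _).trans_lt hx),
    h' t ht x ξ ((le_max_right _ _).trans_lt hx), Prod.snd_add, Real.rpow_add (by linarith)]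
  push_cast [Pi.mul_apply]
  ring

lemma HomBi.mulMaps : MulMaps (HomBi n) (HomBi n) (HomBi n) := by
  rintro m k a b ⟨⟨c, hc, h⟩, hs⟩ ⟨⟨c', hc', h'⟩, hs'⟩
  refine ⟨⟨max c c', lt_max_of_lt_left hc, fun s t hs1 ht x ξ hx hξ => ?_⟩, Symb.mul hs hs'⟩
  rw [Pi.mul_apply, h s t hs1 ht x ξ ((le_max_left _ _).trans_lt hx)
    ((le_max_left _ _).trans_lt hξ), h' s t hs1 ht x ξ ((le_max_right _ _).trans_lt hx)
    ((le_max_right _ _).trans_lt hξ), Prod.fst_add, Prod.snd_add, Real.rpow_add (by linarith),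
    Real.rpow_add (by linarith)]
  push_cast [Pi.mul_apply]
  ring

lemma Symb.mulMaps : MulMaps (Symb n) (Symb n) (Symb n) := fun _ _ _ _ => Symb.mul

lemma Symb.shift₁ : ShiftLe e₁ (Symb n) := fun m => Symb.mono ⟨by simp, by simp⟩

lemma Symb.shift₂ : ShiftLe e₂ (Symb n) := fun m => Symb.mono ⟨by simp, by simp⟩

/-- The degree in `x` does not involve the second order, so only the estimates change. There is no
analogue along `e₁`, and none in either direction for `HomBi`. -/
lemma HomE.shift₂ : ShiftLe e₂ (HomE n) := fun m a ha =>
  ⟨by simpa using ha.1, Symb.shift₂ m ha.2⟩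

lemma HomPsi.shift₁ : ShiftLe e₁ (HomPsi n) := fun m a ha =>
  ⟨by simpa using ha.1, Symb.shift₁ m ha.2⟩

/-! ### The classical symbol spaces as expansions -/

lemma sub_smul_e₁ (m : ℝ × ℝ) (t : ℝ) : m - t • e₁ = (m.1 - t, m.2) := by ext <;> simp

lemma sub_smul_e₂ (m : ℝ × ℝ) (t : ℝ) : m - t • e₂ = (m.1, m.2 - t) := by ext <;> simp

lemma SGClE_eq : SGClE n = ExpF (Symb n) (HomE n) (Symb n) e₁ := by
  ext1 m
  simp only [SGClE, ExpF, HomE, sub_smul_e₁, sub_sub]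

lemma SGClPsi_eq : SGClPsi n = ExpF (Symb n) (HomPsi n) (Symb n) e₂ := by
  ext1 m
  simp only [SGClPsi, ExpF, HomPsi, sub_smul_e₂, sub_sub]

lemma SGHomPsiClE_eq : SGHomPsiClE n = ExpF (HomPsi n) (HomBi n) (Symb n) e₁ := by
  ext1 m
  simp only [SGHomPsiClE, ExpF, HomPsi, HomBi, sub_smul_e₁, sub_sub]

lemma SGHomEClPsi_eq : SGHomEClPsi n = ExpF (HomE n) (HomBi n) (Symb n) e₂ := by
  ext1 m
  simp only [SGHomEClPsi, ExpF, HomE, HomBi, sub_smul_e₂, sub_sub]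

lemma SG_eq₀ (m : ℝ × ℝ) : SG n m = ExpF (Symb n) (SGHomPsiClE n) (SGClE n) e₂ m ⊓
    ExpF (Symb n) (SGHomEClPsi n) (SGClPsi n) e₁ m := by
  simp only [SG, ExpF, sub_smul_e₁, sub_smul_e₂, sub_sub]

lemma SGClE.le_Symb (m : ℝ × ℝ) : SGClE n m ≤ Symb n m := fun _ h => h.1

lemma SGClPsi.le_Symb (m : ℝ × ℝ) : SGClPsi n m ≤ Symb n m := fun _ h => h.1

lemma SGHomPsiClE.le_HomPsi (m : ℝ × ℝ) : SGHomPsiClE n m ≤ HomPsi n m := fun _ h => h.1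

lemma SGHomEClPsi.le_HomE (m : ℝ × ℝ) : SGHomEClPsi n m ≤ HomE n m := fun _ h => h.1

lemma SGClE.shift₁ : ShiftLe e₁ (SGClE n) := by
  rw [SGClE_eq]; exact ExpF.shift Symb.shift₁ fun _ => le_rfl

lemma SGClE.shift₂ : ShiftLe e₂ (SGClE n) := by
  rw [SGClE_eq]; exact ExpF.shift_families Symb.shift₂ HomE.shift₂ Symb.shift₂

lemma SGClPsi.shift₂ : ShiftLe e₂ (SGClPsi n) := by
  rw [SGClPsi_eq]; exact ExpF.shift Symb.shift₂ fun _ => le_rfl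

lemma SGClPsi.shift₁ : ShiftLe e₁ (SGClPsi n) := by
  rw [SGClPsi_eq]; exact ExpF.shift_families Symb.shift₁ HomPsi.shift₁ Symb.shift₁

lemma SGHomPsiClE.shift₁ : ShiftLe e₁ (SGHomPsiClE n) := by
  rw [SGHomPsiClE_eq]; exact ExpF.shift HomPsi.shift₁ fun _ => inf_le_right

lemma SGHomEClPsi.shift₂ : ShiftLe e₂ (SGHomEClPsi n) := by
  rw [SGHomEClPsi_eq]; exact ExpF.shift HomE.shift₂ fun _ => inf_le_right

lemma MulMaps.mono_left {F F' G H : OrderFamily n} (h : MulMaps F G H) (hF : ∀ m, F' m ≤ F m) :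
    MulMaps F' G H := fun _ _ _ _ ha hb => h (hF _ ha) hb

lemma MulMaps.mono_right {F G G' H : OrderFamily n} (h : MulMaps F G H) (hG : ∀ m, G' m ≤ G m) :
    MulMaps F G' H := fun _ _ _ _ ha hb => h ha (hG _ hb)

lemma SGClE.mulMaps : MulMaps (SGClE n) (SGClE n) (SGClE n) := by
  rw [SGClE_eq]
  exact ExpF.mulMaps Symb.mulMaps HomE.mulMaps Symb.mulMaps
    (Symb.mulMaps.mono_left fun _ => inf_le_right)

lemma SGClPsi.mulMaps : MulMaps (SGClPsi n) (SGClPsi n) (SGClPsi n) := by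
  rw [SGClPsi_eq]
  exact ExpF.mulMaps Symb.mulMaps HomPsi.mulMaps Symb.mulMaps
    (Symb.mulMaps.mono_left fun _ => inf_le_right)

lemma SGHomPsiClE.mulMaps : MulMaps (SGHomPsiClE n) (SGHomPsiClE n) (SGHomPsiClE n) := by
  rw [SGHomPsiClE_eq]
  exact ExpF.mulMaps HomPsi.mulMaps HomBi.mulMaps (Symb.mulMaps.mono_right fun _ => inf_le_right)
    (Symb.mulMaps.mono_left fun _ => inf_le_right)

lemma SGHomEClPsi.mulMaps : MulMaps (SGHomEClPsi n) (SGHomEClPsi n) (SGHomEClPsi n) := by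
  rw [SGHomEClPsi_eq]
  exact ExpF.mulMaps HomE.mulMaps HomBi.mulMaps (Symb.mulMaps.mono_right fun _ => inf_le_right)
    (Symb.mulMaps.mono_left fun _ => inf_le_right)

lemma Symb.allSmooth : AllSmooth (Symb n) := fun _ _ h => h.1

lemma AllSmooth.of_le_Symb {F : OrderFamily n} (h : ∀ m, F m ≤ Symb n m) : AllSmooth F :=
  fun _ _ ha => (h _ ha).1

/-- All coordinate derivatives lower the orders as they should. -/
def AllDerivMaps (F : OrderFamily n) : Prop :=
  ∀ i : Fin n, DerivMaps (EuclideanSpace.single i 1, 0) e₁ F ∧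
    DerivMaps (0, EuclideanSpace.single i 1) e₂ F

lemma AllDerivMaps.expF {P T R : OrderFamily n} {d : ℝ × ℝ} (hP : AllDerivMaps P)
    (hT : AllDerivMaps T) (hR : AllDerivMaps R) (hPs : AllSmooth P) (hTs : AllSmooth T) :
    AllDerivMaps (ExpF P T R d) := fun i =>
  ⟨ExpF.derivMaps (hP i).1 (hT i).1 (hR i).1 hPs hTs,
    ExpF.derivMaps (hP i).2 (hT i).2 (hR i).2 hPs hTs⟩

lemma AllDerivMaps.inf {F G : OrderFamily n} (hF : AllDerivMaps F) (hG : AllDerivMaps G) :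
    AllDerivMaps fun m => F m ⊓ G m := fun i =>
  ⟨(hF i).1.inf (hG i).1, (hF i).2.inf (hG i).2⟩

lemma Symb.allDerivMaps : AllDerivMaps (Symb n) := fun i =>
  ⟨fun _ _ h => Symb.dX h i, fun _ _ h => Symb.dXi h i⟩

lemma HomE.allDerivMaps : AllDerivMaps (HomE n) := fun i =>
  ⟨fun _ _ h => HomE.dX_mem h i, fun _ _ h => HomE.dXi_mem h i⟩

lemma HomPsi.allDerivMaps : AllDerivMaps (HomPsi n) := fun i =>
  ⟨fun _ _ h => HomPsi.dX_mem h i, fun _ _ h => HomPsi.dXi_mem h i⟩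

lemma HomBi.allDerivMaps : AllDerivMaps (HomBi n) := fun i =>
  ⟨fun _ _ h => HomBi.dX_mem h i, fun _ _ h => HomBi.dXi_mem h i⟩

lemma HomE.allSmooth : AllSmooth (HomE n) := AllSmooth.of_le_Symb fun _ => inf_le_right

lemma HomPsi.allSmooth : AllSmooth (HomPsi n) := AllSmooth.of_le_Symb fun _ => inf_le_right

lemma HomBi.allSmooth : AllSmooth (HomBi n) := AllSmooth.of_le_Symb fun _ => inf_le_right

lemma SGClE.allDerivMaps : AllDerivMaps (SGClE n) := by
  rw [SGClE_eq]
  exact Symb.allDerivMaps.expF HomE.allDerivMaps Symb.allDerivMaps Symb.allSmooth HomE.allSmooth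

lemma SGClPsi.allDerivMaps : AllDerivMaps (SGClPsi n) := by
  rw [SGClPsi_eq]
  exact Symb.allDerivMaps.expF HomPsi.allDerivMaps Symb.allDerivMaps Symb.allSmooth
    HomPsi.allSmooth

lemma SGHomPsiClE.allDerivMaps : AllDerivMaps (SGHomPsiClE n) := by
  rw [SGHomPsiClE_eq]
  exact HomPsi.allDerivMaps.expF HomBi.allDerivMaps Symb.allDerivMaps HomPsi.allSmooth
    HomBi.allSmooth

lemma SGHomEClPsi.allDerivMaps : AllDerivMaps (SGHomEClPsi n) := by
  rw [SGHomEClPsi_eq]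
  exact HomE.allDerivMaps.expF HomBi.allDerivMaps Symb.allDerivMaps HomE.allSmooth
    HomBi.allSmooth

/-- The exit half of the definition is an expansion of this kind once the `ψ`-classicality of its
terms and remainders is forgotten. -/
lemma SG.mem_ClE {m : ℝ × ℝ} {a : Phase n → ℂ} (ha : a ∈ SG n m) : a ∈ SGClE n m := by
  rw [SG_eq₀] at ha
  rw [SGClE_eq]
  exact ExpF.mono_families (fun _ => le_rfl) SGHomEClPsi.le_HomE SGClPsi.le_Symb m ha.2

lemma SG.mem_ClPsi {m : ℝ × ℝ} {a : Phase n → ℂ} (ha : a ∈ SG n m) : a ∈ SGClPsi n m := by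
  rw [SG_eq₀] at ha
  rw [SGClPsi_eq]
  exact ExpF.mono_families (fun _ => le_rfl) SGHomPsiClE.le_HomPsi SGClE.le_Symb m ha.1

/-- The part of the definition of `SG` that concerns `ψ`-expansions, with classical terms. -/
noncomputable def SGPsi (n : ℕ) : OrderFamily n :=
  ExpF (SGClE n) (fun m => SGHomPsiClE n m ⊓ SGClE n m) (SGClE n) e₂

/-- The part of the definition of `SG` that concerns exit expansions, with classical terms. -/
noncomputable def SGExit (n : ℕ) : OrderFamily n :=
  ExpF (SGClPsi n) (fun m => SGHomEClPsi n m ⊓ SGClPsi n m) (SGClPsi n) e₁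

/-- In a product of expansions a term of one factor meets a remainder of the other, so terms must
lie in the remainder family too. This is not built into the definition: bi-homogeneity where both
variables are large says nothing about `x`-expansions at bounded `ξ`. `ExpF.refine` supplies it. -/
lemma SG_eq : SG n = fun m => SGPsi n m ⊓ SGExit n m := by
  ext1 m
  refine le_antisymm (fun a ha => ?_) (fun a ha => ?_)
  · have h := ha
    rw [SG_eq₀] at h
    exact ⟨ExpF.refine SGClE.shift₂ h.1 (SG.mem_ClE ha),
      ExpF.refine SGClPsi.shift₁ h.2 (SG.mem_ClPsi ha)⟩
  · rw [SG_eq₀]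
    exact ⟨ExpF.mono_families SGClE.le_Symb (fun _ => inf_le_left) (fun _ => le_rfl) m ha.1,
      ExpF.mono_families SGClPsi.le_Symb (fun _ => inf_le_left) (fun _ => le_rfl) m ha.2⟩

lemma SG.mulMaps : MulMaps (SG n) (SG n) (SG n) := by
  rw [SG_eq]
  refine MulMaps.inf ?_ ?_
  · exact ExpF.mulMaps SGClE.mulMaps (SGHomPsiClE.mulMaps.inf SGClE.mulMaps) SGClE.mulMaps
      (SGClE.mulMaps.mono_left fun _ => inf_le_right)
  · exact ExpF.mulMaps SGClPsi.mulMaps (SGHomEClPsi.mulMaps.inf SGClPsi.mulMaps) SGClPsi.mulMaps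
      (SGClPsi.mulMaps.mono_left fun _ => inf_le_right)

lemma SG.allDerivMaps : AllDerivMaps (SG n) := by
  rw [SG_eq]
  refine AllDerivMaps.inf ?_ ?_
  · exact SGClE.allDerivMaps.expF (SGHomPsiClE.allDerivMaps.inf SGClE.allDerivMaps)
      SGClE.allDerivMaps (AllSmooth.of_le_Symb SGClE.le_Symb)
      (AllSmooth.of_le_Symb fun m => inf_le_right.trans (SGClE.le_Symb m))
  · exact SGClPsi.allDerivMaps.expF (SGHomEClPsi.allDerivMaps.inf SGClPsi.allDerivMaps)
      SGClPsi.allDerivMaps (AllSmooth.of_le_Symb SGClPsi.le_Symb)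
      (AllSmooth.of_le_Symb fun m => inf_le_right.trans (SGClPsi.le_Symb m))

lemma SG.shift₁ : ShiftLe e₁ (SG n) := by
  rw [SG_eq]
  exact ShiftLe.inf
    (ExpF.shift_families SGClE.shift₁ (SGHomPsiClE.shift₁.inf SGClE.shift₁) SGClE.shift₁)
    (ExpF.shift SGClPsi.shift₁ fun _ => le_rfl)

lemma SG.shift₂ : ShiftLe e₂ (SG n) := by
  rw [SG_eq]
  exact ShiftLe.inf (ExpF.shift SGClE.shift₂ fun _ => le_rfl)
    (ExpF.shift_families SGClPsi.shift₂ (SGHomEClPsi.shift₂.inf SGClPsi.shift₂) SGClPsi.shift₂)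

lemma SG.shift (m : ℝ × ℝ) (i j : ℕ) : SG n (m.1 - i, m.2 - j) ≤ SG n m := by
  have h := (SG.shift₂ (n := n).nat j (m - (i : ℝ) • e₁)).trans (SG.shift₁.nat i m)
  rwa [sub_smul_e₁, sub_smul_e₂] at h

lemma SG.one_mem : (1 : Phase n → ℂ) ∈ SG n 0 := by
  have hE : (1 : Phase n → ℂ) ∈ HomE n 0 := ⟨⟨1, one_pos, by simp⟩, Symb.one_mem⟩
  have hPsi : (1 : Phase n → ℂ) ∈ HomPsi n 0 := ⟨⟨1, one_pos, by simp⟩, Symb.one_mem⟩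
  have hBi : (1 : Phase n → ℂ) ∈ HomBi n 0 := ⟨⟨1, one_pos, by simp⟩, Symb.one_mem⟩
  have h1 : (1 : Phase n → ℂ) ∈ SGClE n 0 := by
    rw [SGClE_eq]; exact ExpF.of_leading Symb.one_mem hE
  have h2 : (1 : Phase n → ℂ) ∈ SGClPsi n 0 := by
    rw [SGClPsi_eq]; exact ExpF.of_leading Symb.one_mem hPsi
  have h3 : (1 : Phase n → ℂ) ∈ SGHomPsiClE n 0 := by
    rw [SGHomPsiClE_eq]; exact ExpF.of_leading hPsi hBi
  have h4 : (1 : Phase n → ℂ) ∈ SGHomEClPsi n 0 := by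
    rw [SGHomEClPsi_eq]; exact ExpF.of_leading hE hBi
  rw [SG_eq]
  exact ⟨ExpF.of_leading h1 ⟨h3, h1⟩, ExpF.of_leading h2 ⟨h4, h2⟩⟩

lemma e₁_add_e₂ : e₁ + e₂ = oneOne := by ext <;> simp

lemma e₂_add_e₁ : e₂ + e₁ = oneOne := by ext <;> simp

/-- A symbol that is asymptotic to a sum of classical symbols is classical. -/
lemma SG.asymptotic {m : ℝ × ℝ} {a : Phase n → ℂ} {c : ℕ → Phase n → ℂ}
    (hc : ∀ j : ℕ, c j ∈ SG n (m - (j : ℝ) • oneOne))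
    (hr : ∀ N : ℕ, a - ∑ j ∈ Finset.range N, c j ∈ Symb n (m - (N : ℝ) • oneOne)) :
    a ∈ SG n m := by
  have hshift : ∀ (M j : ℕ), m - (M : ℝ) • oneOne - (j : ℝ) • oneOne
      = m - ((M + j : ℕ) : ℝ) • oneOne := fun M j => by push_cast; module
  have hsum : ∀ M N : ℕ, a - ∑ j ∈ Finset.range M, c j - ∑ j ∈ Finset.range N, c (M + j)
      = a - ∑ j ∈ Finset.range (M + N), c j := fun M N => by
    rw [Finset.sum_range_add, sub_sub]
  -- All tails are treated, not only `M = 0`: they are the remainders of the outer `ψ`-expansion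
  -- below, which have to be classical in `x`.
  have hE : ∀ M : ℕ, a - ∑ j ∈ Finset.range M, c j ∈ SGClE n (m - (M : ℝ) • oneOne) := by
    intro M
    rw [SGClE_eq]
    refine ExpF.asymptotic (d' := e₂) (c := fun j => c (M + j)) HomE.shift₂ Symb.shift₂ (hr M)
      (fun j => ?_) fun N => ?_
    · rw [e₁_add_e₂, hshift, ← SGClE_eq]; exact SG.mem_ClE (hc _)
    · rw [e₁_add_e₂, hshift, hsum]; exact hr _
  have hPsi : ∀ M : ℕ, a - ∑ j ∈ Finset.range M, c j ∈ SGClPsi n (m - (M : ℝ) • oneOne) := by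
    intro M
    rw [SGClPsi_eq]
    refine ExpF.asymptotic (d' := e₁) (c := fun j => c (M + j)) HomPsi.shift₁ Symb.shift₁ (hr M)
      (fun j => ?_) fun N => ?_
    · rw [e₂_add_e₁, hshift, ← SGClPsi_eq]; exact SG.mem_ClPsi (hc _)
    · rw [e₂_add_e₁, hshift, hsum]; exact hr _
  rw [SG_eq] at hc ⊢
  refine ⟨ExpF.asymptotic (d' := e₁) (c := c) (SGHomPsiClE.shift₁.inf SGClE.shift₁) SGClE.shift₁
    (by simpa using hE 0) (fun j => ?_) fun N => ?_,
    ExpF.asymptotic (d' := e₂) (c := c) (SGHomEClPsi.shift₂.inf SGClPsi.shift₂) SGClPsi.shift₂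
    (by simpa using hPsi 0) (fun j => ?_) fun N => ?_⟩
  · rw [e₂_add_e₁]; exact (hc j).1
  · rw [e₂_add_e₁]; exact hE N
  · rw [e₁_add_e₂]; exact (hc j).2
  · rw [e₁_add_e₂]; exact hPsi N

end SGCalc

/-! ### The Poisson algebra and the limits defining principal symbols -/

namespace SGCalc

variable {n : ℕ}

/-! ### The Poisson bracket -/

lemma poisson_eq (f g : Phase n → ℂ) :
    poisson f g = ∑ i, (dXi i f * dX i g - dX i f * dXi i g) := by
  ext p
  simp [poisson]

lemma poisson_neg_swap (f g : Phase n → ℂ) : poisson f g = -poisson g f := by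
  ext p
  simp only [poisson, Pi.neg_apply, ← Finset.sum_neg_distrib]
  exact Finset.sum_congr rfl fun i _ => by ring

lemma poisson_self (f : Phase n → ℂ) : poisson f f = 0 := by
  ext p
  exact Finset.sum_eq_zero fun i _ => by ring

lemma poisson_add_left {f f' g : Phase n → ℂ} (hf : ContDiff ℝ ∞ f) (hf' : ContDiff ℝ ∞ f') :
    poisson (f + f') g = poisson f g + poisson f' g := by
  simp only [poisson_eq, dX_eq_dV, dXi_eq_dV, dV_add _ hf hf', ← Finset.sum_add_distrib]
  exact Finset.sum_congr rfl fun i _ => by ring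

lemma poisson_sub_left {f f' g : Phase n → ℂ} (hf : ContDiff ℝ ∞ f) (hf' : ContDiff ℝ ∞ f') :
    poisson (f - f') g = poisson f g - poisson f' g := by
  simp only [poisson_eq, dX_eq_dV, dXi_eq_dV, dV_sub _ hf hf', ← Finset.sum_sub_distrib]
  exact Finset.sum_congr rfl fun i _ => by ring

lemma poisson_smul_left (z : ℂ) {f g : Phase n → ℂ} (hf : ContDiff ℝ ∞ f) :
    poisson (z • f) g = z • poisson f g := by
  simp only [poisson_eq, dX_eq_dV, dXi_eq_dV, dV_smul _ z hf, Finset.smul_sum, smul_sub,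
    smul_mul_assoc]

lemma poisson_add_right {f g g' : Phase n → ℂ} (hg : ContDiff ℝ ∞ g) (hg' : ContDiff ℝ ∞ g') :
    poisson f (g + g') = poisson f g + poisson f g' := by
  rw [poisson_neg_swap, poisson_add_left hg hg', neg_add, ← poisson_neg_swap, ← poisson_neg_swap]

lemma poisson_sub_right {f g g' : Phase n → ℂ} (hg : ContDiff ℝ ∞ g) (hg' : ContDiff ℝ ∞ g') :
    poisson f (g - g') = poisson f g - poisson f g' := by
  simp only [poisson_eq, dX_eq_dV, dXi_eq_dV, dV_sub _ hg hg', ← Finset.sum_sub_distrib]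
  exact Finset.sum_congr rfl fun i _ => by ring

lemma poisson_smul_right (z : ℂ) {f g : Phase n → ℂ} (hg : ContDiff ℝ ∞ g) :
    poisson f (z • g) = z • poisson f g := by
  rw [poisson_neg_swap, poisson_smul_left z hg, ← smul_neg, ← poisson_neg_swap]

lemma poisson_mul_left {f f' g : Phase n → ℂ} (hf : ContDiff ℝ ∞ f) (hf' : ContDiff ℝ ∞ f') :
    poisson (f * f') g = poisson f g * f' + f * poisson f' g := by
  simp only [poisson_eq, dX_eq_dV, dXi_eq_dV, dV_mul _ hf hf', Finset.sum_mul, Finset.mul_sum,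
    ← Finset.sum_add_distrib]
  exact Finset.sum_congr rfl fun i _ => by ring

lemma poisson_mul_right {f g g' : Phase n → ℂ} (hg : ContDiff ℝ ∞ g) (hg' : ContDiff ℝ ∞ g') :
    poisson f (g * g') = poisson f g * g' + g * poisson f g' := by
  rw [poisson_neg_swap, poisson_mul_left hg hg', poisson_neg_swap f g, poisson_neg_swap f g']
  ring

lemma sum_sum_eq_zero_of_antisymm {F : Fin n → Fin n → Phase n → ℂ}
    (h : ∀ i j, F i j + F j i = 0) : ∑ i, ∑ j, F i j = 0 := by
  have h2 : (∑ i, ∑ j, F i j) + ∑ i, ∑ j, F i j = 0 := by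
    nth_rewrite 2 [Finset.sum_comm]
    simp only [← Finset.sum_add_distrib, h, Finset.sum_const_zero]
  ext p
  have := congrFun h2 p
  simp only [Pi.add_apply, Pi.zero_apply] at this ⊢
  linear_combination this / 2

/-- The cyclic sum is a double sum over coordinate indices `i, j`. Once mixed derivatives are put in
a common order, its summand is antisymmetric under exchange of `i` and `j`. -/
lemma poisson_jacobi {a b c : Phase n → ℂ} (ha : ContDiff ℝ ∞ a) (hb : ContDiff ℝ ∞ b)
    (hc : ContDiff ℝ ∞ c) :
    poisson a (poisson b c) + poisson b (poisson c a) + poisson c (poisson a b) = 0 := by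
  have hD : ∀ (v : Phase n) {f g : Phase n → ℂ}, ContDiff ℝ ∞ f → ContDiff ℝ ∞ g →
      dV v (poisson f g) = ∑ j, (dV v (dXi j f) * dX j g + dXi j f * dV v (dX j g)
        - (dV v (dX j f) * dXi j g + dX j f * dV v (dXi j g))) := by
    intro v f g hf hg
    rw [poisson_eq, dV_sum (f := fun j => dXi j f * dX j g - dX j f * dXi j g) Finset.univ v
      fun j => ((dXi_contDiff j hf).mul (dX_contDiff j hg)).sub
      ((dX_contDiff j hf).mul (dXi_contDiff j hg))]
    refine Finset.sum_congr rfl fun j _ => ?_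
    rw [dV_sub (f := dXi j f * dX j g) (g := dX j f * dXi j g) _ ((dXi_contDiff j hf).mul (dX_contDiff j hg))
      ((dX_contDiff j hf).mul (dXi_contDiff j hg)), dV_mul _ (dXi_contDiff j hf)
      (dX_contDiff j hg), dV_mul _ (dX_contDiff j hf) (dXi_contDiff j hg)]
  have hP : ∀ {f g h : Phase n → ℂ}, ContDiff ℝ ∞ g → ContDiff ℝ ∞ h →
      poisson f (poisson g h) = ∑ i, ∑ j,
        (dXi i f * (dX i (dXi j g) * dX j h + dXi j g * dX i (dX j h)
          - (dX i (dX j g) * dXi j h + dX j g * dX i (dXi j h)))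
        - dX i f * (dXi i (dXi j g) * dX j h + dXi j g * dXi i (dX j h)
          - (dXi i (dX j g) * dXi j h + dX j g * dXi i (dXi j h)))) := by
    intro f g h hg hh
    rw [poisson_eq f]
    refine Finset.sum_congr rfl fun i _ => ?_
    rw [dX_eq_dV, dXi_eq_dV, hD _ hg hh, hD _ hg hh, Finset.mul_sum, Finset.mul_sum,
      ← Finset.sum_sub_distrib]
  rw [hP hb hc, hP hc ha, hP ha hb]
  simp only [← Finset.sum_add_distrib]
  refine sum_sum_eq_zero_of_antisymm fun i j => ?_
  have xx : ∀ {f : Phase n → ℂ}, ContDiff ℝ ∞ f → dX i (dX j f) = dX j (dX i f) :=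
    fun hf => dV_comm _ _ hf
  have pp : ∀ {f : Phase n → ℂ}, ContDiff ℝ ∞ f → dXi i (dXi j f) = dXi j (dXi i f) :=
    fun hf => dV_comm _ _ hf
  have px : ∀ (i j : Fin n) {f : Phase n → ℂ}, ContDiff ℝ ∞ f →
    dXi i (dX j f) = dX j (dXi i f) := fun i j _ hf => dV_comm _ _ hf
  simp only [xx ha, xx hb, xx hc, pp ha, pp hb, pp hc, px _ _ ha, px _ _ hb, px _ _ hc]
  ring

lemma poisson_mem {F : OrderFamily n} (hF : MulMaps F F F) (hd : AllDerivMaps F) {m k : ℝ × ℝ}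
    {a b : Phase n → ℂ} (ha : a ∈ F m) (hb : b ∈ F k) : poisson a b ∈ F (m + k - oneOne) := by
  rw [poisson_eq]
  refine Submodule.sum_mem _ fun i _ => Submodule.sub_mem _ ?_ ?_
  · have := hF ((hd i).2 ha) ((hd i).1 hb)
    rwa [show m - e₂ + (k - e₁) = m + k - oneOne by ext <;> simp <;> ring] at this
  · have := hF ((hd i).1 ha) ((hd i).2 hb)
    rwa [show m - e₁ + (k - e₂) = m + k - oneOne by ext <;> simp <;> ring] at this

lemma SG.poisson_mem {m k : ℝ × ℝ} {a b : Phase n → ℂ} (ha : a ∈ SG n m) (hb : b ∈ SG n k) :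
    poisson a b ∈ SG n (m + k - oneOne) := SGCalc.poisson_mem SG.mulMaps SG.allDerivMaps ha hb

/-- The Poisson bracket as a bilinear map on a space of smooth functions. -/
noncomputable def poissonBilin (S T : Submodule ℂ (Phase n → ℂ)) (hs : ∀ a ∈ S, ContDiff ℝ ∞ a)
    (hp : ∀ a ∈ S, ∀ b ∈ S, poisson a b ∈ T) : S →ₗ[ℂ] S →ₗ[ℂ] T :=
  LinearMap.mk₂ ℂ (fun a b => ⟨poisson a b, hp a a.2 b b.2⟩)
    (fun a a' _ => Subtype.ext (poisson_add_left (hs a a.2) (hs a' a'.2)))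
    (fun z a _ => Subtype.ext (poisson_smul_left z (hs a a.2)))
    (fun _ b b' => Subtype.ext (poisson_add_right (hs b b.2) (hs b' b'.2)))
    (fun z _ b => Subtype.ext (poisson_smul_right z (hs b b.2)))

lemma isPoissonLie_of {S : Submodule ℂ (Phase n → ℂ)} (hs : ∀ a ∈ S, ContDiff ℝ ∞ a)
    (hp : ∀ a ∈ S, ∀ b ∈ S, poisson a b ∈ S) : IsPoissonLie S :=
  ⟨poissonBilin S S hs hp, fun _ _ => rfl, fun _ => Subtype.ext (poisson_self _),
    fun a b c => Subtype.ext (poisson_jacobi (hs a a.2) (hs b b.2) (hs c c.2))⟩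

lemma isPoissonBiderivation_of {S : Submodule ℂ (Phase n → ℂ)} (hs : ∀ a ∈ S, ContDiff ℝ ∞ a) :
    IsPoissonBiderivation S := fun a ha b hb c hc =>
  ⟨poisson_mul_right (hs b hb) (hs c hc), by
    rw [poisson_mul_left (hs a ha) (hs b hb)]⟩

/-! ### The unions of all orders -/

lemma SG.smooth {m : ℝ × ℝ} {a : Phase n → ℂ} (ha : a ∈ SG n m) : ContDiff ℝ ∞ a :=
  (SG_le_Symb ha).1

lemma SG.int_mono {m k : ℤ × ℤ} (h : m ≤ k) :
    SG n ((m.1 : ℝ), (m.2 : ℝ)) ≤ SG n ((k.1 : ℝ), (k.2 : ℝ)) := by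
  obtain ⟨i, hi⟩ := Int.eq_ofNat_of_zero_le (sub_nonneg.2 h.1)
  obtain ⟨j, hj⟩ := Int.eq_ofNat_of_zero_le (sub_nonneg.2 h.2)
  have h1 : (m.1 : ℝ) = k.1 - i := by
    rw [show m.1 = k.1 - i by omega]; push_cast; rfl
  have h2 : (m.2 : ℝ) = k.2 - j := by
    rw [show m.2 = k.2 - j by omega]; push_cast; rfl
  rw [h1, h2]
  exact SG.shift ((k.1 : ℝ), (k.2 : ℝ)) i j

/-- Orders in `ℤ²` form a directed family because inclusions hold along integer shifts, so the span
is a union. For real orders this argument is unavailable, and `SGReal` is handled by induction over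
sums. -/
lemma mem_SGInt {a : Phase n → ℂ} :
    a ∈ SGInt n ↔ ∃ m : ℤ × ℤ, a ∈ SG n ((m.1 : ℝ), (m.2 : ℝ)) := by
  refine Submodule.mem_iSup_of_directed _ fun m k => ⟨m ⊔ k, SG.int_mono le_sup_left,
    SG.int_mono le_sup_right⟩

lemma SGInt.smooth : ∀ a ∈ SGInt n, ContDiff ℝ ∞ a := fun a ha => by
  obtain ⟨m, hm⟩ := mem_SGInt.1 ha
  exact SG.smooth hm

lemma SGInt.one_mem : (1 : Phase n → ℂ) ∈ SGInt n :=
  mem_SGInt.2 ⟨0, by simpa using! SG.one_mem⟩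

lemma SGInt.mul_mem : ∀ a ∈ SGInt n, ∀ b ∈ SGInt n, a * b ∈ SGInt n := by
  intro a ha b hb
  obtain ⟨m, hm⟩ := mem_SGInt.1 ha
  obtain ⟨k, hk⟩ := mem_SGInt.1 hb
  refine mem_SGInt.2 ⟨m + k, ?_⟩
  have := SG.mulMaps hm hk
  simpa using this

lemma SGInt.poisson_mem : ∀ a ∈ SGInt n, ∀ b ∈ SGInt n, poisson a b ∈ SGInt n := by
  intro a ha b hb
  obtain ⟨m, hm⟩ := mem_SGInt.1 ha
  obtain ⟨k, hk⟩ := mem_SGInt.1 hb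
  refine mem_SGInt.2 ⟨m + k - (1, 1), ?_⟩
  have := SG.poisson_mem hm hk
  simpa using this

lemma SG.le_SGReal (m : ℝ × ℝ) : SG n m ≤ SGReal n := le_iSup (SG n) m

lemma SGReal.smooth : ∀ a ∈ SGReal n, ContDiff ℝ ∞ a := by
  intro a ha
  refine Submodule.iSup_induction (SG n) (motive := fun a => ContDiff ℝ ∞ a) ha
    (fun m a ha => SG.smooth ha) contDiff_const fun a b ha hb => ha.add hb

lemma SGReal.mul_mem : ∀ a ∈ SGReal n, ∀ b ∈ SGReal n, a * b ∈ SGReal n := by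
  intro a ha b hb
  refine Submodule.iSup_induction (SG n) (motive := fun a => a * b ∈ SGReal n) ha
    (fun m a ha => ?_) (by simp) fun a a' ha ha' => by rw [add_mul]; exact add_mem ha ha'
  refine Submodule.iSup_induction (SG n) (motive := fun b => a * b ∈ SGReal n) hb
    (fun k b hb => ?_) (by simp) fun a a' ha ha' => by rw [mul_add]; exact add_mem ha ha'
  exact SG.le_SGReal _ (SG.mulMaps ha hb)

lemma poisson_zero_left (g : Phase n → ℂ) : poisson 0 g = 0 := by
  simp [poisson_eq, dX_eq_dV, dXi_eq_dV, dV_zero]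

lemma poisson_zero_right (g : Phase n → ℂ) : poisson g 0 = 0 := by
  simp [poisson_eq, dX_eq_dV, dXi_eq_dV, dV_zero]

lemma SGReal.poisson_mem : ∀ a ∈ SGReal n, ∀ b ∈ SGReal n, poisson a b ∈ SGReal n := by
  intro a ha b hb
  -- Smoothness is carried along in the motive, since additivity of the bracket needs both summands
  -- differentiable.
  refine (Submodule.iSup_induction (SG n)
    (motive := fun a => ContDiff ℝ ∞ a ∧ poisson a b ∈ SGReal n) ha (fun m a ha => ?_)
    ⟨contDiff_const, by simp [poisson_zero_left]⟩ fun a a' h h' => ⟨h.1.add h'.1, ?_⟩).2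
  · refine ⟨SG.smooth ha, ?_⟩
    refine (Submodule.iSup_induction (SG n)
      (motive := fun b => ContDiff ℝ ∞ b ∧ poisson a b ∈ SGReal n) hb (fun k b hb => ?_)
      ⟨contDiff_const, by simp [poisson_zero_right]⟩ fun b b' h h' => ⟨h.1.add h'.1, ?_⟩).2
    · exact ⟨SG.smooth hb, SG.le_SGReal _ (SG.poisson_mem ha hb)⟩
    · rw [poisson_add_right h.1 h'.1]; exact add_mem h.2 h'.2
  · rw [poisson_add_left h.1 h'.1]; exact add_mem h.2 h'.2

/-! ### Principal symbols -/

/-- For `μ ≥ 1` one has `μ|x| ≤ ⟨μx⟩ ≤ μ⟨x⟩`. The sign of `s` decides which side is relevant; adding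
both constants avoids the distinction. -/
lemma jap_smul_rpow_le {x : Pos n} (hx : x ≠ 0) (s : ℝ) {μ : ℝ} (hμ : 1 ≤ μ) :
    jap (μ • x) ^ s ≤ (‖x‖ ^ s + jap x ^ s) * μ ^ s := by
  have hμ0 : 0 < μ := by linarith
  have hn : 0 < ‖x‖ := norm_pos_iff.2 hx
  have h1 : μ * ‖x‖ ≤ jap (μ • x) := by
    have := norm_le_jap (μ • x)
    rwa [norm_smul, Real.norm_of_nonneg hμ0.le] at this
  have h2 : jap (μ • x) ≤ μ * jap x := by
    rw [jap, Real.sqrt_le_left (mul_nonneg hμ0.le (jap_nonneg x)), mul_pow, jap_sq, norm_smul,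
      Real.norm_of_nonneg hμ0.le, mul_pow]
    nlinarith
  have p1 := Real.rpow_nonneg hn.le s
  have p2 := (jap_rpow_pos x s).le
  have p3 := (Real.rpow_pos_of_pos hμ0 s).le
  rcases le_total 0 s with hs | hs
  · calc jap (μ • x) ^ s ≤ (μ * jap x) ^ s := Real.rpow_le_rpow (jap_nonneg _) h2 hs
      _ = jap x ^ s * μ ^ s := by rw [Real.mul_rpow hμ0.le (jap_nonneg x), mul_comm]
      _ ≤ _ := by gcongr; linarith
  · calc jap (μ • x) ^ s ≤ (μ * ‖x‖) ^ s := Real.rpow_le_rpow_of_nonpos (by positivity) h1 hs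
      _ = ‖x‖ ^ s * μ ^ s := by rw [Real.mul_rpow hμ0.le hn.le, mul_comm]
      _ ≤ _ := by gcongr; linarith

/-- The homogeneous limit of a function that is asymptotically homogeneous. -/
lemma tendsto_homogeneous {f g : Pos n → ℂ} {s c C : ℝ}
    (hg : ∀ t : ℝ, 1 ≤ t → ∀ x : Pos n, c < ‖x‖ → g (t • x) = ((t ^ s : ℝ) : ℂ) * g x)
    (hfg : ∀ x, ‖f x - g x‖ ≤ C * jap x ^ (s - 1)) {x : Pos n} (hx : x ≠ 0) {μ₀ : ℝ}
    (hμ₀ : 0 < μ₀) (h : c < ‖μ₀ • x‖) :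
    Tendsto (fun μ : ℝ => ((μ ^ (-s) : ℝ) : ℂ) * f (μ • x)) atTop
      (𝓝 (((μ₀ ^ (-s) : ℝ) : ℂ) * g (μ₀ • x))) := by
  -- The sign of the constant is read off from the estimate at the origin.
  have hC : 0 ≤ C := by
    have := (norm_nonneg _).trans (hfg 0)
    exact nonneg_of_mul_nonneg_left this (jap_rpow_pos _ _)
  have h1 : Tendsto (fun μ : ℝ => ((μ ^ (-s) : ℝ) : ℂ) * (f (μ • x) - g (μ • x))) atTop (𝓝 0) := by
    have hlim : Tendsto (fun μ : ℝ => C * (‖x‖ ^ (s - 1) + jap x ^ (s - 1)) * μ⁻¹) atTop (𝓝 0) := by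
      simpa using tendsto_inv_atTop_zero.const_mul (C * (‖x‖ ^ (s - 1) + jap x ^ (s - 1)))
    refine squeeze_zero_norm' ?_ hlim
    filter_upwards [eventually_ge_atTop (1 : ℝ)] with μ hμ
    have hμ0 : 0 < μ := by linarith
    have hp := Real.rpow_pos_of_pos hμ0 (-s)
    rw [norm_mul, Complex.norm_real, Real.norm_of_nonneg hp.le]
    calc μ ^ (-s) * ‖f (μ • x) - g (μ • x)‖
        ≤ μ ^ (-s) * (C * ((‖x‖ ^ (s - 1) + jap x ^ (s - 1)) * μ ^ (s - 1))) := by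
          gcongr
          exact (hfg _).trans (mul_le_mul_of_nonneg_left (jap_smul_rpow_le hx _ hμ) hC)
      _ = C * (‖x‖ ^ (s - 1) + jap x ^ (s - 1)) * (μ ^ (-s) * μ ^ (s - 1)) := by ring
      _ = _ := by rw [← Real.rpow_add hμ0, ← Real.rpow_neg_one]; congr 2; ring
  have h2 : Tendsto (fun μ : ℝ => ((μ ^ (-s) : ℝ) : ℂ) * g (μ • x)) atTop
      (𝓝 (((μ₀ ^ (-s) : ℝ) : ℂ) * g (μ₀ • x))) := by
    -- From `μ₀` on, homogeneity makes this expression constant in `μ`.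
    refine Tendsto.congr' ?_ tendsto_const_nhds
    filter_upwards [eventually_ge_atTop μ₀] with μ hμ
    have hμ0 : 0 < μ := by linarith
    have := hg (μ / μ₀) ((one_le_div hμ₀).2 hμ) (μ₀ • x) h
    rw [smul_smul, div_mul_cancel₀ _ hμ₀.ne'] at this
    rw [this, ← mul_assoc, ← ofReal_mul, Real.div_rpow hμ0.le hμ₀.le, Real.rpow_neg hμ0.le,
      Real.rpow_neg hμ₀.le]
    congr 2
    have := (Real.rpow_pos_of_pos hμ0 s).ne'
    field_simp
  have := h1.add h2
  simp only [zero_add] at this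
  refine this.congr fun μ => ?_
  ring

lemma eventually_large_smul (c : ℝ) {x : Pos n} (hx : x ≠ 0) :
    ∀ᶠ μ : ℝ in atTop, 0 < μ ∧ c < ‖μ • x‖ := by
  have hn : 0 < ‖x‖ := norm_pos_iff.2 hx
  filter_upwards [eventually_gt_atTop 0, eventually_gt_atTop (c / ‖x‖)] with μ h1 h2
  refine ⟨h1, ?_⟩
  rw [norm_smul, Real.norm_of_nonneg h1.le]
  exact (div_lt_iff₀ hn).1 h2

lemma tendsto_sigmaE {m : ℝ × ℝ} {a b : Phase n → ℂ} {c : ℝ}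
    (hb : ∀ t : ℝ, 1 ≤ t → ∀ x ξ : Pos n, c < ‖x‖ → b (t • x, ξ) = ((t ^ m.1 : ℝ) : ℂ) * b (x, ξ))
    (hr : SymbBound (m - e₁) (a - b)) {x ξ : Pos n} (hx : x ≠ 0) {μ₀ : ℝ}
    (hμ₀ : 0 < μ₀) (h : c < ‖μ₀ • x‖) :
    Tendsto (fun μ : ℝ => ((μ ^ (-m.1) : ℝ) : ℂ) * a (μ • x, ξ)) atTop
      (𝓝 (((μ₀ ^ (-m.1) : ℝ) : ℂ) * b (μ₀ • x, ξ))) := by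
  obtain ⟨C, hC⟩ := hr
  refine tendsto_homogeneous (f := fun x => a (x, ξ)) (g := fun x => b (x, ξ)) (c := c)
    (C := C * jap ξ ^ m.2) (fun t ht x hx => hb t ht x ξ hx) (fun x => ?_) hx hμ₀ h
  refine (hC x ξ).trans_eq ?_
  simp
  ring

lemma tendsto_sigmaPsi {m : ℝ × ℝ} {a b : Phase n → ℂ} {c : ℝ}
    (hb : ∀ t : ℝ, 1 ≤ t → ∀ x ξ : Pos n, c < ‖ξ‖ → b (x, t • ξ) = ((t ^ m.2 : ℝ) : ℂ) * b (x, ξ))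
    (hr : SymbBound (m - e₂) (a - b)) {x ξ : Pos n} (hx : ξ ≠ 0) {μ₀ : ℝ}
    (hμ₀ : 0 < μ₀) (h : c < ‖μ₀ • ξ‖) :
    Tendsto (fun μ : ℝ => ((μ ^ (-m.2) : ℝ) : ℂ) * a (x, μ • ξ)) atTop
      (𝓝 (((μ₀ ^ (-m.2) : ℝ) : ℂ) * b (x, μ₀ • ξ))) := by
  obtain ⟨C, hC⟩ := hr
  refine tendsto_homogeneous (f := fun ξ => a (x, ξ)) (g := fun ξ => b (x, ξ)) (c := c)
    (C := C * jap x ^ m.1) (fun t ht ξ hx => hb t ht x ξ hx) (fun ξ => ?_) hx hμ₀ h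
  refine (hC x ξ).trans_eq ?_
  simp

/-- For fixed `ξ` the inner limit equals `t^{-m_ψ} b(·, t ξ)` with one finite `t`, so the outer
limit is again that of a function with a homogeneous leading part, namely that of `d`. -/
lemma tendsto_sigmaPsiE {m : ℝ × ℝ} {a b d : Phase n → ℂ} {c : ℝ}
    (hb : ∀ t : ℝ, 1 ≤ t → ∀ x ξ : Pos n, c < ‖ξ‖ → b (x, t • ξ) = ((t ^ m.2 : ℝ) : ℂ) * b (x, ξ))
    (hr : SymbBound (m - e₂) (a - b))
    (hd : ∀ s t : ℝ, 1 ≤ s → 1 ≤ t → ∀ x ξ : Pos n, c < ‖x‖ → c < ‖ξ‖ →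
      d (s • x, t • ξ) = ((s ^ m.1 * t ^ m.2 : ℝ) : ℂ) * d (x, ξ))
    (hr' : SymbBound (m - e₁) (b - d)) {x ξ : Pos n} (hx : x ≠ 0) (hξ : ξ ≠ 0) {s t : ℝ}
    (hs : 0 < s) (ht : 0 < t) (hsx : c < ‖s • x‖) (htξ : c < ‖t • ξ‖) :
    Tendsto (fun μ : ℝ => ((μ ^ (-m.1) : ℝ) : ℂ) * sigmaPsi m.2 a (μ • x, ξ)) atTop
      (𝓝 (((s ^ (-m.1) * t ^ (-m.2) : ℝ) : ℂ) * d (s • x, t • ξ))) := by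
  obtain ⟨C, hC⟩ := hr'
  have hσ : ∀ y : Pos n, sigmaPsi m.2 a (y, ξ) = ((t ^ (-m.2) : ℝ) : ℂ) * b (y, t • ξ) := fun y =>
    (tendsto_sigmaPsi hb hr hξ ht htξ).limUnder_eq
  have := tendsto_homogeneous (f := fun x => ((t ^ (-m.2) : ℝ) : ℂ) * b (x, t • ξ))
    (g := fun x => ((t ^ (-m.2) : ℝ) : ℂ) * d (x, t • ξ)) (s := m.1) (c := c)
    (C := t ^ (-m.2) * C * jap (t • ξ) ^ m.2) (fun r hr x hx => ?_) (fun x => ?_) hx hs hsx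
  · simp_rw [hσ]
    convert this using 2
    push_cast
    ring
  · have := hd r 1 hr le_rfl x (t • ξ) hx htξ
    simp only [one_smul, Real.one_rpow, mul_one] at this
    rw [this]
    ring
  · rw [← mul_sub, norm_mul, Complex.norm_real,
      Real.norm_of_nonneg (Real.rpow_nonneg ht.le _)]
    have h := hC x (t • ξ)
    simp only [Pi.sub_apply, Prod.fst_sub, Prod.snd_sub, sub_zero] at h
    calc _ ≤ t ^ (-m.2) * (C * jap x ^ (m.1 - 1) * jap (t • ξ) ^ m.2) := by gcongr
      _ = _ := by ring

/-- Local representation of the exit symbol. -/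
lemma sigmaE_eventuallyEq {m : ℝ × ℝ} {a b : Phase n → ℂ} (hb : b ∈ EvHomE n m.1)
    (hr : SymbBound (m - e₁) (a - b)) {p : Phase n} (hp : p.1 ≠ 0) :
    ∀ᶠ μ : ℝ in atTop, 0 < μ ∧
      sigmaE m.1 a =ᶠ[𝓝 p] fun q => ((μ ^ (-m.1) : ℝ) : ℂ) * b (dil μ 1 q) := by
  obtain ⟨c, hc, hb⟩ := hb
  -- One finite `μ` that reaches the homogeneous region at `p` also does so near `p`. All large `μ`
  -- are allowed, so that several symbols can later be represented with a common `μ`.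
  filter_upwards [eventually_large_smul c hp] with μ hμ
  refine ⟨hμ.1, ?_⟩
  have h1 : ∀ᶠ q : Phase n in 𝓝 p, c < ‖μ • q.1‖ :=
    (isOpen_lt continuous_const (by fun_prop)).mem_nhds hμ.2
  have h2 : ∀ᶠ q : Phase n in 𝓝 p, q.1 ≠ 0 := continuous_fst.continuousAt.eventually_ne hp
  filter_upwards [h1, h2] with q h1 h2
  simp only [dil_apply, one_smul]
  exact (tendsto_sigmaE hb hr (ξ := q.2) h2 hμ.1 h1).limUnder_eq

/-- Local representation of the pseudo-differential symbol. -/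
lemma sigmaPsi_eventuallyEq {m : ℝ × ℝ} {a b : Phase n → ℂ} (hb : b ∈ EvHomPsi n m.2)
    (hr : SymbBound (m - e₂) (a - b)) {p : Phase n} (hp : p.2 ≠ 0) :
    ∀ᶠ μ : ℝ in atTop, 0 < μ ∧
      sigmaPsi m.2 a =ᶠ[𝓝 p] fun q => ((μ ^ (-m.2) : ℝ) : ℂ) * b (dil 1 μ q) := by
  obtain ⟨c, hc, hb⟩ := hb
  filter_upwards [eventually_large_smul c hp] with μ hμ
  refine ⟨hμ.1, ?_⟩
  have h1 : ∀ᶠ q : Phase n in 𝓝 p, c < ‖μ • q.2‖ :=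
    (isOpen_lt continuous_const (by fun_prop)).mem_nhds hμ.2
  have h2 : ∀ᶠ q : Phase n in 𝓝 p, q.2 ≠ 0 := continuous_snd.continuousAt.eventually_ne hp
  filter_upwards [h1, h2] with q h1 h2
  simp only [dil_apply, one_smul]
  exact (tendsto_sigmaPsi hb hr (x := q.1) h2 hμ.1 h1).limUnder_eq

/-- Local representation of the corner symbol. -/
lemma sigmaPsiE_eventuallyEq {m : ℝ × ℝ} {a b d : Phase n → ℂ} (hb : b ∈ EvHomPsi n m.2)
    (hr : SymbBound (m - e₂) (a - b)) (hd : d ∈ EvHomBi n m) (hr' : SymbBound (m - e₁) (b - d))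
    {p : Phase n} (hp : p.1 ≠ 0) (hp' : p.2 ≠ 0) :
    ∀ᶠ μ : ℝ in atTop, 0 < μ ∧
      sigmaPsiE m a =ᶠ[𝓝 p] fun q => ((μ ^ (-m.1) * μ ^ (-m.2) : ℝ) : ℂ) * d (dil μ μ q) := by
  obtain ⟨c₁, -, hb⟩ := hb
  obtain ⟨c₂, -, hd⟩ := hd
  filter_upwards [eventually_large_smul (max c₁ c₂) hp, eventually_large_smul (max c₁ c₂) hp']
    with μ hμ hμ'
  refine ⟨hμ.1, ?_⟩
  have h1 : ∀ᶠ q : Phase n in 𝓝 p, max c₁ c₂ < ‖μ • q.1‖ :=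
    (isOpen_lt continuous_const (by fun_prop)).mem_nhds hμ.2
  have h2 : ∀ᶠ q : Phase n in 𝓝 p, q.1 ≠ 0 := continuous_fst.continuousAt.eventually_ne hp
  have h3 : ∀ᶠ q : Phase n in 𝓝 p, max c₁ c₂ < ‖μ • q.2‖ :=
    (isOpen_lt continuous_const (by fun_prop)).mem_nhds hμ'.2
  have h4 : ∀ᶠ q : Phase n in 𝓝 p, q.2 ≠ 0 := continuous_snd.continuousAt.eventually_ne hp'
  filter_upwards [h1, h2, h3, h4] with q h1 h2 h3 h4
  exact (tendsto_sigmaPsiE (c := max c₁ c₂)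
    (fun t ht x ξ h => hb t ht x ξ ((le_max_left _ _).trans_lt h)) hr
    (fun s t hs ht x ξ h h' => hd s t hs ht x ξ ((le_max_right _ _).trans_lt h)
      ((le_max_right _ _).trans_lt h')) hr' h2 h4 hμ.1 hμ.1 h1 h3).limUnder_eq

/-- The leading terms of the exit expansion. -/
lemma SG.exists_exit_leading {m : ℝ × ℝ} {a : Phase n → ℂ} (ha : a ∈ SG n m) :
    ∃ b ∈ SGHomEClPsi n m, a - b ∈ SGClPsi n (m.1 - 1, m.2) := by
  obtain ⟨-, s, hs, hr⟩ := ha.2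
  exact ⟨s 0, by simpa using hs 0, by simpa using hr 0⟩

/-- The leading terms of the pseudo-differential expansion. -/
lemma SG.exists_psi_leading {m : ℝ × ℝ} {a : Phase n → ℂ} (ha : a ∈ SG n m) :
    ∃ b ∈ SGHomPsiClE n m, a - b ∈ SGClE n (m.1, m.2 - 1) := by
  obtain ⟨-, s, hs, hr⟩ := ha.1
  exact ⟨s 0, by simpa using hs 0, by simpa using hr 0⟩

lemma SGHomPsiClE.exists_leading {m : ℝ × ℝ} {a : Phase n → ℂ} (ha : a ∈ SGHomPsiClE n m) :
    ∃ d ∈ HomBi n m, a - d ∈ Symb n (m - e₁) := by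
  rw [SGHomPsiClE_eq] at ha
  obtain ⟨-, s, hs, hr⟩ := mem_ExpF.1 ha
  exact ⟨s 0, by simpa using hs 0, by simpa using hr 0⟩

lemma e₁_sub (m : ℝ × ℝ) : (m.1 - 1, m.2) = m - e₁ := by ext <;> simp

lemma e₂_sub (m : ℝ × ℝ) : (m.1, m.2 - 1) = m - e₂ := by ext <;> simp

end SGCalc

/-! ### Properties of principal symbols and the induced brackets -/

namespace SGCalc

variable {n : ℕ}

lemma contDiffAt_dil {a : Phase n → ℂ} (ha : ContDiff ℝ ∞ a) (z : ℂ) (s t : ℝ) (p : Phase n) :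
    ContDiffAt ℝ ∞ (fun q => z * a (dil s t q)) p :=
  (contDiff_const.mul (ha.comp (dil s t).contDiff)).contDiffAt

lemma rpow_neg_scale {s t μ : ℝ} (ht : 0 < t) (hμ : 0 < μ) :
    ((μ ^ (-s) : ℝ) : ℂ) = ((t ^ s : ℝ) : ℂ) * (((μ * t) ^ (-s) : ℝ) : ℂ) := by
  rw [← ofReal_mul, Real.mul_rpow hμ.le ht.le, mul_left_comm, ← Real.rpow_add ht]
  simp

lemma SG.hasExitSymbol {m : ℝ × ℝ} {a : Phase n → ℂ} (ha : a ∈ SG n m) :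
    HasExitSymbol m a (sigmaE m.1 a) ∧
      ∀ x ξ : Pos n, x ≠ 0 → Tendsto (fun μ : ℝ => ((μ ^ (-m.1) : ℝ) : ℂ) * a (μ • x, ξ))
        atTop (𝓝 (sigmaE m.1 a (x, ξ))) := by
  obtain ⟨b, hb, hr⟩ := SG.exists_exit_leading ha
  have hbE := SGHomEClPsi.le_HomE m hb
  have hrB : SymbBound (m - e₁) (a - b) := by
    rw [← e₁_sub]; exact Symb.bound (SGClPsi.le_Symb _ hr)
  obtain ⟨c, hc, hbh⟩ := hbE.1
  refine ⟨⟨⟨fun p hp => ?_, fun t ht x ξ hx => ?_⟩, b, hb, hr, c, hc, fun x ξ hx => ?_⟩,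
    fun x ξ hx => ?_⟩
  · obtain ⟨μ, -, hμ⟩ := (sigmaE_eventuallyEq hbE.1 hrB hp).exists
    exact ((contDiffAt_dil hbE.2.1 _ μ 1 p).congr_of_eventuallyEq hμ).contDiffWithinAt
  · obtain ⟨μ, hμ, h⟩ := (eventually_large_smul c (smul_ne_zero ht.ne' hx)).exists
    have h1 := (tendsto_sigmaE hbh hrB (ξ := ξ) (smul_ne_zero ht.ne' hx) hμ h).limUnder_eq
    rw [smul_smul] at h
    have h2 := (tendsto_sigmaE hbh hrB (ξ := ξ) hx (mul_pos hμ ht) h).limUnder_eq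
    unfold sigmaE
    rw [h1, h2, smul_smul, rpow_neg_scale ht hμ, mul_assoc]
  · have hx0 : x ≠ 0 := norm_pos_iff.1 (hc.trans hx)
    have := (tendsto_sigmaE hbh hrB (ξ := ξ) hx0 one_pos (by simpa using hx)).limUnder_eq
    simp only [Real.one_rpow, ofReal_one, one_smul, one_mul] at this
    exact this.symm
  · obtain ⟨μ, hμ, h⟩ := (eventually_large_smul c hx).exists
    have := tendsto_sigmaE hbh hrB (ξ := ξ) hx hμ h
    rwa [← this.limUnder_eq] at this

lemma SG.hasPsiSymbol {m : ℝ × ℝ} {a : Phase n → ℂ} (ha : a ∈ SG n m) :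
    HasPsiSymbol m a (sigmaPsi m.2 a) ∧
      ∀ x ξ : Pos n, ξ ≠ 0 → Tendsto (fun μ : ℝ => ((μ ^ (-m.2) : ℝ) : ℂ) * a (x, μ • ξ))
        atTop (𝓝 (sigmaPsi m.2 a (x, ξ))) := by
  obtain ⟨b, hb, hr⟩ := SG.exists_psi_leading ha
  have hbE := SGHomPsiClE.le_HomPsi m hb
  have hrB : SymbBound (m - e₂) (a - b) := by
    rw [← e₂_sub]; exact Symb.bound (SGClE.le_Symb _ hr)
  obtain ⟨c, hc, hbh⟩ := hbE.1
  refine ⟨⟨⟨fun p hp => ?_, fun t ht x ξ hx => ?_⟩, b, hb, hr, c, hc, fun x ξ hx => ?_⟩,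
    fun x ξ hx => ?_⟩
  · obtain ⟨μ, -, hμ⟩ := (sigmaPsi_eventuallyEq hbE.1 hrB hp).exists
    exact ((contDiffAt_dil hbE.2.1 _ 1 μ p).congr_of_eventuallyEq hμ).contDiffWithinAt
  · obtain ⟨μ, hμ, h⟩ := (eventually_large_smul c (smul_ne_zero ht.ne' hx)).exists
    have h1 := (tendsto_sigmaPsi hbh hrB (x := x) (smul_ne_zero ht.ne' hx) hμ h).limUnder_eq
    rw [smul_smul] at h
    have h2 := (tendsto_sigmaPsi hbh hrB (x := x) hx (mul_pos hμ ht) h).limUnder_eq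
    unfold sigmaPsi
    rw [h1, h2, smul_smul, rpow_neg_scale ht hμ, mul_assoc]
  · have hx0 : ξ ≠ 0 := norm_pos_iff.1 (hc.trans hx)
    have := (tendsto_sigmaPsi hbh hrB (x := x) hx0 one_pos (by simpa using hx)).limUnder_eq
    simp only [Real.one_rpow, ofReal_one, one_smul, one_mul] at this
    exact this.symm
  · obtain ⟨μ, hμ, h⟩ := (eventually_large_smul c hx).exists
    have := tendsto_sigmaPsi hbh hrB (x := x) hx hμ h
    rwa [← this.limUnder_eq] at this

/-- The leading terms for the corner symbol. -/
lemma SG.exists_corner_leading {m : ℝ × ℝ} {a : Phase n → ℂ} (ha : a ∈ SG n m) :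
    ∃ b ∈ HomPsi n m, ∃ d ∈ HomBi n m, a - b ∈ Symb n (m - e₂) ∧ b - d ∈ Symb n (m - e₁) := by
  obtain ⟨b, hb, hr⟩ := SG.exists_psi_leading ha
  obtain ⟨d, hd, hr'⟩ := SGHomPsiClE.exists_leading hb
  refine ⟨b, SGHomPsiClE.le_HomPsi m hb, d, hd, ?_, hr'⟩
  rw [← e₂_sub]
  exact SGClE.le_Symb _ hr

lemma SG.cornerSymbol {m : ℝ × ℝ} {a : Phase n → ℂ} (ha : a ∈ SG n m) :
    IsHomBi m (sigmaPsiE m a) ∧ ∀ x ξ : Pos n, x ≠ 0 → ξ ≠ 0 →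
      Tendsto (fun μ : ℝ => ((μ ^ (-m.1) : ℝ) : ℂ) * sigmaPsi m.2 a (μ • x, ξ))
        atTop (𝓝 (sigmaPsiE m a (x, ξ))) := by
  obtain ⟨b, hb, d, hd, hr, hr'⟩ := SG.exists_corner_leading ha
  have hrB := Symb.bound hr
  have hrB' := Symb.bound hr'
  have hlim : ∃ c : ℝ, ∀ {x ξ : Pos n}, x ≠ 0 → ξ ≠ 0 → ∀ {s t : ℝ}, 0 < s → 0 < t →
      c < ‖s • x‖ → c < ‖t • ξ‖ →
      Tendsto (fun μ : ℝ => ((μ ^ (-m.1) : ℝ) : ℂ) * sigmaPsi m.2 a (μ • x, ξ)) atTop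
        (𝓝 (((s ^ (-m.1) * t ^ (-m.2) : ℝ) : ℂ) * d (s • x, t • ξ))) := by
    obtain ⟨c₁, -, hb⟩ := hb.1
    obtain ⟨c₂, -, hd⟩ := hd.1
    exact ⟨max c₁ c₂, fun hx hξ s t hs ht h1 h2 => tendsto_sigmaPsiE
      (fun t ht x ξ h => hb t ht x ξ ((le_max_left _ _).trans_lt h)) hrB
      (fun s t hs ht x ξ h h' => hd s t hs ht x ξ ((le_max_right _ _).trans_lt h)
      ((le_max_right _ _).trans_lt h')) hrB' hx hξ hs ht h1 h2⟩
  obtain ⟨c, hlim⟩ := hlim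
  refine ⟨⟨fun p hp => ?_, fun s t hs ht x ξ hx hξ => ?_⟩, fun x ξ hx hξ => ?_⟩
  · obtain ⟨μ, -, hμ⟩ := (sigmaPsiE_eventuallyEq hb.1 hrB hd.1 hrB' hp.1 hp.2).exists
    exact ((contDiffAt_dil hd.2.1 _ μ μ p).congr_of_eventuallyEq hμ).contDiffWithinAt
  · obtain ⟨μ, hμ, h⟩ := (eventually_large_smul c (smul_ne_zero hs.ne' hx)).exists
    obtain ⟨ν, hν, h'⟩ := (eventually_large_smul c (smul_ne_zero ht.ne' hξ)).exists
    have h1 := (hlim (smul_ne_zero hs.ne' hx) (smul_ne_zero ht.ne' hξ) hμ hν h h').limUnder_eq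
    rw [smul_smul] at h h'
    have h2 := (hlim hx hξ (mul_pos hμ hs) (mul_pos hν ht) h h').limUnder_eq
    unfold sigmaPsiE sigmaE
    rw [h1, h2, smul_smul, smul_smul, ofReal_mul, rpow_neg_scale hs hμ, rpow_neg_scale ht hν]
    push_cast
    ring
  · obtain ⟨μ, hμ, h⟩ := (eventually_large_smul c hx).exists
    obtain ⟨ν, hν, h'⟩ := (eventually_large_smul c hξ).exists
    have := hlim hx hξ hμ hν h h'
    have e := this.limUnder_eq
    rw [← e] at this
    exact this

/-- Zero is homogeneous of every degree and serves as leading term, since the order of `a` is lower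
by one in each variable. -/
lemma sigma_eqOn_zero {m : ℝ × ℝ} {a : Phase n → ℂ} (ha : a ∈ Symb n (m - oneOne)) :
    Set.EqOn (sigmaE m.1 a) 0 {p | p.1 ≠ 0} ∧ Set.EqOn (sigmaPsi m.2 a) 0 {p | p.2 ≠ 0} ∧
      Set.EqOn (sigmaPsiE m a) 0 {p | p.1 ≠ 0 ∧ p.2 ≠ 0} := by
  have h1 : SymbBound (m - e₁) (a - 0) := by
    rw [sub_zero]
    exact (Symb.bound ha).mono ⟨by simp, by simp⟩
  have h2 : SymbBound (m - e₂) (a - 0) := by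
    rw [sub_zero]
    exact (Symb.bound ha).mono ⟨by simp, by simp⟩
  have h3 : SymbBound (m - e₁) ((0 : Phase n → ℂ) - 0) := ⟨0, fun x ξ => by simp⟩
  refine ⟨fun p hp => ?_, fun p hp => ?_, fun p hp => ?_⟩
  · obtain ⟨μ, -, hμ⟩ := (sigmaE_eventuallyEq (EvHomE n m.1).zero_mem h1 hp).exists
    simpa using hμ.eq_of_nhds
  · obtain ⟨μ, -, hμ⟩ := (sigmaPsi_eventuallyEq (EvHomPsi n m.2).zero_mem h2 hp).exists
    simpa using hμ.eq_of_nhds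
  · obtain ⟨μ, -, hμ⟩ := (sigmaPsiE_eventuallyEq (EvHomPsi n m.2).zero_mem h2
      (EvHomBi n m).zero_mem h3 hp.1 hp.2).exists
    simpa using hμ.eq_of_nhds

/-! ### Principal symbols of Poisson brackets -/

lemma dV_congr_dil {F f : Phase n → ℂ} {z : ℂ} {s t : ℝ} {p : Phase n}
    (hF : F =ᶠ[𝓝 p] fun q => z * f (dil s t q)) (hf : ContDiff ℝ ∞ f) (v : Phase n) :
    dV v F p = z * dV (dil s t v) f (dil s t p) := by
  have h1 : fderiv ℝ (f ∘ dil s t) p = (fderiv ℝ f (dil s t p)).comp (dil s t) := by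
    rw [fderiv_comp _ (smooth_diffAt hf _) (dil s t).differentiableAt, ContinuousLinearMap.fderiv]
  have h2 : fderiv ℝ F p = z • fderiv ℝ (f ∘ dil s t) p := by
    have : F =ᶠ[𝓝 p] z • (f ∘ dil s t) := hF
    rw [this.fderiv_eq, fderiv_const_smul
      ((smooth_diffAt hf _).comp p (dil s t).differentiableAt)]
  simp [dV, h2, h1]

/-- Each summand of the bracket has one `x`-derivative and one `ξ`-derivative, which contribute the
factors `s` and `t`. -/
lemma poisson_congr_dil {F G f g : Phase n → ℂ} {z w : ℂ} {s t : ℝ} {p : Phase n}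
    (hF : F =ᶠ[𝓝 p] fun q => z * f (dil s t q)) (hG : G =ᶠ[𝓝 p] fun q => w * g (dil s t q))
    (hf : ContDiff ℝ ∞ f) (hg : ContDiff ℝ ∞ g) :
    poisson F G p = z * w * (s * t : ℝ) * poisson f g (dil s t p) := by
  have hx : ∀ (i : Fin n) (f : Phase n → ℂ), dV (dil s t (EuclideanSpace.single i (1 : ℝ), 0)) f
      = (s : ℂ) • dX i f := fun i f => by
    have : dil s t ((EuclideanSpace.single i (1 : ℝ), 0) : Phase n)
        = s • ((EuclideanSpace.single i (1 : ℝ), 0) : Phase n) := by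
      rw [dil_apply, Prod.smul_mk]; simp
    ext q
    simp only [this, dV, map_smul, dX, Pi.smul_apply, Complex.real_smul, smul_eq_mul]
  have hξ : ∀ (i : Fin n) (f : Phase n → ℂ), dV (dil s t (0, EuclideanSpace.single i (1 : ℝ))) f
      = (t : ℂ) • dXi i f := fun i f => by
    have : dil s t ((0, EuclideanSpace.single i (1 : ℝ)) : Phase n)
        = t • ((0, EuclideanSpace.single i (1 : ℝ)) : Phase n) := by
      rw [dil_apply, Prod.smul_mk]; simp
    ext q
    simp only [this, dV, map_smul, dXi, Pi.smul_apply, Complex.real_smul, smul_eq_mul]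
  simp only [poisson, dX_eq_dV, dXi_eq_dV, dV_congr_dil hF hf, dV_congr_dil hG hg, hx, hξ,
    Finset.mul_sum, Pi.smul_apply, smul_eq_mul]
  refine Finset.sum_congr rfl fun i _ => ?_
  push_cast
  ring

lemma HomPsi.poisson_mem {m k : ℝ × ℝ} {a b : Phase n → ℂ} (ha : a ∈ HomPsi n m)
    (hb : b ∈ HomPsi n k) : poisson a b ∈ HomPsi n (m + k - oneOne) :=
  SGCalc.poisson_mem HomPsi.mulMaps HomPsi.allDerivMaps ha hb

/-- Replace one argument at a time. Bracketing with order `(1, 1)` preserves the order of the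
difference, so the bracket of leading terms is a leading term of the bracket. -/
lemma poisson_sub_poisson_mem {d : ℝ × ℝ} {a b a' b' : Phase n → ℂ} (ha : a ∈ Symb n oneOne)
    (ha' : a' ∈ Symb n oneOne) (hb : b ∈ Symb n oneOne) (hb' : b' ∈ Symb n oneOne)
    (hr : a - a' ∈ Symb n (oneOne - d)) (hr' : b - b' ∈ Symb n (oneOne - d)) :
    poisson a b - poisson a' b' ∈ Symb n (oneOne - d) := by
  have e : poisson a b - poisson a' b' = poisson (a - a') b + poisson a' (b - b') := by
    rw [poisson_sub_left ha.1 ha'.1, poisson_sub_right hb.1 hb'.1]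
    abel
  rw [e]
  refine add_mem ?_ ?_
  · have := SGCalc.poisson_mem Symb.mulMaps Symb.allDerivMaps hr hb
    rwa [add_sub_cancel_right] at this
  · have := SGCalc.poisson_mem Symb.mulMaps Symb.allDerivMaps ha' hr'
    rwa [add_sub_cancel_left] at this

lemma rpow_neg_one_cancel {μ : ℝ} (hμ : 0 < μ) :
    ((μ ^ (-1 : ℝ) : ℝ) : ℂ) * (μ : ℂ) = 1 := by
  rw [Real.rpow_neg_one, ← ofReal_mul, inv_mul_cancel₀ hμ.ne', ofReal_one]

lemma sigmaE_poisson {a b : Phase n → ℂ} (ha : a ∈ SG n oneOne) (hb : b ∈ SG n oneOne) :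
    Set.EqOn (sigmaE 1 (poisson a b)) (poisson (sigmaE 1 a) (sigmaE 1 b)) {p | p.1 ≠ 0} := by
  intro p hp
  obtain ⟨a', ha', har⟩ := SG.exists_exit_leading ha
  obtain ⟨b', hb', hbr⟩ := SG.exists_exit_leading hb
  replace ha' := SGHomEClPsi.le_HomE _ ha'
  replace hb' := SGHomEClPsi.le_HomE _ hb'
  rw [e₁_sub] at har hbr
  replace har := SGClPsi.le_Symb _ har
  replace hbr := SGClPsi.le_Symb _ hbr
  have hP : poisson a' b' ∈ HomE n oneOne := by
    simpa using SGCalc.poisson_mem HomE.mulMaps HomE.allDerivMaps ha' hb'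
  have hr := poisson_sub_poisson_mem (SG_le_Symb ha) ha'.2 (SG_le_Symb hb) hb'.2 har hbr
  -- A single `μ` represents the symbols of `a`, `b` and their bracket near `p`; the powers then
  -- match by `μ⁻¹ μ⁻¹ μ = μ⁻¹`.
  obtain ⟨μ, ⟨hμ, h1⟩, ⟨-, h2⟩, -, h3⟩ := ((sigmaE_eventuallyEq ha'.1 (Symb.bound har) hp).and
    ((sigmaE_eventuallyEq hb'.1 (Symb.bound hbr) hp).and
      (sigmaE_eventuallyEq hP.1 (Symb.bound hr) hp))).exists
  rw [poisson_congr_dil h1 h2 ha'.2.1 hb'.2.1]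
  refine h3.eq_of_nhds.trans ?_
  push_cast
  linear_combination (-((μ ^ (-1 : ℝ) : ℝ) : ℂ) * poisson a' b' (dil μ 1 p)) * rpow_neg_one_cancel hμ

lemma sigmaPsi_poisson {a b : Phase n → ℂ} (ha : a ∈ SG n oneOne) (hb : b ∈ SG n oneOne) :
    Set.EqOn (sigmaPsi 1 (poisson a b)) (poisson (sigmaPsi 1 a) (sigmaPsi 1 b)) {p | p.2 ≠ 0} := by
  intro p hp
  obtain ⟨a', ha', -, -, har, -⟩ := SG.exists_corner_leading ha
  obtain ⟨b', hb', -, -, hbr, -⟩ := SG.exists_corner_leading hb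
  have hP : poisson a' b' ∈ HomPsi n oneOne := by simpa using HomPsi.poisson_mem ha' hb'
  have hr := poisson_sub_poisson_mem (SG_le_Symb ha) ha'.2 (SG_le_Symb hb) hb'.2 har hbr
  obtain ⟨μ, ⟨hμ, h1⟩, ⟨-, h2⟩, -, h3⟩ := ((sigmaPsi_eventuallyEq ha'.1 (Symb.bound har) hp).and
    ((sigmaPsi_eventuallyEq hb'.1 (Symb.bound hbr) hp).and
      (sigmaPsi_eventuallyEq hP.1 (Symb.bound hr) hp))).exists
  rw [poisson_congr_dil h1 h2 ha'.2.1 hb'.2.1]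
  refine h3.eq_of_nhds.trans ?_
  push_cast
  linear_combination (-((μ ^ (-1 : ℝ) : ℝ) : ℂ) * poisson a' b' (dil 1 μ p)) * rpow_neg_one_cancel hμ

lemma sigmaPsiE_poisson {a b : Phase n → ℂ} (ha : a ∈ SG n oneOne) (hb : b ∈ SG n oneOne) :
    Set.EqOn (sigmaPsiE oneOne (poisson a b))
      (poisson (sigmaPsiE oneOne a) (sigmaPsiE oneOne b)) {p | p.1 ≠ 0 ∧ p.2 ≠ 0} := by
  intro p hp
  obtain ⟨a', ha', a'', ha'', har, har'⟩ := SG.exists_corner_leading ha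
  obtain ⟨b', hb', b'', hb'', hbr, hbr'⟩ := SG.exists_corner_leading hb
  have hP : poisson a' b' ∈ HomPsi n oneOne := by simpa using HomPsi.poisson_mem ha' hb'
  have hP' : poisson a'' b'' ∈ HomBi n oneOne := by
    simpa using SGCalc.poisson_mem HomBi.mulMaps HomBi.allDerivMaps ha'' hb''
  have hr := poisson_sub_poisson_mem (SG_le_Symb ha) ha'.2 (SG_le_Symb hb) hb'.2 har hbr
  have hr' := poisson_sub_poisson_mem ha'.2 ha''.2 hb'.2 hb''.2 har' hbr'
  obtain ⟨μ, ⟨hμ, h1⟩, ⟨-, h2⟩, -, h3⟩ :=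
    ((sigmaPsiE_eventuallyEq ha'.1 (Symb.bound har) ha''.1 (Symb.bound har') hp.1 hp.2).and
    ((sigmaPsiE_eventuallyEq hb'.1 (Symb.bound hbr) hb''.1 (Symb.bound hbr') hp.1 hp.2).and
      (sigmaPsiE_eventuallyEq hP.1 (Symb.bound hr) hP'.1 (Symb.bound hr') hp.1 hp.2))).exists
  rw [poisson_congr_dil h1 h2 ha''.2.1 hb''.2.1]
  refine h3.eq_of_nhds.trans ?_
  have h := rpow_neg_one_cancel hμ
  push_cast
  -- Both variables are dilated by `μ`, so the relation needed is `(μ⁻¹ μ)² = 1`; the factor `μ⁻¹ μ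
  -- + 1` comes from `u² - 1 = (u - 1)(u + 1)`.
  linear_combination (-((μ ^ (-1 : ℝ) : ℝ) : ℂ) * ((μ ^ (-1 : ℝ) : ℝ) : ℂ) *
    poisson a'' b'' (dil μ μ p) * (((μ ^ (-1 : ℝ) : ℝ) : ℂ) * (μ : ℂ) + 1)) * h

/-! ### The induced bracket on `SymG` -/

/-- Brackets of symbols of order `0` have order `(-1, -1)`, which is exactly what the quotient
kills. -/
lemma isInducedPoisson_zero :
    IsInducedPoisson (0 : SymG n 0 →ₗ[ℂ] SymG n 0 →ₗ[ℂ] SymG n 0) := by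
  refine ⟨⟨fun v => rfl, fun u v w => by simp⟩, fun a b => ?_⟩
  have h := SG.poisson_mem a.2 b.2
  rw [add_zero] at h
  have h0 : poisson (a : Phase n → ℂ) b ∈ SG n 0 := by
    have := SG.shift (n := n) 0 1 1
    refine this ?_
    convert h using 2
    ext <;> simp
  refine ⟨h0, ?_⟩
  simp only [LinearMap.zero_apply]
  exact ((Submodule.Quotient.mk_eq_zero ((SG n (0 - oneOne)).submoduleOf (SG n 0))).2
    (Submodule.mem_comap.2 h)).symm

lemma SG.poisson_mem_one {a b : Phase n → ℂ} (ha : a ∈ SG n oneOne) (hb : b ∈ SG n oneOne) :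
    poisson a b ∈ SG n oneOne := by simpa using SG.poisson_mem ha hb

/-- A bilinear map that preserves a subspace in each argument descends to the quotient. -/
noncomputable def quotBilin {V : Type*} [AddCommGroup V] [Module ℂ V] (W : Submodule ℂ V)
    (B : V →ₗ[ℂ] V →ₗ[ℂ] V) (hl : ∀ v ∈ W, ∀ w, B v w ∈ W) (hr : ∀ v, ∀ w ∈ W, B v w ∈ W) :
    (V ⧸ W) →ₗ[ℂ] (V ⧸ W) →ₗ[ℂ] V ⧸ W :=
  W.liftQ
    { toFun := fun v => W.mapQ W (B v) (hr v)
      map_add' := fun v v' => by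
        refine Submodule.linearMap_qext _ (LinearMap.ext fun w => ?_)
        simp
      map_smul' := fun z v => by
        refine Submodule.linearMap_qext _ (LinearMap.ext fun w => ?_)
        simp } fun v hv => by
    rw [LinearMap.mem_ker]
    refine Submodule.linearMap_qext _ (LinearMap.ext fun w => ?_)
    simpa using hl v hv w

lemma quotBilin_mk {V : Type*} [AddCommGroup V] [Module ℂ V] (W : Submodule ℂ V)
    (B : V →ₗ[ℂ] V →ₗ[ℂ] V) (hl : ∀ v ∈ W, ∀ w, B v w ∈ W) (hr : ∀ v, ∀ w ∈ W, B v w ∈ W)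
    (v w : V) : quotBilin W B hl hr (Submodule.Quotient.mk v) (Submodule.Quotient.mk w)
      = Submodule.Quotient.mk (B v w) := rfl

lemma IsLieBracket.quotBilin {V : Type*} [AddCommGroup V] [Module ℂ V] {W : Submodule ℂ V}
    {B : V →ₗ[ℂ] V →ₗ[ℂ] V} (hB : IsLieBracket B) (hl : ∀ v ∈ W, ∀ w, B v w ∈ W)
    (hr : ∀ v, ∀ w ∈ W, B v w ∈ W) : IsLieBracket (quotBilin W B hl hr) := by
  refine ⟨fun v => ?_, fun u v w => ?_⟩
  · induction v using Submodule.Quotient.induction_on with | _ v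
    rw [quotBilin_mk, hB.1, Submodule.Quotient.mk_zero]
  · induction u using Submodule.Quotient.induction_on with | _ u
    induction v using Submodule.Quotient.induction_on with | _ v
    induction w using Submodule.Quotient.induction_on with | _ w
    simp only [quotBilin_mk, ← Submodule.Quotient.mk_add, hB.2, Submodule.Quotient.mk_zero]

lemma exists_isInducedPoisson :
    ∃ B : SymG n oneOne →ₗ[ℂ] SymG n oneOne →ₗ[ℂ] SymG n oneOne, IsInducedPoisson B := by
  have hs : ∀ a ∈ SG n oneOne, ContDiff ℝ ∞ a := fun a ha => SG.smooth ha
  have hp : ∀ a ∈ SG n oneOne, ∀ b ∈ SG n oneOne, poisson a b ∈ SG n oneOne :=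
    fun a ha b hb => SG.poisson_mem_one ha hb
  have hB : IsLieBracket (poissonBilin (SG n oneOne) (SG n oneOne) hs hp) :=
    ⟨fun _ => Subtype.ext (poisson_self _),
      fun a b c => Subtype.ext (poisson_jacobi (hs a a.2) (hs b b.2) (hs c c.2))⟩
  refine ⟨quotBilin _ (poissonBilin (SG n oneOne) (SG n oneOne) hs hp) (fun a ha b => ?_)
    (fun a b hb => ?_), hB.quotBilin _ _, fun a b => ⟨hp a a.2 b b.2, rfl⟩⟩
  · have := SG.poisson_mem (Submodule.mem_comap.1 ha) b.2
    rw [add_sub_cancel_right] at this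
    exact Submodule.mem_comap.2 this
  · have := SG.poisson_mem a.2 (Submodule.mem_comap.1 hb)
    rw [add_sub_cancel_left] at this
    exact Submodule.mem_comap.2 this

end SGCalc

/-! ### Uniform Fourier decay and integration by parts -/

namespace SGCalc

open scoped FourierTransform

variable {n : ℕ}

/-! ### Families of functions on `ℝⁿ` with uniform weighted estimates -/

/-- The partial derivative of a function on `ℝⁿ`. -/
noncomputable def pd (j : Fin n) (f : Pos n → ℂ) : Pos n → ℂ :=
  fun y => fderiv ℝ f y (EuclideanSpace.single j 1)

/-- A weighted estimate that is uniform in the parameter. -/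
def FamBound {Θ : Type*} (w : Θ → ℝ) (r : ℝ) (Q : Θ → Pos n → ℂ) : Prop :=
  ∃ C : ℝ, ∀ θ y, ‖Q θ y‖ ≤ C * w θ * jap y ^ r

/-- Weighted estimates for up to `N` derivatives. -/
def FamBounds {Θ : Type*} : ℕ → (Θ → ℝ) → ℝ → (Θ → Pos n → ℂ) → Prop
  | 0, w, r, Q => FamBound w r Q
  | N + 1, w, r, Q => FamBound w r Q ∧ ∀ j, FamBounds N w r fun θ => pd j (Q θ)

/-- A family of smooth functions all of whose derivatives are `O(w(θ) ⟨y⟩^r)`. -/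
structure Fam {Θ : Type*} (w : Θ → ℝ) (r : ℝ) (Q : Θ → Pos n → ℂ) : Prop where
  smooth : ∀ θ, ContDiff ℝ ∞ (Q θ)
  bounds : ∀ N, FamBounds N w r Q

/-- A smooth function all of whose derivatives are `O(⟨y⟩^r)`. -/
abbrev Tame (r : ℝ) (f : Pos n → ℂ) : Prop := Fam (fun _ : Unit => 1) r fun _ => f

lemma pd_contDiff (j : Fin n) {f : Pos n → ℂ} (hf : ContDiff ℝ ∞ f) : ContDiff ℝ ∞ (pd j f) :=
  (hf.fderiv_right (m := ∞) (by simp)).clm_apply contDiff_const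

lemma pos_diffAt {f : Pos n → ℂ} (hf : ContDiff ℝ ∞ f) (p : Pos n) : DifferentiableAt ℝ f p :=
  (hf.differentiable (by simp)) p

lemma pd_add (j : Fin n) {f g : Pos n → ℂ} (hf : ContDiff ℝ ∞ f) (hg : ContDiff ℝ ∞ g) :
    pd j (f + g) = pd j f + pd j g := by
  ext p
  simp [pd, fderiv_add (pos_diffAt hf p) (pos_diffAt hg p)]

lemma pd_mul (j : Fin n) {f g : Pos n → ℂ} (hf : ContDiff ℝ ∞ f) (hg : ContDiff ℝ ∞ g) :
    pd j (f * g) = pd j f * g + f * pd j g := by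
  ext p
  simp [pd, fderiv_mul (pos_diffAt hf p) (pos_diffAt hg p)]
  ring

lemma pd_smul (j : Fin n) (z : ℂ) {f : Pos n → ℂ} (hf : ContDiff ℝ ∞ f) :
    pd j (z • f) = z • pd j f := by
  ext p
  simp [pd, fderiv_const_smul (pos_diffAt hf p) z]

section Families

variable {Θ : Type*} {w v : Θ → ℝ} {r s : ℝ} {Q P : Θ → Pos n → ℂ}

lemma FamBound.exists_nonneg (hw : ∀ θ, 0 ≤ w θ) (h : FamBound w r Q) :
    ∃ C : ℝ, 0 ≤ C ∧ ∀ θ y, ‖Q θ y‖ ≤ C * w θ * jap y ^ r := by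
  obtain ⟨C, hC⟩ := h
  refine ⟨|C|, abs_nonneg C, fun θ y => (hC θ y).trans ?_⟩
  have := (jap_rpow_pos y r).le
  have := hw θ
  gcongr
  exact le_abs_self C

lemma Fam.bound (h : Fam w r Q) : FamBound w r Q := h.bounds 0

lemma Fam.pd (h : Fam w r Q) (j : Fin n) : Fam w r fun θ => pd j (Q θ) :=
  ⟨fun θ => pd_contDiff j (h.smooth θ), fun N => (h.bounds (N + 1)).2 j⟩

lemma FamBound.add (h : FamBound w r Q) (h' : FamBound w r P) :
    FamBound w r fun θ => Q θ + P θ := by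
  obtain ⟨C, hC⟩ := h
  obtain ⟨D, hD⟩ := h'
  refine ⟨C + D, fun θ y => ?_⟩
  rw [add_mul, add_mul]
  exact (norm_add_le _ _).trans (add_le_add (hC θ y) (hD θ y))

lemma FamBound.mul (hw : ∀ θ, 0 ≤ w θ) (hv : ∀ θ, 0 ≤ v θ) (h : FamBound w r Q)
    (h' : FamBound v s P) : FamBound (fun θ => w θ * v θ) (r + s) fun θ => Q θ * P θ := by
  obtain ⟨C, hC0, hC⟩ := h.exists_nonneg hw
  obtain ⟨D, hD0, hD⟩ := h'.exists_nonneg hv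
  refine ⟨C * D, fun θ y => ?_⟩
  change ‖Q θ y * P θ y‖ ≤ C * D * (w θ * v θ) * jap y ^ (r + s)
  rw [norm_mul, Real.rpow_add (jap_pos y)]
  have := (jap_rpow_pos y r).le
  have := hw θ
  calc ‖Q θ y‖ * ‖P θ y‖ ≤ (C * w θ * jap y ^ r) * (D * v θ * jap y ^ s) := by
        gcongr
        · exact hC θ y
        · exact hD θ y
    _ = _ := by ring

lemma FamBounds.add {N : ℕ} (hQ : ∀ θ, ContDiff ℝ ∞ (Q θ)) (hP : ∀ θ, ContDiff ℝ ∞ (P θ))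
    (h : FamBounds N w r Q) (h' : FamBounds N w r P) : FamBounds N w r fun θ => Q θ + P θ := by
  induction N generalizing Q P with
  | zero => exact FamBound.add h h'
  | succ N ih =>
    refine ⟨h.1.add h'.1, fun j => ?_⟩
    simp only [pd_add j (hQ _) (hP _)]
    exact ih (fun θ => pd_contDiff j (hQ θ)) (fun θ => pd_contDiff j (hP θ)) (h.2 j) (h'.2 j)

lemma FamBounds.of_succ {N : ℕ} (h : FamBounds (N + 1) w r Q) : FamBounds N w r Q := by
  induction N generalizing Q with
  | zero => exact h.1
  | succ N ih => exact ⟨h.1, fun j => ih (h.2 j)⟩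

lemma FamBounds.mul {N : ℕ} (hw : ∀ θ, 0 ≤ w θ) (hv : ∀ θ, 0 ≤ v θ)
    (hQ : ∀ θ, ContDiff ℝ ∞ (Q θ)) (hP : ∀ θ, ContDiff ℝ ∞ (P θ)) (h : FamBounds N w r Q)
    (h' : FamBounds N v s P) : FamBounds N (fun θ => w θ * v θ) (r + s) fun θ => Q θ * P θ := by
  induction N generalizing Q P with
  | zero => exact FamBound.mul hw hv h h'
  | succ N ih =>
    refine ⟨h.1.mul hw hv h'.1, fun j => ?_⟩
    simp only [pd_mul j (hQ _) (hP _)]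
    have hQ' := fun θ => pd_contDiff j (hQ θ)
    have hP' := fun θ => pd_contDiff j (hP θ)
    exact FamBounds.add (fun θ => (hQ' θ).mul (hP θ)) (fun θ => (hQ θ).mul (hP' θ))
      (ih hQ' hP (h.2 j) h'.of_succ) (ih hQ hP' h.of_succ (h'.2 j))

lemma Fam.mul (hw : ∀ θ, 0 ≤ w θ) (hv : ∀ θ, 0 ≤ v θ) (h : Fam w r Q) (h' : Fam v s P) :
    Fam (fun θ => w θ * v θ) (r + s) fun θ => Q θ * P θ :=
  ⟨fun θ => (h.smooth θ).mul (h'.smooth θ), fun N =>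
    FamBounds.mul hw hv h.smooth h'.smooth (h.bounds N) (h'.bounds N)⟩

lemma FamBound.scale (h : FamBound w r Q) {σ : Θ → ℂ} {C : ℝ} (hw : ∀ θ, 0 ≤ w θ)
    (hσ : ∀ θ, ‖σ θ‖ ≤ C) : FamBound w r fun θ => σ θ • Q θ := by
  obtain ⟨D, hD0, hD⟩ := h.exists_nonneg hw
  refine ⟨C * D, fun θ y => ?_⟩
  change ‖σ θ • Q θ y‖ ≤ _
  rw [norm_smul]
  have := hw θ
  have := (jap_rpow_pos y r).le
  calc ‖σ θ‖ * ‖Q θ y‖ ≤ C * (D * w θ * jap y ^ r) :=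
        mul_le_mul (hσ θ) (hD θ y) (norm_nonneg _) ((norm_nonneg _).trans (hσ θ))
    _ = _ := by ring

lemma FamBounds.scale {N : ℕ} (hQ : ∀ θ, ContDiff ℝ ∞ (Q θ)) (h : FamBounds N w r Q) {σ : Θ → ℂ}
    {C : ℝ} (hw : ∀ θ, 0 ≤ w θ) (hσ : ∀ θ, ‖σ θ‖ ≤ C) :
    FamBounds N w r fun θ => σ θ • Q θ := by
  induction N generalizing Q with
  | zero => exact FamBound.scale h hw hσ
  | succ N ih =>
    refine ⟨h.1.scale hw hσ, fun j => ?_⟩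
    simp only [pd_smul j _ (hQ _)]
    exact ih (fun θ => pd_contDiff j (hQ θ)) (h.2 j)

lemma FamBound.mono (hw : ∀ θ, 0 ≤ w θ) (hrs : r ≤ s) (h : FamBound w r Q) : FamBound w s Q := by
  obtain ⟨C, hC0, hC⟩ := h.exists_nonneg hw
  exact ⟨C, fun θ y => (hC θ y).trans
    (mul_le_mul_of_nonneg_left (jap_rpow_mono y hrs) (mul_nonneg hC0 (hw θ)))⟩

lemma FamBounds.mono {N : ℕ} (hw : ∀ θ, 0 ≤ w θ) (hrs : r ≤ s) (h : FamBounds N w r Q) :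
    FamBounds N w s Q := by
  induction N generalizing Q with
  | zero => exact FamBound.mono hw hrs h
  | succ N ih => exact ⟨h.1.mono hw hrs, fun j => ih (h.2 j)⟩

lemma Fam.mono (hw : ∀ θ, 0 ≤ w θ) (hrs : r ≤ s) (h : Fam w r Q) : Fam w s Q :=
  ⟨h.smooth, fun N => (h.bounds N).mono hw hrs⟩

lemma Fam.comp_param {Θ' : Type*} (h : Fam w r Q) (φ : Θ' → Θ) :
    Fam (fun θ => w (φ θ)) r fun θ => Q (φ θ) := by
  have hb : ∀ {Q : Θ → Pos n → ℂ}, FamBound w r Q → FamBound (fun θ => w (φ θ)) r fun θ => Q (φ θ) :=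
    fun ⟨C, hC⟩ => ⟨C, fun θ y => hC (φ θ) y⟩
  refine ⟨fun θ => h.smooth _, fun N => ?_⟩
  induction N generalizing Q with
  | zero => exact hb h.bound
  | succ N ih => exact ⟨hb h.bound, fun j => ih (h.pd j)⟩

lemma Fam.const {f : Pos n → ℂ} (h : Tame r f) : Fam (fun _ : Θ => 1) r fun _ => f :=
  h.comp_param fun _ => ()

/-- At a frozen parameter the weight is a constant and is absorbed in the bounds. -/
lemma Fam.tame (h : Fam w r Q) (θ : Θ) : Tame r (Q θ) := by
  have h' := h.comp_param (Θ' := Unit) fun _ => θ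
  have hb : ∀ {f : Pos n → ℂ}, FamBound (fun _ : Unit => w θ) r (fun _ => f) →
      FamBound (fun _ : Unit => 1) r fun _ => f := fun ⟨C, hC⟩ =>
    ⟨C * w θ, fun t y => by simpa using hC t y⟩
  refine ⟨fun _ => h.smooth θ, fun N => ?_⟩
  have := h'.bounds N
  generalize Q θ = f at this
  induction N generalizing f with
  | zero => exact hb this
  | succ N ih => exact ⟨hb this.1, fun j => ih (SGCalc.pd j f) (this.2 j)⟩

/-! ### Integrability -/

lemma integrable_jap_rpow {r : ℝ} (hr : r < -n) : Integrable fun y : Pos n => jap y ^ r := by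
  have h := integrable_rpow_neg_one_add_norm_sq (E := Pos n) (μ := volume) (r := -r)
    (by rw [finrank_euclideanSpace_fin]; linarith)
  refine h.congr (Eventually.of_forall fun y => ?_)
  simp only [jap, Real.sqrt_eq_rpow]
  rw [← Real.rpow_mul (by positivity)]
  congr 1
  ring

lemma Fam.continuous (h : Fam w r Q) (θ : Θ) : Continuous (Q θ) := (h.smooth θ).continuous

lemma Fam.integrable (h : Fam w r Q) (hr : r < -n) (θ : Θ) : Integrable (Q θ) := by
  obtain ⟨C, hC⟩ := h.bound
  exact ((integrable_jap_rpow hr).const_mul (C * w θ)).mono' (h.continuous θ).aestronglyMeasurable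
    (Eventually.of_forall fun y => hC θ y)

lemma norm_fderiv_le_sum_pd (f : Pos n → ℂ) (y : Pos n) :
    ‖fderiv ℝ f y‖ ≤ ∑ j, ‖pd j f y‖ := by
  refine ContinuousLinearMap.opNorm_le_bound _ (by positivity) fun z => ?_
  have hz : z = ∑ j, z j • EuclideanSpace.single j (1 : ℝ) := by
    ext i
    simp [Finset.sum_apply, Pi.single_apply]
  conv_lhs => rw [hz]
  rw [map_sum, Finset.sum_mul]
  refine (norm_sum_le _ _).trans (Finset.sum_le_sum fun j _ => ?_)
  rw [map_smul, norm_smul, mul_comm]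
  exact mul_le_mul_of_nonneg_left (PiLp.norm_apply_le z j) (norm_nonneg _)

/-- The coordinate function `y ↦ y_j`. -/
noncomputable def coord (j : Fin n) : Pos n → ℂ := fun y => ((y j : ℝ) : ℂ)

lemma innerSL_single (y : Pos n) (j : Fin n) :
    innerSL ℝ y (EuclideanSpace.single j (1 : ℝ)) = y j := by
  rw [innerSL_apply_apply, EuclideanSpace.inner_single_right]
  simp

lemma fourier_pd (h : Fam w r Q) (hr : r < -n) (θ : Θ) (j : Fin n) (η : Pos n) :
    𝓕 (SGCalc.pd j (Q θ)) η = 2 * Real.pi * I * coord j η * 𝓕 (Q θ) η := by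
  have hd : Integrable (fderiv ℝ (Q θ)) := by
    refine (integrable_finsetSum Finset.univ fun j _ => ((h.pd j).integrable hr θ).norm).mono'
      ((h.smooth θ).continuous_fderiv (by simp)).aestronglyMeasurable
      (Eventually.of_forall fun y => norm_fderiv_le_sum_pd _ _)
  have h1 := Real.fourier_fderiv (h.integrable hr θ) ((h.smooth θ).differentiable (by simp)) hd
  have h2 : 𝓕 (SGCalc.pd j (Q θ)) η = 𝓕 (fderiv ℝ (Q θ)) η (EuclideanSpace.single j 1) :=
    (Real.fourier_continuousLinearMap_apply hd).symm
  rw [h2, h1]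
  have key : ∀ z : ℝ, z = η j → (-(2 * (Real.pi : ℂ) * I)) • (-z • 𝓕 (Q θ) η)
      = 2 * Real.pi * I * coord j η * 𝓕 (Q θ) η := by
    rintro z rfl
    simp [coord]
    ring
  exact key _ (innerSL_single η j)

lemma norm_le_sum_coord (y : Pos n) : ‖y‖ ≤ ∑ j, ‖coord j y‖ := by
  have hz : y = ∑ j, y j • EuclideanSpace.single j (1 : ℝ) := by
    ext i
    simp [Finset.sum_apply, Pi.single_apply]
  conv_lhs => rw [hz]
  refine (norm_sum_le _ _).trans (Finset.sum_le_sum fun j _ => ?_)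
  simp [norm_smul, coord]

/-- Each factor `|η|` is bounded by the sum of `|ηⱼ|` and exchanged for a derivative of `Q`.
Derivatives satisfy the same integrable bound, so decay to any power is uniform in the parameter up
to `w`. -/
lemma Fam.fourier_decay_nat (hw : ∀ θ, 0 ≤ w θ) (h : Fam w r Q) (hr : r < -n) (K : ℕ) :
    ∃ C : ℝ, 0 ≤ C ∧ ∀ θ η, ‖η‖ ^ K * ‖𝓕 (Q θ) η‖ ≤ C * w θ := by
  induction K generalizing Q with
  | zero =>
    obtain ⟨C, hC0, hC⟩ := h.bound.exists_nonneg hw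
    refine ⟨C * ∫ y : Pos n, jap y ^ r, mul_nonneg hC0
      (integral_nonneg fun y => (jap_rpow_pos y r).le), fun θ η => ?_⟩
    rw [pow_zero, one_mul]
    refine (VectorFourier.norm_fourierIntegral_le_integral_norm _ _ _ _ _).trans ?_
    calc ∫ y, ‖Q θ y‖ ≤ ∫ y : Pos n, C * w θ * jap y ^ r :=
          integral_mono (h.integrable hr θ).norm ((integrable_jap_rpow hr).const_mul _) (hC θ)
      _ = _ := by rw [integral_const_mul]; ring
  | succ K ih =>
    choose C hC0 hC using fun j => ih (h.pd j)
    refine ⟨∑ j, C j, Finset.sum_nonneg fun j _ => hC0 j, fun θ η => ?_⟩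
    calc ‖η‖ ^ (K + 1) * ‖𝓕 (Q θ) η‖
        ≤ ‖η‖ ^ K * (∑ j, ‖coord j η‖) * ‖𝓕 (Q θ) η‖ := by
          rw [pow_succ]
          gcongr
          exact norm_le_sum_coord η
      _ = ∑ j, ‖η‖ ^ K * (‖coord j η‖ * ‖𝓕 (Q θ) η‖) := by
          rw [Finset.mul_sum, Finset.sum_mul]
          exact Finset.sum_congr rfl fun j _ => by ring
      _ ≤ ∑ j, C j * w θ := by
          refine Finset.sum_le_sum fun j _ => le_trans ?_ (hC j θ η)
          rw [fourier_pd h hr]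
          gcongr
          rw [norm_mul, norm_mul]
          gcongr
          -- The factor `2π` of `fourier_pd` is at least `1` and may be dropped.
          refine le_mul_of_one_le_left (norm_nonneg _) ?_
          simp only [norm_mul, Complex.norm_ofNat, Complex.norm_real, Complex.norm_I, mul_one,
            Real.norm_of_nonneg Real.pi_pos.le]
          linarith [Real.pi_gt_three]
      _ = _ := by rw [Finset.sum_mul]

lemma Fam.fourier_decay (hw : ∀ θ, 0 ≤ w θ) (h : Fam w r Q) (hr : r < -n) (s : ℝ) :
    ∃ C : ℝ, 0 ≤ C ∧ ∀ θ η, ‖𝓕 (Q θ) η‖ ≤ C * w θ * jap η ^ s := by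
  obtain ⟨k, hk⟩ := jap_rpow_le (n := n) (-s)
  obtain ⟨C, hC0, hC⟩ := h.fourier_decay_nat hw hr 0
  obtain ⟨D, hD0, hD⟩ := h.fourier_decay_nat hw hr k
  refine ⟨2 ^ k * (C + D), by positivity, fun θ η => ?_⟩
  have hp := jap_rpow_pos η s
  have hp' := jap_rpow_pos η (-s)
  have e : jap η ^ (-s) * jap η ^ s = 1 := by rw [← Real.rpow_add (jap_pos η)]; simp
  calc ‖𝓕 (Q θ) η‖ = jap η ^ (-s) * ‖𝓕 (Q θ) η‖ * jap η ^ s := by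
        linear_combination (-‖𝓕 (Q θ) η‖) * e
    _ ≤ (2 ^ k * (1 + ‖η‖ ^ k)) * ‖𝓕 (Q θ) η‖ * jap η ^ s := by gcongr; exact hk η
    _ = 2 ^ k * (‖η‖ ^ 0 * ‖𝓕 (Q θ) η‖ + ‖η‖ ^ k * ‖𝓕 (Q θ) η‖) * jap η ^ s := by ring
    _ ≤ 2 ^ k * (C * w θ + D * w θ) * jap η ^ s := by
        refine mul_le_mul_of_nonneg_right (mul_le_mul_of_nonneg_left ?_ (by positivity)) hp.le
        exact add_le_add (hC θ η) (hD θ η)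
    _ = _ := by ring

lemma Fam.continuous_fourier (h : Fam w r Q) (hr : r < -n) (θ : Θ) : Continuous (𝓕 (Q θ)) :=
  VectorFourier.fourierIntegral_continuous Real.continuous_fourierChar continuous_inner
    (h.integrable hr θ)

lemma fourier_add {f g : Pos n → ℂ} (hf : Integrable f) (hg : Integrable g) :
    𝓕 (f + g) = 𝓕 f + 𝓕 g :=
  VectorFourier.fourierIntegral_add Real.continuous_fourierChar continuous_inner hf hg

lemma fourier_const_smul (f : Pos n → ℂ) (z : ℂ) : 𝓕 (z • f) = z • 𝓕 f :=
  VectorFourier.fourierIntegral_const_smul _ _ _ _ _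

/-! ### The pairing `∫ P 𝓕 Q` -/

/-- The Fourier transform decays faster than any power, so it absorbs the growth `s` of the other
factor and leaves any prescribed power `l`. -/
lemma exists_pairing_bound (hw : ∀ θ, 0 ≤ w θ) (hv : ∀ θ, 0 ≤ v θ) (hP : FamBound w s P)
    (hQ : Fam v r Q) (hr : r < -n) (l : ℝ) :
    ∃ C : ℝ, 0 ≤ C ∧ ∀ θ η, ‖P θ η * 𝓕 (Q θ) η‖ ≤ C * (w θ * v θ) * jap η ^ l := by
  obtain ⟨C, hC0, hC⟩ := hP.exists_nonneg hw
  obtain ⟨D, hD0, hD⟩ := hQ.fourier_decay hv hr (l - s)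
  refine ⟨C * D, by positivity, fun θ η => ?_⟩
  have := (jap_rpow_pos η s).le
  have := hw θ
  rw [norm_mul]
  calc ‖P θ η‖ * ‖𝓕 (Q θ) η‖ ≤ (C * w θ * jap η ^ s) * (D * v θ * jap η ^ (l - s)) := by
        gcongr
        · exact hC θ η
        · exact hD θ η
    _ = C * D * (w θ * v θ) * (jap η ^ s * jap η ^ (l - s)) := by ring
    _ = _ := by rw [← Real.rpow_add (jap_pos η)]; congr 2; ring

lemma integrable_pairing {p q : Pos n → ℂ} (hp : Continuous p)
    (hb : FamBound (fun _ : Unit => 1) s fun _ => p) (hq : Tame r q) (hr : r < -n) :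
    Integrable fun η => p η * 𝓕 q η := by
  obtain ⟨C, -, hC⟩ := exists_pairing_bound (fun _ => zero_le_one) (fun _ => zero_le_one) hb hq hr
    (-n - 1)
  refine ((integrable_jap_rpow (n := n) (r := -n - 1) (by linarith)).const_mul (C * (1 * 1))).mono'
    (hp.mul (hq.continuous_fourier hr ())).aestronglyMeasurable
    (Eventually.of_forall fun η => hC () η)

lemma pd_coord (i j : Fin n) : pd i (coord j) = fun _ => if i = j then 1 else 0 := by
  ext y
  have : (coord j : Pos n → ℂ) = Complex.ofRealCLM ∘L (EuclideanSpace.proj j : Pos n →L[ℝ] ℝ) := by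
    ext y; simp [coord]
  rw [pd, this, ContinuousLinearMap.fderiv]
  simp [eq_comm]
  split_ifs <;> simp

lemma coord_contDiff (j : Fin n) : ContDiff ℝ ∞ (coord j : Pos n → ℂ) := by
  have : (coord j : Pos n → ℂ) = Complex.ofRealCLM ∘L (EuclideanSpace.proj j : Pos n →L[ℝ] ℝ) := by
    ext y; simp [coord]
  rw [this]
  exact ContinuousLinearMap.contDiff _

lemma pd_const (j : Fin n) (z : ℂ) : pd j (fun _ => z) = fun _ => 0 := by
  ext y; simp [pd]

lemma tame_const (z : ℂ) : Tame 0 (fun _ : Pos n => z) := by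
  refine ⟨fun _ => contDiff_const, fun N => ?_⟩
  induction N generalizing z with
  | zero => exact ⟨‖z‖, fun _ y => by simp⟩
  | succ N ih => exact ⟨⟨‖z‖, fun _ y => by simp⟩, fun j => by simp only [pd_const]; exact ih 0⟩

lemma norm_coord_le (j : Fin n) (y : Pos n) : ‖coord j y‖ ≤ jap y := by
  rw [coord, Complex.norm_real]
  exact (PiLp.norm_apply_le y j).trans (norm_le_jap y)

lemma tame_coord (j : Fin n) : Tame 1 (coord j : Pos n → ℂ) := by
  have hb : FamBound (fun _ : Unit => 1) 1 fun _ => (coord j : Pos n → ℂ) :=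
    ⟨1, fun _ y => by simpa using norm_coord_le j y⟩
  refine ⟨fun _ => coord_contDiff j, fun N => ?_⟩
  cases N with
  | zero => exact hb
  | succ N =>
    refine ⟨hb, fun i => ?_⟩
    simp only [pd_coord]
    exact ((tame_const _).mono (fun _ => zero_le_one) zero_le_one).bounds N

/-- The function `⟨y⟩^s`. -/
noncomputable def japC (s : ℝ) : Pos n → ℂ := fun y => ((jap y ^ s : ℝ) : ℂ)

lemma jap_rpow_eq (s : ℝ) (y : Pos n) : jap y ^ s = (1 + ‖y‖ ^ 2) ^ (s / 2) := by
  rw [jap, Real.sqrt_eq_rpow, ← Real.rpow_mul (by positivity)]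
  congr 1
  ring

lemma japC_contDiff (s : ℝ) : ContDiff ℝ ∞ (japC s : Pos n → ℂ) := by
  have : ContDiff ℝ ∞ fun y : Pos n => jap y ^ s := by
    simp only [jap_rpow_eq]
    exact (contDiff_const.add (contDiff_norm_sq ℝ)).rpow_const_of_ne fun y => by positivity
  exact Complex.ofRealCLM.contDiff.comp this

lemma pd_japC (j : Fin n) (s : ℝ) :
    pd j (japC s : Pos n → ℂ) = (s : ℂ) • (coord j * japC (s - 2)) := by
  ext y
  have h1 : HasFDerivAt (fun y : Pos n => 1 + ‖y‖ ^ 2) (2 • innerSL ℝ y) y :=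
    (hasStrictFDerivAt_norm_sq y).hasFDerivAt.const_add 1
  have h2 := h1.rpow_const (p := s / 2) (Or.inl (by positivity))
  have h3 : HasFDerivAt (japC s : Pos n → ℂ) (Complex.ofRealCLM.comp
      ((s / 2 * (1 + ‖y‖ ^ 2) ^ (s / 2 - 1)) • (2 • innerSL ℝ y))) y := by
    refine (Complex.ofRealCLM.hasFDerivAt.comp y h2).congr_of_eventuallyEq
      (Eventually.of_forall fun y => ?_)
    simp [japC, jap_rpow_eq]
  rw [pd, h3.fderiv]
  simp only [Pi.smul_apply, Pi.mul_apply, japC, jap_rpow_eq, coord]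
  rw [show (s - 2) / 2 = s / 2 - 1 by ring]
  simp [innerSL_single]
  ring

lemma tame_japC (s : ℝ) : Tame s (japC s : Pos n → ℂ) := by
  have hb : ∀ s : ℝ, FamBound (fun _ : Unit => 1) s fun _ => (japC s : Pos n → ℂ) := fun s =>
    ⟨1, fun _ y => by
      simp only [japC, Complex.norm_real, Real.norm_of_nonneg (jap_rpow_pos y s).le]; simp⟩
  refine ⟨fun _ => japC_contDiff s, fun N => ?_⟩
  induction N generalizing s with
  | zero => exact hb s
  | succ N ih =>
    refine ⟨hb s, fun j => ?_⟩
    simp only [pd_japC]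
    have h := FamBounds.mul (fun _ => zero_le_one) (fun _ => zero_le_one)
      (fun _ => coord_contDiff j) (fun _ => japC_contDiff (s - 2))
      (((tame_coord j).bounds N)) (ih (s - 2))
    simp only [mul_one] at h
    have h' := h.scale (fun _ => (coord_contDiff j).mul (japC_contDiff (s - 2)))
      (σ := fun _ => (s : ℂ)) (C := ‖(s : ℂ)‖) (fun _ => zero_le_one) fun _ => le_rfl
    exact h'.mono (fun _ => zero_le_one) (by linarith)

lemma Tame.mul {f g : Pos n → ℂ} (hf : Tame r f) (hg : Tame s g) : Tame (r + s) (f * g) := by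
  simpa using Fam.mul (fun _ => zero_le_one) (fun _ => zero_le_one) hf hg

lemma Tame.integrable_norm_mul {q : Pos n → ℂ} (hq : Tame r q) (hr : r + 1 < -n) :
    Integrable fun y => ‖y‖ * ‖q y‖ := by
  obtain ⟨C, hC0, hC⟩ := hq.bound.exists_nonneg fun _ => zero_le_one
  refine ((integrable_jap_rpow hr).const_mul C).mono'
    (continuous_norm.mul (hq.continuous ()).norm).aestronglyMeasurable
    (Eventually.of_forall fun y => ?_)
  rw [Real.norm_of_nonneg (by positivity), Real.rpow_add (jap_pos y), Real.rpow_one]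
  calc ‖y‖ * ‖q y‖ ≤ jap y * (C * 1 * jap y ^ r) := by
        have := jap_nonneg y
        gcongr
        · exact norm_le_jap y
        · exact hC () y
    _ = _ := by ring

/-- One extra power of decay makes `|y| q` integrable, which is what differentiating a Fourier
transform costs. -/
lemma pd_fourier {q : Pos n → ℂ} (hq : Tame r q) (hr : r + 1 < -n) (j : Fin n)
    (η : Pos n) : fderiv ℝ (𝓕 q) η (EuclideanSpace.single j 1)
      = -(2 * Real.pi * I) * 𝓕 (coord j * q) η := by
  have hi := hq.integrable (by linarith) ()
  have hvi := hq.integrable_norm_mul hr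
  rw [(Real.hasFDerivAt_fourier hi hvi η).fderiv]
  have hi' : Integrable (VectorFourier.fourierSMulRight (innerSL ℝ) q) := by
    refine (hvi.const_mul (2 * Real.pi * ‖(innerSL ℝ : Pos n →L[ℝ] Pos n →L[ℝ] ℝ)‖)).mono'
      hi.aestronglyMeasurable.fourierSMulRight (Eventually.of_forall fun y => ?_)
    refine (VectorFourier.norm_fourierSMulRight_le _ _ _).trans_eq ?_
    ring
  rw [Real.fourier_continuousLinearMap_apply hi']
  have : (fun y => VectorFourier.fourierSMulRight (innerSL ℝ) q y (EuclideanSpace.single j 1))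
      = (-(2 * Real.pi * I)) • (coord j * q) := by
    ext y
    have key : ∀ z : ℝ, z = y j → (-(2 * (Real.pi : ℂ) * I)) • (z • q y)
        = -(2 * Real.pi * I) * (coord j y * q y) := by
      rintro z rfl
      simp [coord]
    exact key _ (innerSL_single y j)
  rw [this, fourier_const_smul]
  simp

/-- Integration by parts in the pairing. -/
lemma pairing_pd {p q : Pos n → ℂ} (hp : Tame s p) (hq : Tame r q) (hr : r + 1 < -n) (j : Fin n) :
    ∫ η, pd j p η * 𝓕 q η = 2 * Real.pi * I * ∫ η, p η * 𝓕 (coord j * q) η := by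
  have hq' : Tame (r + 1) (coord j * q) := by rw [add_comm]; exact (tame_coord j).mul hq
  have h1 := integrable_pairing (hp.continuous ()) hp.bound hq' hr
  have h2 := integrable_pairing (hp.continuous ()) hp.bound hq (by linarith)
  have h3 := integrable_pairing ((hp.pd j).continuous ()) (hp.pd j).bound hq (by linarith)
  have hd : Differentiable ℝ (𝓕 q) :=
    Real.differentiable_fourier (hq.integrable (by linarith) ()) (hq.integrable_norm_mul hr)
  have h4 := integral_mul_fderiv_eq_neg_fderiv_mul_of_integrable (μ := volume) (f := p)
    (g := 𝓕 q) (v := EuclideanSpace.single j 1) h3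
    (by
      simp only [pd_fourier hq hr]
      refine (h1.const_mul (-(2 * Real.pi * I))).congr (Eventually.of_forall fun η => ?_)
      ring) h2 (fun η _ => pos_diffAt (hp.smooth ()) η) (fun η _ => hd η)
  simp only [pd_fourier hq hr, mul_left_comm (p _)] at h4
  rw [integral_const_mul] at h4
  change ∫ η, fderiv ℝ p η (EuclideanSpace.single j 1) * 𝓕 q η = _
  linear_combination h4

end Families

end SGCalc

/-! ### Parameter-dependent integrals and uniform symbol bounds -/

namespace SGCalc

open scoped FourierTransform

variable {n : ℕ}

/-! ### Differentiation under the integral sign -/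

/-- The parameter space, with points `(t, (x, ξ))`. -/
abbrev Par (n : ℕ) : Type := ℝ × Phase n

/-- The coordinate directions of the parameter space. -/
noncomputable def dir : Option (Fin n ⊕ Fin n) → Par n
  | none => (1, 0)
  | some (Sum.inl j) => (0, (EuclideanSpace.single j 1, 0))
  | some (Sum.inr j) => (0, (0, EuclideanSpace.single j 1))

/-- The coordinates on the parameter space. -/
noncomputable def dirCoord : Option (Fin n ⊕ Fin n) → Par n → ℝ
  | none, θ => θ.1
  | some (Sum.inl j), θ => θ.2.1 j
  | some (Sum.inr j), θ => θ.2.2 j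

lemma par_eq (θ : Par n) : θ = ∑ d, dirCoord d θ • dir d := by
  rw [Fintype.sum_option, Fintype.sum_sum_type]
  ext i
  · simp [dirCoord, dir, Prod.fst_sum]
  · simp [dirCoord, dir, Prod.fst_sum, Prod.snd_sum, Pi.single_apply]
  · simp [dirCoord, dir, Prod.snd_sum, Pi.single_apply]

lemma abs_dirCoord_le (d : Option (Fin n ⊕ Fin n)) (θ : Par n) : |dirCoord d θ| ≤ ‖θ‖ := by
  rcases d with _ | j | j
  · exact norm_fst_le θ
  · exact (PiLp.norm_apply_le θ.2.1 j).trans ((norm_fst_le _).trans (norm_snd_le θ))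
  · exact (PiLp.norm_apply_le θ.2.2 j).trans ((norm_snd_le _).trans (norm_snd_le θ))

lemma clm_apply_eq_sum (ℓ : Par n →L[ℝ] ℂ) (θ : Par n) :
    ℓ θ = ∑ d, dirCoord d θ • ℓ (dir d) := by
  conv_lhs => rw [par_eq θ]
  simp only [map_sum, map_smul]

lemma norm_clm_le_sum_dir (ℓ : Par n →L[ℝ] ℂ) : ‖ℓ‖ ≤ ∑ d, ‖ℓ (dir d)‖ := by
  refine ContinuousLinearMap.opNorm_le_bound _ (by positivity) fun θ => ?_
  rw [clm_apply_eq_sum, Finset.sum_mul]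
  refine (norm_sum_le _ _).trans (Finset.sum_le_sum fun d _ => ?_)
  rw [norm_smul, mul_comm]
  exact mul_le_mul_of_nonneg_left (abs_dirCoord_le d θ) (norm_nonneg _)

lemma continuous_clm_of_dir {X : Type*} [TopologicalSpace X] {ℓ : X → Par n →L[ℝ] ℂ}
    (h : ∀ d, Continuous fun x => ℓ x (dir d)) : Continuous ℓ := by
  refine continuous_clm_apply.2 fun θ => ?_
  simp only [clm_apply_eq_sum _ θ]
  exact continuous_finsetSum _ fun d _ => (h d).const_smul (dirCoord d θ)

/-- Dominated differentiation. Bounds on the finitely many directional derivatives `D d` suffice,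
because they control the norm and continuity of the full derivative. -/
lemma differentiableAt_integral {F : Par n → Pos n → ℂ}
    {D : Option (Fin n ⊕ Fin n) → Par n → Pos n → ℂ} {W : Par n → ℝ} (hW : Continuous W)
    {s : ℝ} (hs : s < -n)
    (hF : ∀ θ : Par n, |θ.1| < 2 → ∀ y, DifferentiableAt ℝ (fun θ => F θ y) θ)
    (hD : ∀ d (θ : Par n), |θ.1| < 2 → ∀ y, fderiv ℝ (fun θ => F θ y) θ (dir d) = D d θ y)
    (hDc : ∀ d (θ : Par n), |θ.1| < 2 → Continuous (D d θ))
    (hFi : ∀ θ : Par n, |θ.1| < 2 → Integrable (F θ))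
    (hb : ∀ d, ∃ C : ℝ, 0 ≤ C ∧ ∀ θ : Par n, |θ.1| < 2 → ∀ y, ‖D d θ y‖ ≤ C * W θ * jap y ^ s)
    {θ₀ : Par n} (h0 : |θ₀.1| < 2) :
    DifferentiableAt ℝ (fun θ => ∫ y, F θ y) θ₀ ∧
      ∀ d, fderiv ℝ (fun θ => ∫ y, F θ y) θ₀ (dir d) = ∫ y, D d θ₀ y := by
  choose C hC0 hC using hb
  -- The weight is only continuous, not bounded; on this neighbourhood `W θ₀ + 1` replaces it and
  -- gives a dominating function independent of the parameter.
  have hU : {θ : Par n | |θ.1| < 2 ∧ W θ < W θ₀ + 1} ∈ 𝓝 θ₀ := by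
    have o1 : IsOpen {θ : Par n | |θ.1| < 2} := isOpen_lt (by fun_prop) continuous_const
    have o2 : IsOpen {θ : Par n | W θ < W θ₀ + 1} := isOpen_lt hW continuous_const
    exact (o1.inter o2).mem_nhds ⟨h0, show W θ₀ < W θ₀ + 1 from lt_add_one _⟩
  have hbd : ∀ y, ∀ θ ∈ {θ : Par n | |θ.1| < 2 ∧ W θ < W θ₀ + 1},
      ‖fderiv ℝ (fun θ => F θ y) θ‖ ≤ (∑ d, C d) * (W θ₀ + 1) * jap y ^ s := by
    rintro y θ ⟨hθ, hθ'⟩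
    refine (norm_clm_le_sum_dir _).trans ?_
    rw [Finset.sum_mul, Finset.sum_mul]
    refine Finset.sum_le_sum fun d _ => ?_
    rw [hD d θ hθ]
    refine (hC d θ hθ y).trans ?_
    have := (jap_rpow_pos y s).le
    have := hC0 d
    gcongr
  have hc : Continuous fun y => fderiv ℝ (fun θ => F θ y) θ₀ := by
    refine continuous_clm_of_dir fun d => ?_
    simp only [hD d θ₀ h0]
    exact hDc d θ₀ h0
  have hint : Integrable fun y : Pos n => (∑ d, C d) * (W θ₀ + 1) * jap y ^ s :=
    (integrable_jap_rpow hs).const_mul _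
  have key := hasFDerivAt_integral_of_dominated_of_fderiv_le (𝕜 := ℝ) (μ := volume) (F := F)
    (F' := fun θ y => fderiv ℝ (fun θ => F θ y) θ) hU
    (by filter_upwards [hU] with θ hθ using (hFi θ hθ.1).aestronglyMeasurable) (hFi θ₀ h0)
    hc.aestronglyMeasurable (Eventually.of_forall hbd) hint
    (Eventually.of_forall fun y θ hθ => (hF θ hθ.1 y).hasFDerivAt)
  refine ⟨key.differentiableAt, fun d => ?_⟩
  have hi : Integrable fun y => fderiv ℝ (fun θ => F θ y) θ₀ :=
    hint.mono' hc.aestronglyMeasurable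
      (Eventually.of_forall fun y => hbd y θ₀ (mem_of_mem_nhds hU))
  rw [key.fderiv, ContinuousLinearMap.integral_apply hi]
  exact integral_congr_ae (Eventually.of_forall fun y => hD d θ₀ h0 y)

/-! ### Weights and Peetre's inequality -/

lemma jap_add_smul_le {T t : ℝ} (ht : |t| ≤ T) (x y : Pos n) :
    jap (x + t • y) ≤ (2 + T) * (jap x * jap y) := by
  have hx := one_le_jap x
  have hy := one_le_jap y
  have h1 : ‖x + t • y‖ ≤ ‖x‖ + T * ‖y‖ := by
    refine (norm_add_le _ _).trans ?_
    rw [norm_smul, Real.norm_eq_abs]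
    gcongr
  have hT : 0 ≤ T := (abs_nonneg t).trans ht
  have h2 : T * ‖y‖ ≤ T * (jap x * jap y) := by
    have := norm_le_jap y
    gcongr
    nlinarith
  have h3 := norm_le_jap x
  have h4 : jap x ≤ jap x * jap y := le_mul_of_one_le_right (jap_nonneg x) hy
  linarith [jap_le_one_add (x + t • y)]

/-- Peetre's inequality. -/
lemma peetre {T t : ℝ} (ht : |t| ≤ T) (s : ℝ) (x y : Pos n) :
    jap (x + t • y) ^ s ≤ (2 + T) ^ |s| * (jap x ^ s * jap y ^ |s|) := by
  have hT : 0 ≤ T := (abs_nonneg t).trans ht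
  have hx := jap_pos x
  have hy := jap_pos y
  rcases le_total 0 s with hs | hs
  · rw [abs_of_nonneg hs, ← Real.mul_rpow hx.le hy.le, ← Real.mul_rpow (by positivity) (by positivity)]
    exact Real.rpow_le_rpow (jap_nonneg _) (jap_add_smul_le ht x y) hs
  -- For negative exponents, translate back from `x + t y` to `x` and raise that inequality to the
  -- power `-s`.
  · have h := jap_add_smul_le (T := T) (t := -t) (by rwa [abs_neg]) (x + t • y) y
    rw [neg_smul, add_neg_cancel_right] at h
    have hz := jap_pos (x + t • y)
    have h1 := Real.rpow_le_rpow hx.le h (neg_nonneg.2 hs)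
    rw [Real.mul_rpow (by positivity) (by positivity), Real.mul_rpow hz.le hy.le] at h1
    rw [abs_of_nonpos hs]
    have e1 : jap (x + t • y) ^ s * jap (x + t • y) ^ (-s) = 1 := by
      rw [← Real.rpow_add hz]; simp
    have e2 : jap x ^ s * jap x ^ (-s) = 1 := by
      rw [← Real.rpow_add hx]; simp
    have p1 := jap_rpow_pos (x + t • y) s
    have p2 := jap_rpow_pos x s
    calc jap (x + t • y) ^ s
        = jap (x + t • y) ^ s * jap x ^ s * jap x ^ (-s) := by rw [mul_assoc, e2, mul_one]
      _ ≤ jap (x + t • y) ^ s * jap x ^ s *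
          ((2 + T) ^ (-s) * (jap (x + t • y) ^ (-s) * jap y ^ (-s))) := by gcongr
      _ = (jap (x + t • y) ^ s * jap (x + t • y) ^ (-s)) *
          ((2 + T) ^ (-s) * (jap x ^ s * jap y ^ (-s))) := by ring
      _ = _ := by rw [e1, one_mul]

/-- The weight `⟨x⟩^{m_e} ⟨ξ⟩^{m_ψ}`. -/
noncomputable def wt (m : ℝ × ℝ) (θ : Par n) : ℝ := jap θ.2.1 ^ m.1 * jap θ.2.2 ^ m.2

lemma wt_pos (m : ℝ × ℝ) (θ : Par n) : 0 < wt m θ :=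
  mul_pos (jap_rpow_pos _ _) (jap_rpow_pos _ _)

lemma wt_continuous (m : ℝ × ℝ) : Continuous (wt m : Par n → ℝ) :=
  ((jap_rpow_continuous _).comp (by fun_prop)).mul ((jap_rpow_continuous _).comp (by fun_prop))

lemma wt_mul (m k : ℝ × ℝ) (θ : Par n) : wt m θ * wt k θ = wt (m + k) θ := by
  simp only [wt, Prod.fst_add, Prod.snd_add, Real.rpow_add (jap_pos _)]
  ring

/-- The parameters with `|t| < 2`. -/
abbrev Slab (n : ℕ) : Type := {θ : Par n // |θ.1| < 2}

/-- The map `(t, (x, ξ)) ↦ (x + t y, ξ)`. -/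
noncomputable def aff (y : Pos n) : Par n →L[ℝ] Phase n :=
  ((ContinuousLinearMap.fst ℝ (Pos n) (Pos n)).comp (ContinuousLinearMap.snd ℝ ℝ (Phase n)) +
    (ContinuousLinearMap.fst ℝ ℝ (Phase n)).smulRight y).prod
    ((ContinuousLinearMap.snd ℝ (Pos n) (Pos n)).comp (ContinuousLinearMap.snd ℝ ℝ (Phase n)))

@[simp] lemma aff_apply (y : Pos n) (θ : Par n) : aff y θ = (θ.2.1 + θ.1 • y, θ.2.2) := rfl

/-- The point `(x, ξ + 2πη)`. -/
noncomputable def cot (θ : Par n) (η : Pos n) : Phase n := (θ.2.1, θ.2.2 + (2 * Real.pi) • η)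

/-- The gain of a derivative is deliberately discarded while convergence is at stake; it is
recovered later by the Leibniz induction. -/
lemma Symb.le_self_sub_e₁ {k : ℝ × ℝ} : Symb n (k - e₁) ≤ Symb n k := Symb.shift₁ k

lemma Symb.le_self_sub_e₂ {k : ℝ × ℝ} : Symb n (k - e₂) ≤ Symb n k := Symb.shift₂ k

lemma pd_comp_aff (j : Fin n) {b : Phase n → ℂ} (hb : ContDiff ℝ ∞ b) (θ : Par n) :
    pd j (fun y => b (aff y θ)) = (θ.1 : ℂ) • fun y => dX j b (aff y θ) := by
  ext y
  have h1 : HasFDerivAt (fun y : Pos n => aff y θ)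
      ((θ.1 • ContinuousLinearMap.id ℝ (Pos n)).prod (0 : Pos n →L[ℝ] Pos n)) y := by
    simp only [aff_apply]
    exact (((hasFDerivAt_id y).const_smul θ.1).const_add θ.2.1).prodMk (hasFDerivAt_const _ _)
  have h2 := ((smooth_diffAt hb (aff y θ)).hasFDerivAt).comp y h1
  change fderiv ℝ (b ∘ fun y => aff y θ) y (EuclideanSpace.single j 1) = _
  rw [h2.fderiv]
  simp only [dX, Pi.smul_apply, smul_eq_mul, ContinuousLinearMap.comp_apply]
  rw [← Complex.real_smul, ← map_smul]
  simp

lemma pd_comp_cot (j : Fin n) {a : Phase n → ℂ} (ha : ContDiff ℝ ∞ a) (θ : Par n) :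
    pd j (fun η => a (cot θ η)) = ((2 * Real.pi : ℝ) : ℂ) • fun η => dXi j a (cot θ η) := by
  ext y
  have h1 : HasFDerivAt (fun y : Pos n => cot θ y)
      ((0 : Pos n →L[ℝ] Pos n).prod ((2 * Real.pi) • ContinuousLinearMap.id ℝ (Pos n))) y := by
    simp only [cot]
    exact (hasFDerivAt_const _ _).prodMk
      (((hasFDerivAt_id y).const_smul (2 * Real.pi)).const_add θ.2.2)
  have h2 := ((smooth_diffAt ha (cot θ y)).hasFDerivAt).comp y h1
  change fderiv ℝ (a ∘ fun y => cot θ y) y (EuclideanSpace.single j 1) = _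
  rw [h2.fderiv]
  simp only [dXi, Pi.smul_apply, smul_eq_mul, ContinuousLinearMap.comp_apply]
  rw [← Complex.real_smul, ← map_smul]
  simp

lemma comp_aff_contDiff {b : Phase n → ℂ} (hb : ContDiff ℝ ∞ b) (θ : Par n) :
    ContDiff ℝ ∞ fun y => b (aff y θ) :=
  hb.comp ((contDiff_const.add (contDiff_const.smul contDiff_id)).prodMk contDiff_const)

lemma comp_cot_contDiff {a : Phase n → ℂ} (ha : ContDiff ℝ ∞ a) (θ : Par n) :
    ContDiff ℝ ∞ fun η => a (cot θ η) :=
  ha.comp (contDiff_const.prodMk (contDiff_const.add (contDiff_id.const_smul (2 * Real.pi))))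

/-- Peetre's inequality separates `x` from `y` at the cost of growth `|k.1|` in `y`. Every
`y`-derivative brings out a factor `t`, bounded by `2` on the slab. -/
lemma Symb.fam_aff {k : ℝ × ℝ} {b : Phase n → ℂ} (hb : b ∈ Symb n k) :
    Fam (fun θ : Slab n => wt k θ.1) |k.1| fun θ y => b (aff y θ.1) := by
  have hbd : ∀ {b : Phase n → ℂ}, b ∈ Symb n k →
      FamBound (fun θ : Slab n => wt k θ.1) |k.1| fun θ y => b (aff y θ.1) := by
    intro b hb
    obtain ⟨C, hC0, hC⟩ := (Symb.bound hb).exists_nonneg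
    refine ⟨C * (2 + 2) ^ |k.1|, fun θ y => (hC _ _).trans ?_⟩
    have h := peetre (T := 2) θ.2.le k.1 θ.1.2.1 y
    have := (jap_rpow_pos θ.1.2.2 k.2).le
    calc C * jap (θ.1.2.1 + θ.1.1 • y) ^ k.1 * jap θ.1.2.2 ^ k.2
        ≤ C * ((2 + 2) ^ |k.1| * (jap θ.1.2.1 ^ k.1 * jap y ^ |k.1|)) * jap θ.1.2.2 ^ k.2 := by
          gcongr
      _ = _ := by simp only [wt]; ring
  refine ⟨fun θ => comp_aff_contDiff (Symb.smooth hb) θ.1, fun N => ?_⟩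
  induction N generalizing b with
  | zero => exact hbd hb
  | succ N ih =>
    refine ⟨hbd hb, fun j => ?_⟩
    simp only [pd_comp_aff j (Symb.smooth hb)]
    have hb' := Symb.le_self_sub_e₁ (Symb.dX hb j)
    exact FamBounds.scale (fun θ : Slab n => comp_aff_contDiff (Symb.smooth hb') θ.1) (ih hb')
      (σ := fun θ => (θ.1.1 : ℂ)) (C := 2) (fun θ => (wt_pos k θ.1).le) fun θ => by
        rw [Complex.norm_real]
        exact θ.2.le

lemma Symb.fam_cot {m : ℝ × ℝ} {a : Phase n → ℂ} (ha : a ∈ Symb n m) :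
    Fam (fun θ : Slab n => wt m θ.1) |m.2| fun θ η => a (cot θ.1 η) := by
  have hbd : ∀ {a : Phase n → ℂ}, a ∈ Symb n m →
      FamBound (fun θ : Slab n => wt m θ.1) |m.2| fun θ y => a (cot θ.1 y) := by
    intro a ha
    obtain ⟨C, hC0, hC⟩ := (Symb.bound ha).exists_nonneg
    refine ⟨C * (2 + 2 * Real.pi) ^ |m.2|, fun θ y => (hC _ _).trans ?_⟩
    have h := peetre (T := 2 * Real.pi) (t := 2 * Real.pi)
      (abs_of_nonneg (by positivity)).le m.2 θ.1.2.2 y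
    have := (jap_rpow_pos θ.1.2.1 m.1).le
    calc C * jap θ.1.2.1 ^ m.1 * jap (θ.1.2.2 + (2 * Real.pi) • y) ^ m.2
        ≤ C * jap θ.1.2.1 ^ m.1 *
          ((2 + 2 * Real.pi) ^ |m.2| * (jap θ.1.2.2 ^ m.2 * jap y ^ |m.2|)) := by
          gcongr
      _ = _ := by simp only [wt]; ring
  refine ⟨fun θ => comp_cot_contDiff (Symb.smooth ha) θ.1, fun N => ?_⟩
  induction N generalizing a with
  | zero => exact hbd ha
  | succ N ih =>
    refine ⟨hbd ha, fun j => ?_⟩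
    simp only [pd_comp_cot j (Symb.smooth ha)]
    have ha' := Symb.le_self_sub_e₂ (Symb.dXi ha j)
    exact FamBounds.scale (fun θ : Slab n => comp_cot_contDiff (Symb.smooth ha') θ.1) (ih ha')
      (σ := fun _ => ((2 * Real.pi : ℝ) : ℂ)) (fun θ => (wt_pos m θ.1).le) fun _ => le_rfl

end SGCalc

/-! ### Derivatives and integrations by parts for the regularised integral -/

namespace SGCalc

open scoped FourierTransform

variable {n : ℕ}

/-! ### The regularised composition integral and its derivatives -/

/-- The Fourier transform in `y` of `h(y) b(x + t y, ξ)`. -/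
noncomputable def innerF (h : Pos n → ℂ) (b : Phase n → ℂ) (θ : Par n) : Pos n → ℂ :=
  𝓕 fun y => h y * b (aff y θ)

/-- The integral `∫ a(x, ξ + 2πη) 𝓕(h(y) b(x + t y, ξ))(η) dη`. -/
noncomputable def pairC (h : Pos n → ℂ) (a b : Phase n → ℂ) (θ : Par n) : ℂ :=
  ∫ η, a (cot θ η) * innerF h b θ η

section General

variable {Θ : Type*} {w : Θ → ℝ} {r s : ℝ}

lemma FamBound.zero : FamBound w r fun _ => (0 : Pos n → ℂ) := ⟨0, fun θ y => by simp⟩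

lemma FamBound.sum {ι : Type*} (t : Finset ι) {Q : ι → Θ → Pos n → ℂ}
    (h : ∀ i ∈ t, FamBound w r (Q i)) : FamBound w r fun θ => ∑ i ∈ t, Q i θ := by
  classical
  induction t using Finset.induction_on with
  | empty => simpa using FamBound.zero
  | insert i t hi ih =>
    simp only [Finset.sum_insert hi]
    exact (h i (by simp)).add (ih fun j hj => h j (Finset.mem_insert_of_mem hj))

lemma FamBound.slab {w : Par n → ℝ} (hw : ∀ θ, 0 ≤ w θ) {Q : Par n → Pos n → ℂ}
    (h : FamBound (fun θ : Slab n => w θ.1) r fun θ => Q θ.1) :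
    ∃ C : ℝ, 0 ≤ C ∧ ∀ θ : Par n, |θ.1| < 2 → ∀ y, ‖Q θ y‖ ≤ C * w θ * jap y ^ r := by
  obtain ⟨C, hC0, hC⟩ := h.exists_nonneg fun θ : Slab n => hw θ.1
  exact ⟨C, hC0, fun θ hθ y => hC ⟨θ, hθ⟩ y⟩

end General

variable {r : ℝ} {m k : ℝ × ℝ} {h : Pos n → ℂ} {a b : Phase n → ℂ}

lemma fam_mul_aff (hh : Tame r h) (hb : b ∈ Symb n k) :
    Fam (fun θ : Slab n => wt k θ.1) (r + |k.1|) fun θ y => h y * b (aff y θ.1) := by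
  have := Fam.mul (fun _ => zero_le_one) (fun θ : Slab n => (wt_pos k θ.1).le) hh.const
    (Symb.fam_aff hb)
  simp only [one_mul] at this
  exact this

lemma tame_coord_mul (hh : Tame r h) (j : Fin n) : Tame (r + 1) (coord j * h) := by
  rw [add_comm]
  exact (tame_coord j).mul hh

/-- The derivatives of `θ ↦ b(x + t y, ξ)` in the coordinate directions. -/
noncomputable def affD (b : Phase n → ℂ) (y : Pos n) (θ : Par n) : Option (Fin n ⊕ Fin n) → ℂ
  | none => ∑ j, coord j y * dX j b (aff y θ)
  | some (Sum.inl j) => dX j b (aff y θ)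
  | some (Sum.inr j) => dXi j b (aff y θ)

lemma fderiv_comp_aff (hb : ContDiff ℝ ∞ b) (y : Pos n) (θ : Par n)
    (d : Option (Fin n ⊕ Fin n)) :
    fderiv ℝ (fun θ => b (aff y θ)) θ (dir d) = affD b y θ d := by
  have h1 := ((smooth_diffAt hb (aff y θ)).hasFDerivAt).comp θ (aff y).hasFDerivAt
  change fderiv ℝ (b ∘ fun θ => aff y θ) θ (dir d) = _
  rw [h1.fderiv, ContinuousLinearMap.comp_apply]
  rcases d with _ | j | j
  · have hy : aff y (dir none) = ∑ j, y j • ((EuclideanSpace.single j 1, 0) : Phase n) := by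
      ext i
      · simp [dir, Prod.fst_sum, Pi.single_apply]
      · simp [dir, Prod.snd_sum]
    rw [hy, map_sum]
    refine Finset.sum_congr rfl fun j _ => ?_
    rw [map_smul, Complex.real_smul]
    rfl
  · simp [dir, affD, dX]
  · simp [dir, affD, dXi]

lemma diffAt_comp_aff (hb : ContDiff ℝ ∞ b) (y : Pos n) (θ : Par n) :
    DifferentiableAt ℝ (fun θ => b (aff y θ)) θ :=
  (((smooth_diffAt hb (aff y θ)).hasFDerivAt).comp θ (aff y).hasFDerivAt).differentiableAt

/-- The derivatives of `innerF` in the coordinate directions. -/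
noncomputable def innerD (h : Pos n → ℂ) (b : Phase n → ℂ) (θ : Par n) (η : Pos n) :
    Option (Fin n ⊕ Fin n) → ℂ
  | none => ∑ j, innerF (coord j * h) (dX j b) θ η
  | some (Sum.inl j) => innerF h (dX j b) θ η
  | some (Sum.inr j) => innerF h (dXi j b) θ η

lemma mul_affD_none (θ : Par n) : (fun y => h y * affD b y θ none)
    = ∑ j, fun y => (coord j * h) y * dX j b (aff y θ) := by
  funext y
  rw [Finset.sum_apply, affD, Finset.mul_sum]
  exact Finset.sum_congr rfl fun j _ => by simp only [Pi.mul_apply]; ring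

/-- The additional power of `⟨y⟩` is needed only for the `t`-derivative, which produces factors
`yⱼ`; allowing it in all directions keeps the bound uniform. -/
lemma famBound_affD (hh : Tame r h) (hb : b ∈ Symb n k) (d : Option (Fin n ⊕ Fin n)) :
    FamBound (fun θ : Slab n => wt k θ.1) (r + 1 + |k.1|) fun θ y => h y * affD b y θ.1 d := by
  rcases d with _ | j | j
  · have e : (fun (θ : Slab n) y => h y * affD b y θ.1 none) = fun θ => ∑ j, fun y =>
        (coord j * h) y * dX j b (aff y θ.1) := funext fun θ => mul_affD_none θ.1
    rw [e]
    exact FamBound.sum (Finset.univ : Finset (Fin n)) fun j _ =>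
      (fam_mul_aff (tame_coord_mul hh j) (Symb.le_self_sub_e₁ (Symb.dX hb j))).bound
  · change FamBound (fun θ : Slab n => wt k θ.1) _ fun θ y => h y * dX j b (aff y θ.1)
    exact (fam_mul_aff hh (Symb.le_self_sub_e₁ (Symb.dX hb j))).bound.mono
      (fun θ => (wt_pos k θ.1).le) (by linarith)
  · change FamBound (fun θ : Slab n => wt k θ.1) _ fun θ y => h y * dXi j b (aff y θ.1)
    exact (fam_mul_aff hh (Symb.le_self_sub_e₂ (Symb.dXi hb j))).bound.mono
      (fun θ => (wt_pos k θ.1).le) (by linarith)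

lemma continuous_mul_affD (hh : Tame r h) (hb : b ∈ Symb n k) (d : Option (Fin n ⊕ Fin n))
    {θ : Par n} (hθ : |θ.1| < 2) : Continuous fun y => h y * affD b y θ d := by
  have hc := fun {b} (hb : b ∈ Symb n k) => (Symb.fam_aff hb).continuous ⟨θ, hθ⟩
  refine (hh.continuous ()).mul ?_
  rcases d with _ | j | j
  · exact continuous_finsetSum _ fun j _ => (coord_contDiff j).continuous.mul
      (hc (Symb.le_self_sub_e₁ (Symb.dX hb j)))
  · exact hc (Symb.le_self_sub_e₁ (Symb.dX hb j))
  · exact hc (Symb.le_self_sub_e₂ (Symb.dXi hb j))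

lemma fourier_sum {ι : Type*} (t : Finset ι) {f : ι → Pos n → ℂ}
    (hf : ∀ i ∈ t, Integrable (f i)) : 𝓕 (∑ i ∈ t, f i) = ∑ i ∈ t, 𝓕 (f i) := by
  classical
  induction t using Finset.induction_on with
  | empty =>
    ext η
    simp [Real.fourier_eq']
  | insert i t hi ih =>
    rw [Finset.sum_insert hi, Finset.sum_insert hi, fourier_add (hf i (by simp)),
      ih fun j hj => hf j (Finset.mem_insert_of_mem hj)]
    exact integrable_finsetSum' t fun j hj => hf j (Finset.mem_insert_of_mem hj)

lemma fourier_mul_affD (hh : Tame r h) (hb : b ∈ Symb n k) (hr : r + 1 + |k.1| < -n)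
    (d : Option (Fin n ⊕ Fin n)) {θ : Par n} (hθ : |θ.1| < 2) (η : Pos n) :
    𝓕 (fun y => h y * affD b y θ d) η = innerD h b θ η d := by
  rcases d with _ | j | j
  · have h1 := fourier_sum (Finset.univ : Finset (Fin n)) fun j _ =>
      (fam_mul_aff (tame_coord_mul hh j) (Symb.le_self_sub_e₁ (Symb.dX hb j))).integrable hr ⟨θ, hθ⟩
    have h2 := congrFun h1 η
    rw [Finset.sum_apply] at h2
    rw [mul_affD_none]
    exact h2
  · rfl
  · rfl

lemma innerF_diff (hh : Tame r h) (hb : b ∈ Symb n k) (hr : r + 1 + |k.1| < -n) {θ₀ : Par n}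
    (hθ₀ : |θ₀.1| < 2) (η : Pos n) :
    DifferentiableAt ℝ (fun θ => innerF h b θ η) θ₀ ∧
      ∀ d, fderiv ℝ (fun θ => innerF h b θ η) θ₀ (dir d) = innerD h b θ₀ η d := by
  have hn : ∀ y : Pos n, ‖cexp (((-2 * Real.pi * inner ℝ y η : ℝ) : ℂ) * I)‖ = 1 :=
    fun y => Complex.norm_exp_ofReal_mul_I _
  have hec : Continuous fun y : Pos n => cexp (((-2 * Real.pi * inner ℝ y η : ℝ) : ℂ) * I) := by
    fun_prop
  have hbs := Symb.smooth hb
  have key := differentiableAt_integral (n := n) (W := wt k)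
    (F := fun θ y => cexp (((-2 * Real.pi * inner ℝ y η : ℝ) : ℂ) * I) * (h y * b (aff y θ)))
    (D := fun d θ y => cexp (((-2 * Real.pi * inner ℝ y η : ℝ) : ℂ) * I) * (h y * affD b y θ d))
    (wt_continuous k) hr
    (fun θ _ y => ((diffAt_comp_aff hbs y θ).const_mul _).const_mul _)
    (fun d θ _ y => by
      rw [fderiv_const_mul ((diffAt_comp_aff hbs y θ).const_mul _),
        fderiv_const_mul (diffAt_comp_aff hbs y θ)]
      simp only [_root_.smul_apply, fderiv_comp_aff hbs, smul_eq_mul])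
    (fun d θ hθ => hec.mul (continuous_mul_affD hh hb d hθ))
    (fun θ hθ => by
      have h1 := (fam_mul_aff hh hb).integrable (by linarith) ⟨θ, hθ⟩
      exact h1.bdd_mul hec.aestronglyMeasurable (Eventually.of_forall fun y => (hn y).le))
    (fun d => by
      obtain ⟨C, hC0, hC⟩ := FamBound.slab (w := wt k)
        (Q := fun θ y => h y * affD b y θ d) (fun θ => (wt_pos k θ).le) (famBound_affD hh hb d)
      refine ⟨C, hC0, fun θ hθ y => ?_⟩
      rw [norm_mul, hn, one_mul]
      exact hC θ hθ y) hθ₀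
  have e : ∀ f : Pos n → ℂ, 𝓕 f η
      = ∫ y, cexp (((-2 * Real.pi * inner ℝ y η : ℝ) : ℂ) * I) * f y := fun f => by
    rw [Real.fourier_eq']
    rfl
  simp only [innerF, e]
  refine ⟨key.1, fun d => (key.2 d).trans ?_⟩
  rw [← e, fourier_mul_affD hh hb hr d hθ₀]

lemma pairing_famBound (ha : a ∈ Symb n m) (hh : Tame r h) (hb : b ∈ Symb n k)
    (hr : r + |k.1| < -n) (l : ℝ) :
    FamBound (fun θ : Slab n => wt m θ.1 * wt k θ.1) l
      fun θ η => a (cot θ.1 η) * innerF h b θ.1 η := by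
  obtain ⟨C, -, hC⟩ := exists_pairing_bound (fun θ : Slab n => (wt_pos m θ.1).le)
    (fun θ : Slab n => (wt_pos k θ.1).le) (Symb.fam_cot ha).bound (fam_mul_aff hh hb) hr l
  exact ⟨C, hC⟩

lemma pairing_continuous (ha : a ∈ Symb n m) (hh : Tame r h) (hb : b ∈ Symb n k)
    (hr : r + |k.1| < -n) {θ : Par n} (hθ : |θ.1| < 2) :
    Continuous fun η => a (cot θ η) * innerF h b θ η :=
  ((Symb.fam_cot ha).continuous ⟨θ, hθ⟩).mul ((fam_mul_aff hh hb).continuous_fourier hr ⟨θ, hθ⟩)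

lemma pairing_integrable (ha : a ∈ Symb n m) (hh : Tame r h) (hb : b ∈ Symb n k)
    (hr : r + |k.1| < -n) {θ : Par n} (hθ : |θ.1| < 2) :
    Integrable fun η => a (cot θ η) * innerF h b θ η := by
  obtain ⟨C, hC⟩ := pairing_famBound ha hh hb hr (-n - 1)
  exact ((integrable_jap_rpow (n := n) (r := -n - 1) (by linarith)).const_mul _).mono'
    (pairing_continuous ha hh hb hr hθ).aestronglyMeasurable
    (Eventually.of_forall fun η => hC ⟨θ, hθ⟩ η)

/-- The integrand is bounded by the product of the two weights times an integrable function of `η`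
alone, so the orders of `a` and `b` add. -/
lemma pairC_bound (ha : a ∈ Symb n m) (hh : Tame r h) (hb : b ∈ Symb n k)
    (hr : r + |k.1| < -n) :
    ∃ C : ℝ, 0 ≤ C ∧ ∀ θ : Par n, |θ.1| < 2 → ‖pairC h a b θ‖ ≤ C * wt (m + k) θ := by
  obtain ⟨C, hC0, hC⟩ := (pairing_famBound ha hh hb hr (-n - 1)).exists_nonneg
    fun θ : Slab n => (mul_pos (wt_pos m θ.1) (wt_pos k θ.1)).le
  refine ⟨C * ∫ y : Pos n, jap y ^ (-n - 1 : ℝ), mul_nonneg hC0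
    (integral_nonneg fun y => (jap_rpow_pos y _).le), fun θ hθ => ?_⟩
  refine (norm_integral_le_integral_norm _).trans ?_
  rw [← wt_mul]
  calc ∫ η, ‖a (cot θ η) * innerF h b θ η‖
      ≤ ∫ η : Pos n, C * (wt m θ * wt k θ) * jap η ^ (-n - 1 : ℝ) :=
        integral_mono (pairing_integrable ha hh hb hr hθ).norm
          ((integrable_jap_rpow (by linarith)).const_mul _) (hC ⟨θ, hθ⟩)
    _ = _ := by rw [integral_const_mul]; ring

/-- The derivatives of `θ ↦ a(x, ξ + 2πη)` in the coordinate directions. -/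
noncomputable def cotD (a : Phase n → ℂ) (η : Pos n) (θ : Par n) : Option (Fin n ⊕ Fin n) → ℂ
  | none => 0
  | some (Sum.inl j) => dX j a (cot θ η)
  | some (Sum.inr j) => dXi j a (cot θ η)

lemma hasFDerivAt_cot (η : Pos n) (θ : Par n) :
    HasFDerivAt (fun θ : Par n => cot θ η) (ContinuousLinearMap.snd ℝ ℝ (Phase n)) θ := by
  have : (fun θ : Par n => cot θ η) = fun θ => ContinuousLinearMap.snd ℝ ℝ (Phase n) θ +
      ((0, (2 * Real.pi) • η) : Phase n) := by
    ext θ <;> simp [cot]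
  rw [this]
  exact (ContinuousLinearMap.snd ℝ ℝ (Phase n)).hasFDerivAt.add_const _

lemma diffAt_comp_cot (ha : ContDiff ℝ ∞ a) (η : Pos n) (θ : Par n) :
    DifferentiableAt ℝ (fun θ => a (cot θ η)) θ :=
  (((smooth_diffAt ha (cot θ η)).hasFDerivAt).comp θ (hasFDerivAt_cot η θ)).differentiableAt

lemma fderiv_comp_cot (ha : ContDiff ℝ ∞ a) (η : Pos n) (θ : Par n)
    (d : Option (Fin n ⊕ Fin n)) :
    fderiv ℝ (fun θ => a (cot θ η)) θ (dir d) = cotD a η θ d := by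
  have h1 := ((smooth_diffAt ha (cot θ η)).hasFDerivAt).comp θ (hasFDerivAt_cot η θ)
  change fderiv ℝ (a ∘ fun θ => cot θ η) θ (dir d) = _
  rw [h1.fderiv, ContinuousLinearMap.comp_apply]
  rcases d with _ | j | j
  · simp [dir, cotD]
  · simp [dir, cotD, dX]
  · simp [dir, cotD, dXi]

/-- The derivatives of `pairC` in the coordinate directions. -/
noncomputable def pairD (h : Pos n → ℂ) (a b : Phase n → ℂ) (θ : Par n) :
    Option (Fin n ⊕ Fin n) → ℂ
  | none => ∑ j, pairC (coord j * h) a (dX j b) θ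
  | some (Sum.inl j) => pairC h (dX j a) b θ + pairC h a (dX j b) θ
  | some (Sum.inr j) => pairC h (dXi j a) b θ + pairC h a (dXi j b) θ

/-- The integral over `η` is differentiated with derivatives of `innerF` already known. All
derivatives are again sums of `pairC`, with a cutoff `yⱼ h` in the `t`-direction. -/
lemma pairC_diff (ha : a ∈ Symb n m) (hh : Tame r h) (hb : b ∈ Symb n k)
    (hr : r + 1 + |k.1| < -n) {θ₀ : Par n} (hθ₀ : |θ₀.1| < 2) :
    DifferentiableAt ℝ (pairC h a b) θ₀ ∧
      ∀ d, fderiv ℝ (pairC h a b) θ₀ (dir d) = pairD h a b θ₀ d := by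
  have has := Symb.smooth ha
  have hr' : r + |k.1| < -n := by linarith
  have ha1 := fun j => Symb.le_self_sub_e₁ (Symb.dX ha j)
  have ha2 := fun j => Symb.le_self_sub_e₂ (Symb.dXi ha j)
  have hb1 := fun j => Symb.le_self_sub_e₁ (Symb.dX hb j)
  have hb2 := fun j => Symb.le_self_sub_e₂ (Symb.dXi hb j)
  have hhj := fun j => tame_coord_mul hh j
  have key := differentiableAt_integral (n := n) (W := fun θ => wt m θ * wt k θ) (s := -n - 1)
    (F := fun θ η => a (cot θ η) * innerF h b θ η)
    (D := fun d θ η => cotD a η θ d * innerF h b θ η + a (cot θ η) * innerD h b θ η d)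
    ((wt_continuous m).mul (wt_continuous k)) (by linarith)
    (fun θ hθ η => (diffAt_comp_cot has η θ).mul (innerF_diff hh hb hr hθ η).1)
    (fun d θ hθ η => by
      have h2 := innerF_diff hh hb hr hθ η
      rw [fderiv_fun_mul (diffAt_comp_cot has η θ) h2.1]
      simp only [_root_.add_apply, _root_.smul_apply, smul_eq_mul,
        fderiv_comp_cot has, h2.2]
      ring)
    (fun d θ hθ => by
      rcases d with _ | j | j
      · simp only [cotD, innerD, zero_mul, zero_add, Finset.mul_sum]
        exact continuous_finsetSum _ fun j _ => pairing_continuous ha (hhj j) (hb1 j) hr hθ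
      · exact (pairing_continuous (ha1 j) hh hb hr' hθ).add
          (pairing_continuous ha hh (hb1 j) hr' hθ)
      · exact (pairing_continuous (ha2 j) hh hb hr' hθ).add
          (pairing_continuous ha hh (hb2 j) hr' hθ))
    (fun θ hθ => pairing_integrable ha hh hb hr' hθ)
    (fun d => by
      refine FamBound.slab (n := n) (w := fun θ => wt m θ * wt k θ)
        (Q := fun θ η => cotD a η θ d * innerF h b θ η + a (cot θ η) * innerD h b θ η d)
        (fun θ => (mul_pos (wt_pos m θ) (wt_pos k θ)).le) ?_
      rcases d with _ | j | j
      · have := FamBound.sum (Finset.univ : Finset (Fin n)) fun j _ =>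
          pairing_famBound ha (hhj j) (hb1 j) hr (-n - 1)
        have e : (fun (θ : Slab n) η => cotD a η θ.1 none * innerF h b θ.1 η +
            a (cot θ.1 η) * innerD h b θ.1 η none) = fun θ => ∑ j, fun η =>
              a (cot θ.1 η) * innerF (coord j * h) (dX j b) θ.1 η := by
          funext θ η
          simp [cotD, innerD, Finset.mul_sum, Finset.sum_apply]
        rw [e]
        exact this
      · exact (pairing_famBound (ha1 j) hh hb hr' (-n - 1)).add
          (pairing_famBound ha hh (hb1 j) hr' (-n - 1))
      · exact (pairing_famBound (ha2 j) hh hb hr' (-n - 1)).add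
          (pairing_famBound ha hh (hb2 j) hr' (-n - 1))) hθ₀
  refine ⟨key.1, fun d => (key.2 d).trans ?_⟩
  rcases d with _ | j | j
  · simp only [cotD, innerD, zero_mul, zero_add, Finset.mul_sum]
    exact integral_finsetSum _ fun j _ => pairing_integrable ha (hhj j) (hb1 j) hr hθ₀
  · exact integral_add (pairing_integrable (ha1 j) hh hb hr' hθ₀)
      (pairing_integrable ha hh (hb1 j) hr' hθ₀)
  · exact integral_add (pairing_integrable (ha2 j) hh hb hr' hθ₀)
      (pairing_integrable ha hh (hb2 j) hr' hθ₀)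

/-! ### Integration by parts -/

/-- `cot` ignores `t`, so `t = 0` may be chosen to enter the slab. -/
lemma tame_cot (ha : a ∈ Symb n m) (θ : Par n) : Tame |m.2| fun η => a (cot θ η) :=
  (Symb.fam_cot ha).tame ⟨(0, θ.2), by simp⟩

lemma pairing_dXi (ha : a ∈ Symb n m) (θ : Par n) {q : Pos n → ℂ} (hq : Tame r q)
    (hr : r + 1 < -n) (j : Fin n) :
    ∫ η, dXi j a (cot θ η) * 𝓕 q η = I * ∫ η, a (cot θ η) * 𝓕 (coord j * q) η := by
  have h1 := pairing_pd (tame_cot ha θ) hq hr j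
  rw [pd_comp_cot j (Symb.smooth ha)] at h1
  simp only [Pi.smul_apply, smul_eq_mul, mul_assoc] at h1
  rw [integral_const_mul] at h1
  have h2 : (2 * (Real.pi : ℂ)) ≠ 0 := by simp [Real.pi_ne_zero]
  apply mul_left_cancel₀ h2
  push_cast at h1
  linear_combination h1

/-- Integration by parts in `η`: a `ξ`-derivative on `a` is traded for multiplication by `i yⱼ`
inside the Fourier transform. This identifies the `t`-derivative of the composition. -/
lemma pairC_dXi (ha : a ∈ Symb n m) (hh : Tame r h) (hb : b ∈ Symb n k)
    (hr : r + 1 + |k.1| < -n) {θ : Par n} (hθ : |θ.1| < 2) (j : Fin n) :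
    pairC h (dXi j a) b θ = I * pairC (coord j * h) a b θ := by
  have h1 := pairing_dXi ha θ ((fam_mul_aff hh hb).tame ⟨θ, hθ⟩) (by linarith) j
  have e : (fun y => (coord j * h) y * b (aff y θ)) = coord j * fun y => h y * b (aff y θ) := by
    ext y
    simp [mul_assoc]
  simp only [pairC, innerF, e]
  exact h1

/-- The operator `1 - Δ_ξ`. -/
noncomputable def bess (a : Phase n → ℂ) : Phase n → ℂ := a - ∑ j, dXi j (dXi j a)

lemma Symb.bess (ha : a ∈ Symb n m) : bess a ∈ Symb n m :=
  (Symb n m).sub_mem ha ((Symb n m).sum_mem fun j _ => Symb.le_self_sub_e₂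
    (Symb.dXi (Symb.le_self_sub_e₂ (Symb.dXi ha j)) j))

lemma japC_mul_eq (q : Pos n → ℂ) : japC 2 * q = q + ∑ j, coord j * (coord j * q) := by
  ext y
  have : ((jap y ^ (2 : ℝ) : ℝ) : ℂ) = 1 + ∑ j, ((y j : ℝ) : ℂ) ^ 2 := by
    rw [Real.rpow_two, jap_sq, EuclideanSpace.real_norm_sq_eq]
    push_cast
    rfl
  simp only [Pi.mul_apply, japC, this, Pi.add_apply, Finset.sum_apply, coord]
  rw [add_mul, one_mul, Finset.sum_mul]
  congr 1
  exact Finset.sum_congr rfl fun j _ => by ring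

/-- Two integrations by parts per coordinate give `i² = -1`, so `1 - Δ_ξ` on `a` becomes
multiplication by `1 + |y|² = ⟨y⟩²`. -/
lemma pairing_bess (ha : a ∈ Symb n m) (θ : Par n) {q : Pos n → ℂ} (hq : Tame r q)
    (hr : r + 2 < -n) :
    ∫ η, bess a (cot θ η) * 𝓕 q η = ∫ η, a (cot θ η) * (𝓕 (japC 2 * q) : Pos n → ℂ) η := by
  have hq1 := fun j => tame_coord_mul hq j
  have hq2 := fun j => tame_coord_mul (hq1 j) j
  have ha1 := fun j => Symb.le_self_sub_e₂ (Symb.dXi ha j)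
  have ha2 := fun j => Symb.le_self_sub_e₂ (Symb.dXi (ha1 j) j)
  have hr1 : r < -n := by linarith
  have hr2 : r + 1 < -n := by linarith
  have hr3 : r + 1 + 1 < -n := by linarith
  have hi : ∀ {a : Phase n → ℂ} {q : Pos n → ℂ} {r : ℝ}, a ∈ Symb n m → Tame r q → r < -n →
      Integrable fun η => a (cot θ η) * 𝓕 q η := fun ha hq hr =>
    integrable_pairing ((tame_cot ha θ).continuous ()) (tame_cot ha θ).bound hq hr
  have e1 : ∀ j, ∫ η, dXi j (dXi j a) (cot θ η) * 𝓕 q η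
      = -∫ η, a (cot θ η) * 𝓕 (coord j * (coord j * q)) η := fun j => by
    rw [pairing_dXi (ha1 j) θ hq hr2 j, pairing_dXi ha θ (hq1 j) hr3 j, ← mul_assoc, I_mul_I]
    ring
  rw [japC_mul_eq, fourier_add (hq.integrable hr1 ()), fourier_sum _ fun j _ =>
    (hq2 j).integrable hr3 ()]
  · simp only [bess, Pi.sub_apply, Finset.sum_apply, Pi.add_apply, sub_mul, mul_add,
      Finset.sum_mul, Finset.mul_sum]
    rw [integral_sub (hi ha hq hr1) (integrable_finsetSum _ fun j _ => hi (ha2 j) hq hr1),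
      integral_add (hi ha hq hr1) (integrable_finsetSum _ fun j _ => hi ha (hq2 j) hr3),
      integral_finsetSum _ fun j _ => hi (ha2 j) hq hr1,
      integral_finsetSum _ fun j _ => hi ha (hq2 j) hr3]
    simp only [e1, Finset.sum_neg_distrib]
    ring
  · exact integrable_finsetSum' (Finset.univ : Finset (Fin n)) fun j _ =>
      (hq2 j).integrable hr3 ()

end SGCalc

/-! ### The interpolated composition and its symbol estimates -/

namespace SGCalc

open scoped FourierTransform

variable {n : ℕ}

/-! ### The composition of symbols -/

/-- The composition integral, regularised by `L` integrations by parts. -/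
noncomputable def compL (L : ℕ) (a b : Phase n → ℂ) (θ : Par n) : ℂ :=
  pairC (japC (-2 * L)) (bess^[L] a) b θ

/-- The oscillatory integral `∬ e^{-2πi y·η} a(x, ξ + 2πη) b(x + t y, ξ) dy dη`. -/
noncomputable def comp (a b : Phase n → ℂ) (θ : Par n) : ℂ :=
  limUnder atTop fun L : ℕ => compL L a b θ

variable {m k : ℝ × ℝ} {a b : Phase n → ℂ}

lemma Symb.bess_iterate (ha : a ∈ Symb n m) (L : ℕ) : SGCalc.bess^[L] a ∈ Symb n m := by
  induction L with
  | zero => exact ha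
  | succ L ih =>
    rw [Function.iterate_succ_apply']
    exact Symb.bess ih

lemma dV_bess (v : Phase n) (ha : ContDiff ℝ ∞ a) : dV v (bess a) = bess (dV v a) := by
  have h1 : ∀ j, ContDiff ℝ ∞ (dXi j (dXi j a)) := fun j =>
    dXi_contDiff j (dXi_contDiff j ha)
  rw [bess, dV_sub v ha (smooth_sum _ h1), dV_sum _ _ h1, bess]
  congr 1
  refine Finset.sum_congr rfl fun j _ => ?_
  simp only [dXi_eq_dV]
  rw [dV_comm _ _ (dV_contDiff _ ha), dV_comm _ _ ha]

lemma dV_bess_iterate (v : Phase n) (ha : a ∈ Symb n m) (L : ℕ) :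
    dV v (bess^[L] a) = bess^[L] (dV v a) := by
  induction L with
  | zero => rfl
  | succ L ih =>
    rw [Function.iterate_succ_apply', Function.iterate_succ_apply',
      dV_bess v (Symb.smooth (Symb.bess_iterate ha L)), ih]

lemma japC_mul_japC (r s : ℝ) : (japC r * japC s : Pos n → ℂ) = japC (r + s) := by
  ext y
  simp [japC, Real.rpow_add (jap_pos y)]

/-- The extra `1 - Δ_ξ` on `a` cancels the extra `⟨y⟩^{-2}`. Hence the sequence defining `comp` is
eventually constant, and any `L` large enough for convergence computes it. -/
lemma compL_succ (ha : a ∈ Symb n m) {θ : Par n} {s : ℝ} (hb : Tame s fun y => b (aff y θ))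
    {L : ℕ} (hL : s - 2 * L < -n) : compL (L + 1) a b θ = compL L a b θ := by
  have hq := (tame_japC (n := n) (-2 * ((L + 1 : ℕ) : ℝ))).mul hb
  have h := pairing_bess (Symb.bess_iterate ha L) θ hq (by push_cast; linarith)
  rw [← mul_assoc, japC_mul_japC, show 2 + -2 * ((L + 1 : ℕ) : ℝ) = -2 * L by push_cast; ring] at h
  rw [compL, Function.iterate_succ_apply']
  exact h

lemma compL_eq (ha : a ∈ Symb n m) {θ : Par n} {s : ℝ} (hb : Tame s fun y => b (aff y θ))
    {L M : ℕ} (hL : s - 2 * L < -n) (hLM : L ≤ M) : compL M a b θ = compL L a b θ := by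
  induction M, hLM using Nat.le_induction with
  | base => rfl
  | succ M hM ih =>
    rw [compL_succ ha hb, ih]
    have : (L : ℝ) ≤ M := by exact_mod_cast hM
    linarith

lemma comp_eq_of_tame (ha : a ∈ Symb n m) {θ : Par n} {s : ℝ} (hb : Tame s fun y => b (aff y θ))
    {L : ℕ} (hL : s - 2 * L < -n) : comp a b θ = compL L a b θ :=
  (tendsto_const_nhds.congr' ((eventually_ge_atTop L).mono fun _ hM =>
    (compL_eq ha hb hL hM).symm)).limUnder_eq

lemma comp_eq (ha : a ∈ Symb n m) (hb : b ∈ Symb n k) {θ : Par n} (hθ : |θ.1| < 2) {L : ℕ}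
    (hL : |k.1| - 2 * L < -n) : comp a b θ = compL L a b θ :=
  comp_eq_of_tame ha ((Symb.fam_aff hb).tame ⟨θ, hθ⟩) hL

lemma exists_order (s : ℝ) : ∃ L : ℕ, s - 2 * L < -n := by
  obtain ⟨L, hL⟩ := exists_nat_gt (s + n)
  exact ⟨L, by have : (0 : ℝ) ≤ L := L.cast_nonneg; linarith⟩

lemma comp_bound (ha : a ∈ Symb n m) (hb : b ∈ Symb n k) :
    ∃ C : ℝ, 0 ≤ C ∧ ∀ θ : Par n, |θ.1| < 2 → ‖comp a b θ‖ ≤ C * wt (m + k) θ := by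
  obtain ⟨L, hL⟩ := exists_order (n := n) |k.1|
  obtain ⟨C, hC0, hC⟩ := pairC_bound (Symb.bess_iterate ha L) (tame_japC (-2 * L)) hb
    (by linarith)
  refine ⟨C, hC0, fun θ hθ => ?_⟩
  rw [comp_eq ha hb hθ hL]
  exact hC θ hθ

/-- The derivatives of `comp` in the coordinate directions. -/
noncomputable def compD (a b : Phase n → ℂ) (θ : Par n) : Option (Fin n ⊕ Fin n) → ℂ
  | none => -I * ∑ j, comp (dXi j a) (dX j b) θ
  | some (Sum.inl j) => comp (dX j a) b θ + comp a (dX j b) θ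
  | some (Sum.inr j) => comp (dXi j a) b θ + comp a (dXi j b) θ

/-- A sufficiently large `L`, fixed throughout the slab, computes `comp` and all its first
derivatives. Differentiating in `x` or `ξ` gives the Leibniz rule because `bess` commutes with
derivatives; in the `t`-direction the factors `yⱼ` become `ξ`-derivatives of `a`. -/
lemma comp_diff (ha : a ∈ Symb n m) (hb : b ∈ Symb n k) {θ : Par n} (hθ : |θ.1| < 2) :
    DifferentiableAt ℝ (comp a b) θ ∧ ∀ d, fderiv ℝ (comp a b) θ (dir d) = compD a b θ d := by
  -- The additional `1` pays for the factor `yⱼ` that the `t`-derivative creates.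
  obtain ⟨L, hL⟩ := exists_order (n := n) (|k.1| + 1)
  have hL' : |k.1| - 2 * (L : ℝ) < -n := by linarith
  have hr : -2 * (L : ℝ) + 1 + |k.1| < -n := by linarith
  have ho : {θ : Par n | |θ.1| < 2} ∈ 𝓝 θ :=
    (isOpen_lt (by fun_prop) continuous_const).mem_nhds hθ
  have he : comp a b =ᶠ[𝓝 θ] compL L a b := by
    filter_upwards [ho] with θ' hθ' using comp_eq ha hb hθ' hL'
  have haL := Symb.bess_iterate ha L
  have hh := tame_japC (n := n) (-2 * (L : ℝ))
  have ha1 := fun j => Symb.le_self_sub_e₁ (Symb.dX ha j)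
  have ha2 := fun j => Symb.le_self_sub_e₂ (Symb.dXi ha j)
  have hb1 := fun j => Symb.le_self_sub_e₁ (Symb.dX hb j)
  have hb2 := fun j => Symb.le_self_sub_e₂ (Symb.dXi hb j)
  have e1 : ∀ j, dX j (bess^[L] a) = bess^[L] (dX j a) := fun j => dV_bess_iterate _ ha L
  have e2 : ∀ j, dXi j (bess^[L] a) = bess^[L] (dXi j a) := fun j => dV_bess_iterate _ ha L
  have key := pairC_diff haL hh hb hr hθ
  refine ⟨key.1.congr_of_eventuallyEq he, fun d => ?_⟩
  rw [he.fderiv_eq]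
  refine (key.2 d).trans ?_
  rcases d with _ | j | j
  · simp only [pairD, compD, Finset.mul_sum]
    refine Finset.sum_congr rfl fun j _ => ?_
    have h1 := pairC_dXi haL hh (hb1 j) hr hθ j
    rw [e2] at h1
    rw [comp_eq (ha2 j) (hb1 j) hθ hL', compL, h1, ← mul_assoc,
      show -I * I = 1 by rw [neg_mul, I_mul_I, neg_neg], one_mul]
  · simp only [pairD, compD]
    rw [comp_eq (ha1 j) hb hθ hL', comp_eq ha (hb1 j) hθ hL', e1]
    rfl
  · simp only [pairD, compD]
    rw [comp_eq (ha2 j) hb hθ hL', comp_eq ha (hb2 j) hθ hL', e2]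
    rfl

/-! ### Bilinear operations that satisfy the Leibniz rule -/

lemma fderiv_phase_eq (f : Phase n → ℂ) : fderiv ℝ f = fun p =>
    ∑ j, ((((EuclideanSpace.proj j : Pos n →L[ℝ] ℝ).comp
      (ContinuousLinearMap.fst ℝ (Pos n) (Pos n))).smulRight (dX j f p)) +
    (((EuclideanSpace.proj j : Pos n →L[ℝ] ℝ).comp
      (ContinuousLinearMap.snd ℝ (Pos n) (Pos n))).smulRight (dXi j f p))) := by
  funext p
  ext v
  · have hv : v = (∑ j, v j • EuclideanSpace.single j (1 : ℝ) : Pos n) := by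
      ext i
      simp [Finset.sum_apply, Pi.single_apply]
    have : ((v, 0) : Phase n) = ∑ j, v j • ((EuclideanSpace.single j (1 : ℝ), 0) : Phase n) := by
      conv_lhs => rw [hv]
      ext <;> simp [Prod.fst_sum, Prod.snd_sum]
    simp only [ContinuousLinearMap.comp_apply, ContinuousLinearMap.inl_apply]
    rw [this, map_sum, _root_.sum_apply, ← this]
    exact Finset.sum_congr rfl fun j _ => by rw [map_smul]; simp [dX]
  · have hv : v = (∑ j, v j • EuclideanSpace.single j (1 : ℝ) : Pos n) := by
      ext i
      simp [Finset.sum_apply, Pi.single_apply]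
    have : ((0, v) : Phase n) = ∑ j, v j • ((0, EuclideanSpace.single j (1 : ℝ)) : Phase n) := by
      conv_lhs => rw [hv]
      ext <;> simp [Prod.fst_sum, Prod.snd_sum]
    simp only [ContinuousLinearMap.comp_apply, ContinuousLinearMap.inr_apply]
    rw [this, map_sum, _root_.sum_apply, ← this]
    exact Finset.sum_congr rfl fun j _ => by rw [map_smul]; simp [dXi]

lemma contDiff_succ_of_partials {f : Phase n → ℂ} {N : ℕ} (hf : Differentiable ℝ f)
    (h1 : ∀ j, ContDiff ℝ N (dX j f)) (h2 : ∀ j, ContDiff ℝ N (dXi j f)) :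
    ContDiff ℝ (N + 1 : ℕ) f := by
  push_cast
  refine contDiff_succ_iff_fderiv.2 ⟨hf, by simp, ?_⟩
  rw [fderiv_phase_eq]
  exact ContDiff.sum fun j _ => ((contDiff_const.smulRight (h1 j))).add
    (contDiff_const.smulRight (h2 j))

/-- A bilinear operation on symbols, differentiable and satisfying the Leibniz rule. -/
structure IsLeibniz (E : (Phase n → ℂ) → (Phase n → ℂ) → Phase n → ℂ) : Prop where
  diff : ∀ ⦃m k a b⦄, a ∈ Symb n m → b ∈ Symb n k → Differentiable ℝ (E a b)
  dX : ∀ ⦃m k a b⦄, a ∈ Symb n m → b ∈ Symb n k → ∀ j,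
    dX j (E a b) = E (dX j a) b + E a (dX j b)
  dXi : ∀ ⦃m k a b⦄, a ∈ Symb n m → b ∈ Symb n k → ∀ j,
    dXi j (E a b) = E (dXi j a) b + E a (dXi j b)

/-- The partial derivatives are sums of values of the same operation on symbols, so
differentiability bootstraps itself. -/
lemma IsLeibniz.contDiff {E : (Phase n → ℂ) → (Phase n → ℂ) → Phase n → ℂ} (hE : IsLeibniz E)
    (ha : a ∈ Symb n m) (hb : b ∈ Symb n k) : ContDiff ℝ ∞ (E a b) := by
  refine contDiff_infty.2 fun N => ?_
  induction N generalizing m k a b with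
  | zero => exact contDiff_zero.2 (hE.diff ha hb).continuous
  | succ N ih =>
    refine contDiff_succ_of_partials (hE.diff ha hb) (fun j => ?_) fun j => ?_
    · rw [hE.dX ha hb]
      exact (ih (Symb.dX ha j) hb).add (ih ha (Symb.dX hb j))
    · rw [hE.dXi ha hb]
      exact (ih (Symb.dXi ha j) hb).add (ih ha (Symb.dXi hb j))

/-- A size bound valid for all symbols of all orders already contains the derivative estimates:
differentiate the arguments, whose orders drop accordingly. It is used for `comp` and for its Taylor
remainders. -/
lemma IsLeibniz.symb {E : (Phase n → ℂ) → (Phase n → ℂ) → Phase n → ℂ} (hE : IsLeibniz E)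
    {δ : ℝ × ℝ} (hbd : ∀ ⦃m k a b⦄, a ∈ Symb n m → b ∈ Symb n k → SymbBound (m + k - δ) (E a b))
    (ha : a ∈ Symb n m) (hb : b ∈ Symb n k) : E a b ∈ Symb n (m + k - δ) := by
  refine Symb.of_bounds (hE.contDiff ha hb) fun N => ?_
  induction N generalizing m k a b with
  | zero => exact hbd ha hb
  | succ N ih =>
    refine ⟨hbd ha hb, fun j => ⟨?_, ?_⟩⟩
    · have h1 := ih (Symb.dX ha j) hb
      have h2 := ih ha (Symb.dX hb j)
      rw [show m - e₁ + k - δ = m + k - δ - e₁ by abel] at h1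
      rw [show m + (k - e₁) - δ = m + k - δ - e₁ by abel] at h2
      rw [hE.dX ha hb]
      exact h1.add (hE.contDiff (Symb.dX ha j) hb) (hE.contDiff ha (Symb.dX hb j)) h2
    · have h1 := ih (Symb.dXi ha j) hb
      have h2 := ih ha (Symb.dXi hb j)
      rw [show m - e₂ + k - δ = m + k - δ - e₂ by abel] at h1
      rw [show m + (k - e₂) - δ = m + k - δ - e₂ by abel] at h2
      rw [hE.dXi ha hb]
      exact h1.add (hE.contDiff (Symb.dXi ha j) hb) (hE.contDiff ha (Symb.dXi hb j)) h2

lemma hasFDerivAt_slice (t : ℝ) (p : Phase n) :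
    HasFDerivAt (fun p : Phase n => ((t, p) : Par n)) (ContinuousLinearMap.inr ℝ ℝ (Phase n)) p :=
  hasFDerivAt_prodMk_right t p

lemma comp_slice_diff (ha : a ∈ Symb n m) (hb : b ∈ Symb n k) {t : ℝ} (ht : |t| < 2)
    (p : Phase n) : HasFDerivAt (fun p => comp a b (t, p))
      ((fderiv ℝ (comp a b) (t, p)).comp (ContinuousLinearMap.inr ℝ ℝ (Phase n))) p :=
  ((comp_diff ha hb (θ := (t, p)) ht).1.hasFDerivAt).comp p (hasFDerivAt_slice t p)

lemma comp_isLeibniz {t : ℝ} (ht : |t| < 2) :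
    IsLeibniz fun (a b : Phase n → ℂ) p => comp a b (t, p) where
  diff _ _ _ _ ha hb p := (comp_slice_diff ha hb ht p).differentiableAt
  dX _ _ a b ha hb j := by
    ext p
    rw [SGCalc.dX, (comp_slice_diff ha hb ht p).fderiv]
    exact (comp_diff ha hb (θ := (t, p)) ht).2 (some (Sum.inl j))
  dXi _ _ a b ha hb j := by
    ext p
    rw [SGCalc.dXi, (comp_slice_diff ha hb ht p).fderiv]
    exact (comp_diff ha hb (θ := (t, p)) ht).2 (some (Sum.inr j))

lemma comp_mem_symb {t : ℝ} (ht : |t| < 2) (ha : a ∈ Symb n m) (hb : b ∈ Symb n k) :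
    (fun p => comp a b (t, p)) ∈ Symb n (m + k) := by
  have := (comp_isLeibniz (n := n) ht).symb (δ := 0) (fun m k a b ha hb => ?_) ha hb
  · simpa using this
  · obtain ⟨C, -, hC⟩ := comp_bound ha hb
    refine ⟨C, fun x ξ => (hC (t, (x, ξ)) ht).trans_eq ?_⟩
    simp only [wt, sub_zero]
    ring

lemma comp_hasDerivAt (ha : a ∈ Symb n m) (hb : b ∈ Symb n k) {t : ℝ} (ht : |t| < 2)
    (p : Phase n) : HasDerivAt (fun t => comp a b (t, p))
      (-I * ∑ j, comp (dXi j a) (dX j b) (t, p)) t := by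
  have h := comp_diff ha hb (θ := (t, p)) ht
  have h1 := (h.1.hasFDerivAt).comp_hasDerivAt t ((hasDerivAt_id t).prodMk (hasDerivAt_const t p))
  have h2 := h.2 none
  simp only [dir, compD] at h2
  rw [← h2]
  exact h1

end SGCalc

/-! ### Quantisation on the Schwartz space -/

namespace SGCalc

open scoped FourierTransform

variable {n : ℕ}

/-! ### Schwartz functions and tame functions -/

lemma pd_schwartz (j : Fin n) (u : 𝓢(Pos n, ℂ)) :
    pd j u = (LineDeriv.lineDerivOp (EuclideanSpace.single j (1 : ℝ)) u : 𝓢(Pos n, ℂ)) := by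
  ext y
  rw [SchwartzMap.lineDerivOp_apply_eq_fderiv]
  rfl

lemma schwartz_tame (u : 𝓢(Pos n, ℂ)) (r : ℝ) : Tame r (u : Pos n → ℂ) := by
  have hb : ∀ u : 𝓢(Pos n, ℂ), FamBound (fun _ : Unit => 1) r fun _ => (u : Pos n → ℂ) := by
    intro u
    obtain ⟨k, hk⟩ := exists_nat_ge (-r)
    refine ⟨2 ^ k * ((Finset.Iic (k, 0)).sup fun m => SchwartzMap.seminorm ℂ m.1 m.2) u,
      fun _ y => ?_⟩
    have h := SchwartzMap.one_add_le_sup_seminorm_apply (𝕜 := ℂ) (m := (k, 0)) le_rfl le_rfl u y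
    rw [norm_iteratedFDeriv_zero] at h
    have h1 : jap y ^ (-r) ≤ (1 + ‖y‖) ^ k := by
      refine (jap_rpow_mono y hk).trans ?_
      rw [Real.rpow_natCast]
      exact pow_le_pow_left₀ (jap_nonneg y) (jap_le_one_add y) k
    have e : jap y ^ (-r) * jap y ^ r = 1 := by rw [← Real.rpow_add (jap_pos y)]; simp
    have hp := jap_rpow_pos y r
    rw [mul_one]
    calc ‖u y‖ = jap y ^ (-r) * ‖u y‖ * jap y ^ r := by linear_combination (-‖u y‖) * e
      _ ≤ (1 + ‖y‖) ^ k * ‖u y‖ * jap y ^ r := by gcongr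
      _ ≤ _ := by gcongr
  refine ⟨fun _ => u.smooth ⊤, fun N => ?_⟩
  induction N generalizing u with
  | zero => exact hb u
  | succ N ih =>
    refine ⟨hb u, fun j => ?_⟩
    simp only [pd_schwartz]
    exact ih _

lemma fderiv_pos_eq (f : Pos n → ℂ) : fderiv ℝ f = fun y =>
    ∑ j, (ContinuousLinearMap.smulRightL ℝ (Pos n) ℂ
      (EuclideanSpace.proj j : Pos n →L[ℝ] ℝ)) (pd j f y) := by
  funext y
  ext v
  have hv : v = (∑ j, v j • EuclideanSpace.single j (1 : ℝ) : Pos n) := by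
    ext i
    simp [Finset.sum_apply, Pi.single_apply]
  conv_lhs => rw [hv]
  rw [map_sum, _root_.sum_apply]
  refine Finset.sum_congr rfl fun j _ => ?_
  rw [map_smul]
  simp [pd]

lemma Tame.iteratedFDeriv_bound {r : ℝ} {f : Pos n → ℂ} (hf : Tame r f) (N : ℕ) :
    ∃ C : ℝ, ∀ y, ‖iteratedFDeriv ℝ N f y‖ ≤ C * jap y ^ r := by
  induction N generalizing f with
  | zero =>
    obtain ⟨C, hC⟩ := hf.bound
    exact ⟨C, fun y => by simpa using hC () y⟩
  | succ N ih =>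
    choose C hC using fun j => ih (hf.pd j)
    refine ⟨∑ j, ‖ContinuousLinearMap.smulRightL ℝ (Pos n) ℂ
      (EuclideanSpace.proj j : Pos n →L[ℝ] ℝ)‖ * C j, fun y => ?_⟩
    have hs := fun j => (hf.pd j).smooth ()
    rw [← norm_iteratedFDeriv_fderiv, fderiv_pos_eq]
    have hN : ((N : ℕ∞) : WithTop ℕ∞) ≤ ∞ := by exact_mod_cast le_top
    have hs' : ∀ j, ContDiff ℝ (N : ℕ∞) fun y => ContinuousLinearMap.smulRightL ℝ (Pos n) ℂ
        (EuclideanSpace.proj j : Pos n →L[ℝ] ℝ) (pd j f y) := fun j =>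
      ((ContinuousLinearMap.smulRightL ℝ (Pos n) ℂ
        (EuclideanSpace.proj j : Pos n →L[ℝ] ℝ)).contDiff.comp (hs j)).of_le hN
    have e := iteratedFDeriv_fun_sum_apply (u := Finset.univ) (x := y) (n := N)
      fun j _ => (hs' j).contDiffAt
    rw [e, Finset.sum_mul]
    refine (norm_sum_le _ _).trans (Finset.sum_le_sum fun j _ => ?_)
    refine (ContinuousLinearMap.norm_iteratedFDeriv_comp_left _ (hs j).contDiffAt hN).trans ?_
    rw [mul_assoc]
    exact mul_le_mul_of_nonneg_left (hC j y) (norm_nonneg _)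

/-- A smooth function all of whose derivatives decay rapidly, as a Schwartz function. -/
noncomputable def toSchwartz (f : Pos n → ℂ) (hf : ∀ r : ℝ, Tame r f) : 𝓢(Pos n, ℂ) where
  toFun := f
  smooth' := (hf 0).smooth ()
  decay' k N := by
    obtain ⟨C, hC⟩ := (hf (-k)).iteratedFDeriv_bound N
    refine ⟨C, fun y => ?_⟩
    have e : jap y ^ k * jap y ^ (-(k : ℝ)) = 1 := by
      rw [← Real.rpow_natCast, ← Real.rpow_add (jap_pos y)]; simp
    calc ‖y‖ ^ k * ‖iteratedFDeriv ℝ N f y‖ ≤ jap y ^ k * (C * jap y ^ (-(k : ℝ))) := by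
          gcongr
          · exact pow_nonneg (jap_nonneg y) k
          · exact norm_le_jap y
          · exact hC y
      _ = C := by linear_combination C * e

/-- A function of `x` as a function on the phase space. -/
def lift (u : Pos n → ℂ) : Phase n → ℂ := fun p => u p.1

lemma dX_lift (j : Fin n) (u : 𝓢(Pos n, ℂ)) : dX j (lift u)
    = lift (LineDeriv.lineDerivOp (EuclideanSpace.single j (1 : ℝ)) u : 𝓢(Pos n, ℂ)) := by
  ext p
  have h := (u.differentiableAt (x := p.1)).hasFDerivAt.comp p (hasFDerivAt_fst (𝕜 := ℝ))
  change fderiv ℝ (u ∘ Prod.fst) p _ = _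
  rw [h.fderiv]
  simp [lift, SchwartzMap.lineDerivOp_apply_eq_fderiv]

lemma dXi_lift (j : Fin n) (u : 𝓢(Pos n, ℂ)) : dXi j (lift u) = lift (0 : 𝓢(Pos n, ℂ)) := by
  ext p
  have h := (u.differentiableAt (x := p.1)).hasFDerivAt.comp p (hasFDerivAt_fst (𝕜 := ℝ))
  change fderiv ℝ (u ∘ Prod.fst) p _ = _
  rw [h.fderiv]
  simp [lift]

/-- A Schwartz function is a symbol of arbitrarily negative order in `x`, so the symbol calculus can
be applied to `Op(a)u` itself. -/
lemma lift_mem (u : 𝓢(Pos n, ℂ)) (k : ℝ × ℝ) : lift u ∈ Symb n (k.1, 0) := by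
  have hb : ∀ (u : 𝓢(Pos n, ℂ)) (k : ℝ), SymbBound (k, 0) (lift u) := by
    intro u k
    obtain ⟨C, hC⟩ := (schwartz_tame u k).bound
    exact ⟨C, fun x ξ => by simpa [lift] using hC () x⟩
  refine Symb.of_bounds (((u.smooth ⊤).comp contDiff_fst)) fun N => ?_
  obtain ⟨k, -⟩ := k
  induction N generalizing u k with
  | zero => exact hb u k
  | succ N ih =>
    refine ⟨hb u k, fun j => ⟨?_, ?_⟩⟩
    · rw [dX_lift]
      have := ih (LineDeriv.lineDerivOp (EuclideanSpace.single j (1 : ℝ)) u) (k - 1)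
      simpa using this
    · rw [dXi_lift]
      exact Symb.bounds ((Symb n _).zero_mem) N

variable {m k : ℝ × ℝ} {a b : Phase n → ℂ}

/-- At `t = 1` and fixed `p`, Peetre's inequality with the roles of `x` and `y` exchanged gives the
exponent `k.1` itself instead of `|k.1|`. Decay of `b` in `x` is thereby preserved. -/
lemma Symb.tame_aff_one (hb : b ∈ Symb n k) (p : Phase n) :
    Tame k.1 fun y => b (aff y (1, p)) := by
  have hbd : ∀ {b : Phase n → ℂ}, b ∈ Symb n k →
      FamBound (fun _ : Unit => 1) k.1 fun _ y => b (aff y (1, p)) := by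
    intro b hb
    obtain ⟨C, hC0, hC⟩ := (Symb.bound hb).exists_nonneg
    refine ⟨C * ((2 + 1) ^ |k.1| * jap p.1 ^ |k.1|) * jap p.2 ^ k.2, fun _ y => ?_⟩
    have h := peetre (T := 1) (t := 1) (by simp) k.1 y p.1
    have e : aff y ((1, p) : Par n) = (p.1 + y, p.2) := by simp
    rw [one_smul, add_comm] at h
    have := (jap_rpow_pos p.2 k.2).le
    beta_reduce
    rw [e, mul_one]
    calc ‖b (p.1 + y, p.2)‖ ≤ C * jap (p.1 + y) ^ k.1 * jap p.2 ^ k.2 := hC _ _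
      _ ≤ C * ((2 + 1) ^ |k.1| * (jap y ^ k.1 * jap p.1 ^ |k.1|)) * jap p.2 ^ k.2 := by gcongr
      _ = _ := by ring
  refine ⟨fun _ => comp_aff_contDiff (Symb.smooth hb) _, fun N => ?_⟩
  induction N generalizing b with
  | zero => exact hbd hb
  | succ N ih =>
    refine ⟨hbd hb, fun j => ?_⟩
    simp only [pd_comp_aff j (Symb.smooth hb), Complex.ofReal_one, one_smul]
    exact ih (Symb.le_self_sub_e₁ (Symb.dX hb j))

/-! ### Pseudo-differential operators -/

/-- The exponential `e^{2πis}`. -/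
noncomputable def ex (s : ℝ) : ℂ := cexp (((2 * Real.pi * s : ℝ) : ℂ) * I)

lemma norm_ex (s : ℝ) : ‖ex s‖ = 1 := Complex.norm_exp_ofReal_mul_I _

lemma ex_add (s t : ℝ) : ex (s + t) = ex s * ex t := by
  rw [ex, ex, ex, ← Complex.exp_add]
  congr 1
  push_cast
  ring

lemma ex_continuous : Continuous ex := by
  unfold ex
  fun_prop

lemma fourier_eq_ex (f : Pos n → ℂ) (η : Pos n) : 𝓕 f η = ∫ y, ex (-inner ℝ y η) * f y := by
  rw [Real.fourier_eq']
  refine integral_congr_ae (Eventually.of_forall fun y => ?_)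
  simp only [ex, smul_eq_mul]
  congr 3
  push_cast
  ring

lemma fourier_translate (f : Pos n → ℂ) (x η : Pos n) :
    𝓕 (fun y => f (x + y)) η = ex (inner ℝ x η) * 𝓕 f η := by
  rw [fourier_eq_ex, fourier_eq_ex, ← integral_const_mul,
    ← integral_add_left_eq_self (fun y => ex (inner ℝ x η) * (ex (-inner ℝ y η) * f y)) x]
  refine integral_congr_ae (Eventually.of_forall fun y => ?_)
  simp only [← mul_assoc, ← ex_add, inner_add_left]
  congr 2
  ring

/-- The substitution `ξ = 2πη` passes to the normalisation of the Fourier transform used here; its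
Jacobian cancels `(2π)^{-n}`. -/
lemma opApply_eq (a : Phase n → ℂ) (u : 𝓢(Pos n, ℂ)) (x : Pos n) :
    opApply a u x = ∫ η, ex (inner ℝ x η) * a (x, (2 * Real.pi) • η) * 𝓕 (u : Pos n → ℂ) η := by
  have hπ : (2 * Real.pi : ℝ) ≠ 0 := by positivity
  have h := Measure.integral_comp_smul (volume : Measure (Pos n))
    (fun η => ex (inner ℝ x η) * a (x, (2 * Real.pi) • η) * 𝓕 (u : Pos n → ℂ) η) (2 * Real.pi)⁻¹
  rw [finrank_euclideanSpace_fin, inv_pow, inv_inv, abs_of_pos (by positivity)] at h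
  have e : ∀ ξ : Pos n, ∫ y : Pos n, cexp (I * ((inner ℝ (x - y) ξ : ℝ) : ℂ)) * a (x, ξ) * u y
      = ex (inner ℝ x ((2 * Real.pi)⁻¹ • ξ)) * a (x, (2 * Real.pi) • (2 * Real.pi)⁻¹ • ξ) *
        𝓕 (u : Pos n → ℂ) ((2 * Real.pi)⁻¹ • ξ) := by
    intro ξ
    rw [inner_integral, smul_inv_smul₀ hπ, SchwartzMap.fourier_coe, ex, inner_smul_right,
      mul_inv_cancel_left₀ hπ, mul_comm I]
  rw [opApply, integral_congr_ae (Eventually.of_forall e), h, Complex.real_smul, ← mul_assoc]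
  push_cast
  rw [inv_pow, inv_mul_cancel₀ (by simp [Real.pi_ne_zero]), one_mul]

lemma aff_one (x : Pos n) (y : Pos n) : aff y ((1, (x, 0)) : Par n) = (x + y, 0) := by
  simp

lemma cot_zero (x : Pos n) (η : Pos n) : cot ((1, (x, 0)) : Par n) η = (x, (2 * Real.pi) • η) := by
  simp [cot]

lemma opApply_eq_pairing (a : Phase n → ℂ) (u : 𝓢(Pos n, ℂ)) (x : Pos n) :
    opApply a u x = ∫ η, a (cot (1, (x, 0)) η) * 𝓕 (fun y => u (x + y)) η := by
  rw [opApply_eq]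
  refine integral_congr_ae (Eventually.of_forall fun η => ?_)
  simp only [fourier_translate, cot_zero]
  ring

lemma tame_translate (u : 𝓢(Pos n, ℂ)) (r : ℝ) (x : Pos n) : Tame r fun y => u (x + y) := by
  simpa [lift] using Symb.tame_aff_one (lift_mem u (r, 0)) (x, 0)

lemma japC_zero : (japC 0 : Pos n → ℂ) = 1 := by
  ext y
  simp [japC]

/-- An operator applied to `u` is a composition with a symbol independent of `ξ`. Because `u` is
rapidly decreasing, no regularisation is needed and `L = 0` is admissible. -/
lemma opApply_eq_comp (ha : a ∈ Symb n m) (u : 𝓢(Pos n, ℂ)) (x : Pos n) :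
    opApply a u x = comp a (lift u) (1, (x, 0)) := by
  have ht : Tame (-n - 1) fun y => lift u (aff y ((1, (x, 0)) : Par n)) :=
    Symb.tame_aff_one (lift_mem u (-n - 1, 0)) (x, 0)
  rw [comp_eq_of_tame ha ht (L := 0) (by simp), opApply_eq_pairing, compL, pairC]
  simp [innerF, japC_zero, lift]

/-- Regard `u` as a symbol of order `(r - m.1, 0)`: the composition has order `r` in `x`, and
restricting it to `ξ = 0` yields the claim. Since `r` is arbitrary, `Op(a)u` is Schwartz. -/
lemma op_tame (ha : a ∈ Symb n m) (u : 𝓢(Pos n, ℂ)) (r : ℝ) : Tame r (opApply a u) := by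
  have h1 := comp_mem_symb (n := n) (t := 1) (by norm_num) ha (lift_mem u (r - m.1, 0))
  have h2 := Symb.tame_aff_one h1 (0, 0)
  have e : opApply a u = fun y => comp a (lift u) (1, aff y (1, (0, 0))) := by
    ext y
    rw [opApply_eq_comp ha]
    simp
  rw [e]
  simpa using h2

lemma op_pairing_integrable (ha : a ∈ Symb n m) (u : 𝓢(Pos n, ℂ)) (x : Pos n) :
    Integrable fun η => a (cot (1, (x, 0)) η) * 𝓕 (fun y => u (x + y)) η :=
  integrable_pairing ((tame_cot ha (1, (x, 0))).continuous ()) (tame_cot ha _).bound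
    (tame_translate u (-n - 1) x) (by linarith)

lemma opApply_add_right (ha : a ∈ Symb n m) (u v : 𝓢(Pos n, ℂ)) (x : Pos n) :
    opApply a (u + v) x = opApply a u x + opApply a v x := by
  simp only [opApply_eq_pairing]
  rw [← integral_add (op_pairing_integrable ha u x) (op_pairing_integrable ha v x)]
  have h := fourier_add ((tame_translate u (-n - 1) x).integrable (by linarith) ())
    ((tame_translate v (-n - 1) x).integrable (by linarith) ())
  refine integral_congr_ae (Eventually.of_forall fun η => ?_)
  simp only [← mul_add]
  congr 1
  exact congrFun h η

lemma opApply_smul_right (a : Phase n → ℂ) (z : ℂ) (u : 𝓢(Pos n, ℂ)) (x : Pos n) :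
    opApply a (z • u) x = z * opApply a u x := by
  simp only [opApply_eq_pairing, ← integral_const_mul]
  have h := fourier_const_smul (fun y => u (x + y)) z
  refine integral_congr_ae (Eventually.of_forall fun η => ?_)
  simp only [mul_left_comm z]
  congr 1
  exact congrFun h η

/-- The operator `Op(a)` on the Schwartz space. -/
noncomputable def opS (a : Phase n → ℂ) (ha : a ∈ Symb n m) : Module.End ℂ 𝓢(Pos n, ℂ) where
  toFun u := toSchwartz (opApply a u) (op_tame ha u)
  map_add' u v := by
    ext x
    exact opApply_add_right ha u v x
  map_smul' z u := by
    ext x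
    exact opApply_smul_right a z u x

lemma opS_isOp (ha : a ∈ Symb n m) : IsOp a (opS a ha) := fun _ _ => rfl

lemma IsOp.unique {A B : Module.End ℂ 𝓢(Pos n, ℂ)} (hA : IsOp a A) (hB : IsOp a B) : A = B := by
  ext u x
  rw [hA, hB]

/-! ### Injectivity of the quantisation -/

/-- For fixed `x`, the function `e^{2πi x·η} a(x, 2πη)` integrates to zero against every Fourier
transform of a Schwartz function, in particular against every bump function. It is continuous and
the exponential never vanishes. -/
lemma eq_zero_of_opApply (ha : a ∈ Symb n m) (h : ∀ u x, opApply a u x = 0) : a = 0 := by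
  have hπ : (2 * Real.pi : ℝ) ≠ 0 := by positivity
  ext ⟨x, ξ⟩
  have hc : Continuous fun η : Pos n => ex (inner ℝ x η) * a (x, (2 * Real.pi) • η) := by
    have := (Symb.smooth ha).continuous
    have := ex_continuous
    fun_prop
  have h0 := ae_eq_zero_of_integral_contDiff_smul_eq_zero (μ := volume)
    hc.locallyIntegrable fun g hg hs => by
      have hg' : ContDiff ℝ ∞ fun η => (g η : ℂ) := Complex.ofRealCLM.contDiff.comp hg
      have hs' : HasCompactSupport fun η => (g η : ℂ) := hs.comp_left Complex.ofReal_zero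
      let φ : 𝓢(Pos n, ℂ) := hs'.toSchwartzMap hg'
      have h1 := h (𝓕⁻ φ) x
      rw [opApply_eq, ← SchwartzMap.fourier_coe, FourierTransform.fourier_fourierInv_eq] at h1
      rw [← h1]
      refine integral_congr_ae (Eventually.of_forall fun η => ?_)
      change (g η) • _ = _ * (g η : ℂ)
      rw [Complex.real_smul, mul_comm]
  have h1 := congrFun ((hc.ae_eq_iff_eq volume continuous_const).1 h0) ((2 * Real.pi)⁻¹ • ξ)
  simp only [smul_inv_smul₀ hπ] at h1
  rcases mul_eq_zero.1 h1 with h2 | h2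
  · have := norm_ex (inner ℝ x ((2 * Real.pi)⁻¹ • ξ))
    rw [h2] at this
    simp at this
  · exact h2

end SGCalc

/-! ### The interpolation at `t = 1` and at `t = 0` -/

namespace SGCalc

open scoped FourierTransform

variable {n : ℕ}

variable {m k : ℝ × ℝ} {a b : Phase n → ℂ}

/-! ### Composition of pseudo-differential operators -/

/-- The symbol of the composition of `Op(a)` and `Op(b)`. -/
noncomputable def comp₁ (a b : Phase n → ℂ) : Phase n → ℂ := fun p => comp a b (1, p)

lemma comp₁_mem (ha : a ∈ Symb n m) (hb : b ∈ Symb n k) : comp₁ a b ∈ Symb n (m + k) :=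
  comp_mem_symb (by norm_num) ha hb

/-- The parameter `(1, (x, 2πζ))`. -/
noncomputable def par (x ζ : Pos n) : Par n := (1, (x, (2 * Real.pi) • ζ))

lemma wt_par_le (k : ℝ × ℝ) (x : Pos n) :
    ∃ C : ℝ, 0 ≤ C ∧ ∀ ζ, wt k (par x ζ) ≤ C * jap ζ ^ |k.2| := by
  have hp := (jap_rpow_pos x k.1).le
  have h0 := (jap_rpow_pos (0 : Pos n) k.2).le
  refine ⟨jap x ^ k.1 * ((2 + 2 * Real.pi) ^ |k.2| * jap (0 : Pos n) ^ k.2), by positivity,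
    fun ζ => ?_⟩
  have h := peetre (T := 2 * Real.pi) (t := 2 * Real.pi) (abs_of_nonneg (by positivity)).le k.2 0 ζ
  rw [zero_add] at h
  calc wt k (par x ζ) = jap x ^ k.1 * jap ((2 * Real.pi) • ζ) ^ k.2 := rfl
    _ ≤ jap x ^ k.1 * ((2 + 2 * Real.pi) ^ |k.2| * (jap 0 ^ k.2 * jap ζ ^ |k.2|)) := by gcongr
    _ = _ := by ring

lemma schwartz_fourier_decay (u : 𝓢(Pos n, ℂ)) (s : ℝ) :
    ∃ C : ℝ, 0 ≤ C ∧ ∀ ζ, ‖𝓕 (u : Pos n → ℂ) ζ‖ ≤ C * jap ζ ^ s := by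
  obtain ⟨C, hC0, hC⟩ := Fam.fourier_decay (fun _ => zero_le_one) (schwartz_tame u (-n - 1))
    (by linarith) s
  exact ⟨C, hC0, fun ζ => by simpa using hC () ζ⟩

lemma schwartz_fourier_continuous (u : 𝓢(Pos n, ℂ)) : Continuous (𝓕 (u : Pos n → ℂ)) :=
  (schwartz_tame u (-n - 1)).continuous_fourier (by linarith) ()

lemma par_slab (x ζ : Pos n) : |(par x ζ).1| < 2 := by simp [par]

/-- The Fourier transform of `h(y) (Op(b)u)(x + y)`. -/
lemma fourier_mul_op {h : Pos n → ℂ} {r : ℝ} (hh : Tame r h) (hb : b ∈ Symb n k)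
    (hr : r + |k.1| < -n) (u : 𝓢(Pos n, ℂ)) (x η : Pos n) :
    ∫ ζ, ex (inner ℝ x ζ) * 𝓕 (u : Pos n → ℂ) ζ * innerF h b (par x ζ) (η - ζ)
      = 𝓕 (fun y => h y * opApply b u (x + y)) η := by
  have hbc := (Symb.smooth hb).continuous
  have hhc := hh.continuous ()
  have huc := schwartz_fourier_continuous u
  have hec := ex_continuous
  obtain ⟨C, hC0, hC⟩ := (fam_mul_aff hh hb).bound.exists_nonneg
    fun θ : Slab n => (wt_pos k θ.1).le
  obtain ⟨D, hD0, hD⟩ := wt_par_le k x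
  obtain ⟨E, hE0, hE⟩ := schwartz_fourier_decay u (-n - 1 - |k.2|)
  -- The double integrand obtained by writing `(Op(b)u)(x + y)` as an integral over frequencies `ζ`;
  -- the identity is Fubini for it.
  let M : Pos n → Pos n → ℂ := fun ζ y => ex (inner ℝ x ζ) * 𝓕 (u : Pos n → ℂ) ζ *
    (ex (-inner ℝ y (η - ζ)) * (h y * b (aff y (par x ζ))))
  have hM : Integrable (Function.uncurry M) ((volume : Measure (Pos n)).prod volume) := by
    have h1 : Integrable fun ζ : Pos n => (E * C * D) * jap ζ ^ (-n - 1 : ℝ) :=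
      (integrable_jap_rpow (by linarith)).const_mul _
    refine (h1.mul_prod (integrable_jap_rpow hr)).mono' ?_ (Eventually.of_forall ?_)
    · refine Continuous.aestronglyMeasurable ?_
      simp only [Function.uncurry_def, M, aff_apply, par]
      fun_prop
    · rintro ⟨ζ, y⟩
      simp only [Function.uncurry_apply_pair, M, norm_mul, norm_ex, one_mul]
      have h2 := hC ⟨par x ζ, par_slab x ζ⟩ y
      rw [norm_mul] at h2
      have h3 := (jap_rpow_pos y (r + |k.1|)).le
      have h4 := (jap_rpow_pos ζ (-n - 1 - |k.2|)).le
      calc ‖𝓕 (u : Pos n → ℂ) ζ‖ * (‖h y‖ * ‖b (aff y (par x ζ))‖)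
          ≤ (E * jap ζ ^ (-n - 1 - |k.2|)) *
            (C * (D * jap ζ ^ |k.2|) * jap y ^ (r + |k.1|)) := by
            refine mul_le_mul (hE ζ) (h2.trans ?_) (by positivity) (by positivity)
            gcongr
            exact hD ζ
        _ = (E * C * D) * (jap ζ ^ (-n - 1 - |k.2|) * jap ζ ^ |k.2|) * jap y ^ (r + |k.1|) := by
            ring
        _ = _ := by rw [← Real.rpow_add (jap_pos ζ), sub_add_cancel]
  have hl : ∀ ζ, ex (inner ℝ x ζ) * 𝓕 (u : Pos n → ℂ) ζ * innerF h b (par x ζ) (η - ζ)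
      = ∫ y, M ζ y := fun ζ => by
    rw [innerF, fourier_eq_ex (fun y => h y * b (aff y (par x ζ))), ← integral_const_mul]
  have hrr : ∀ y, ex (-inner ℝ y η) * (h y * opApply b u (x + y)) = ∫ ζ, M ζ y := fun y => by
    rw [opApply_eq, ← mul_assoc, ← integral_const_mul]
    refine integral_congr_ae (Eventually.of_forall fun ζ => ?_)
    have e : ex (inner ℝ x ζ) * ex (-inner ℝ y (η - ζ)) = ex (-inner ℝ y η) * ex (inner ℝ (x + y) ζ) := by
      rw [← ex_add, ← ex_add]
      congr 1
      rw [inner_sub_right, inner_add_left]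
      ring
    simp only [M, aff_apply, par, one_smul]
    linear_combination (-(𝓕 (u : Pos n → ℂ) ζ * h y * b (x + y, (2 * Real.pi) • ζ))) * e
  rw [fourier_eq_ex, integral_congr_ae (Eventually.of_forall hl),
    integral_congr_ae (Eventually.of_forall hrr)]
  exact integral_integral_swap hM

/-- Both sides are regularised with the same `L` and become iterated integrals of one kernel `K ζ η`
in opposite orders. On the left `Op(b)u` enters through `fourier_mul_op`; on the right the frequency
is translated by `ζ`. -/
lemma opApply_comp (ha : a ∈ Symb n m) (hb : b ∈ Symb n k) (u : 𝓢(Pos n, ℂ)) (x : Pos n) :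
    opApply a (opS b hb u) x = opApply (comp₁ a b) u x := by
  obtain ⟨L, hL⟩ := exists_order (n := n) |k.1|
  have hh := tame_japC (n := n) (-2 * (L : ℝ))
  have hr : -2 * (L : ℝ) + |k.1| < -n := by linarith
  have haL := Symb.bess_iterate ha L
  have hac := (Symb.smooth haL).continuous
  have hbc := (Symb.smooth hb).continuous
  have hhc := hh.continuous ()
  have huc := schwartz_fourier_continuous u
  have hec := ex_continuous
  obtain ⟨A, hA0, hA⟩ := (Symb.fam_cot haL).bound.exists_nonneg
    fun θ : Slab n => (wt_pos m θ.1).le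
  -- Decay in `η - ζ` chosen so that, after Peetre's inequality and against the growth `|m.2|` of
  -- `a`, an integrable power of `⟨η⟩` is left.
  set s : ℝ := -n - 1 - |m.2| with hs
  obtain ⟨C, hC0, hC⟩ := (fam_mul_aff hh hb).fourier_decay
    (fun θ : Slab n => (wt_pos k θ.1).le) hr s
  obtain ⟨D, hD0, hD⟩ := wt_par_le k x
  -- The term `|k.2|` absorbs the weight of `b` at frequency `ζ`, and `|s|` the loss in Peetre's
  -- inequality.
  obtain ⟨E, hE0, hE⟩ := schwartz_fourier_decay u (-n - 1 - |k.2| - |s|)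
  let K : Pos n → Pos n → ℂ := fun ζ η => ex (inner ℝ x ζ) * 𝓕 (u : Pos n → ℂ) ζ *
    ((bess^[L] a) (cot (1, (x, 0)) η) * innerF (japC (-2 * L)) b (par x ζ) (η - ζ))
  have hK : Integrable (Function.uncurry K) ((volume : Measure (Pos n)).prod volume) := by
    have h1 : Integrable fun ζ : Pos n =>
        (E * A * wt m (1, (x, (0 : Pos n))) * C * D * (2 + 1) ^ |s|) * jap ζ ^ (-n - 1 : ℝ) :=
      (integrable_jap_rpow (by linarith)).const_mul _
    have h2 : Integrable fun η : Pos n => jap η ^ (-n - 1 : ℝ) := integrable_jap_rpow (by linarith)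
    refine (h1.mul_prod h2).mono' ?_ (Eventually.of_forall ?_)
    · have hi : StronglyMeasurable fun z : Pos n × Pos n =>
          innerF (japC (-2 * L)) b (par x z.1) (z.2 - z.1) := by
        simp only [innerF, fourier_eq_ex]
        refine StronglyMeasurable.integral_prod_right' (f := fun z : (Pos n × Pos n) × Pos n =>
          ex (-inner ℝ z.2 (z.1.2 - z.1.1)) * (japC (-2 * L) z.2 * b (aff z.2 (par x z.1.1)))) ?_
        refine Continuous.stronglyMeasurable ?_
        simp only [aff_apply, par]
        fun_prop
      have hc1 : Continuous fun z : Pos n × Pos n =>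
          ex (inner ℝ x z.1) * 𝓕 (u : Pos n → ℂ) z.1 := by fun_prop
      have hc2 : Continuous fun z : Pos n × Pos n => (bess^[L] a) (cot (1, (x, 0)) z.2) := by
        simp only [cot]
        fun_prop
      exact (hc1.stronglyMeasurable.mul (hc2.stronglyMeasurable.mul hi)).aestronglyMeasurable
    · rintro ⟨ζ, η⟩
      simp only [Function.uncurry_apply_pair, K, norm_mul, norm_ex, one_mul]
      have h3 := hA ⟨(1, (x, 0)), by simp⟩ η
      have h4 := hC ⟨par x ζ, par_slab x ζ⟩ (η - ζ)
      have h5 := peetre (T := 1) (t := -1) (by simp) s η ζ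
      rw [neg_one_smul, ← sub_eq_add_neg] at h5
      have p1 := (jap_rpow_pos ζ (-n - 1 - |k.2| - |s|)).le
      have p2 := (jap_rpow_pos η |m.2|).le
      have p3 := (wt_pos m ((1, (x, (0 : Pos n))) : Par n)).le
      have p4 := (jap_rpow_pos ζ |k.2|).le
      have p5 := (jap_rpow_pos (η - ζ) s).le
      calc ‖𝓕 (u : Pos n → ℂ) ζ‖ * (‖(bess^[L] a) (cot (1, (x, 0)) η)‖ *
            ‖innerF (japC (-2 * L)) b (par x ζ) (η - ζ)‖)
          ≤ (E * jap ζ ^ (-n - 1 - |k.2| - |s|)) * ((A * wt m (1, (x, 0)) * jap η ^ |m.2|) *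
            (C * (D * jap ζ ^ |k.2|) * ((2 + 1) ^ |s| * (jap η ^ s * jap ζ ^ |s|)))) := by
            refine mul_le_mul (hE ζ) (mul_le_mul h3 (h4.trans ?_) (norm_nonneg _) (by positivity))
              (by positivity) (by positivity)
            gcongr
            exact hD ζ
        _ = (E * A * wt m (1, (x, 0)) * C * D * (2 + 1) ^ |s|) *
            (jap ζ ^ (-n - 1 - |k.2| - |s|) * jap ζ ^ |k.2| * jap ζ ^ |s|) *
            (jap η ^ |m.2| * jap η ^ s) := by ring
        _ = _ := by
            rw [← Real.rpow_add (jap_pos ζ), ← Real.rpow_add (jap_pos ζ),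
              ← Real.rpow_add (jap_pos η),
              show -(n : ℝ) - 1 - |k.2| - |s| + |k.2| + |s| = -n - 1 by ring,
              show |m.2| + s = -(n : ℝ) - 1 by rw [hs]; ring]
  have hl : ∀ ζ, ex (inner ℝ x ζ) * comp₁ a b (x, (2 * Real.pi) • ζ) * 𝓕 (u : Pos n → ℂ) ζ
      = ∫ η, K ζ η := fun ζ => by
    have e1 : comp₁ a b (x, (2 * Real.pi) • ζ) = compL L a b (par x ζ) :=
      comp_eq ha hb (par_slab x ζ) hL
    -- Replacing `η` by `η - ζ` makes the argument of `a` equal to `(x, 2πη)`, independent of `ζ`.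
    rw [e1, compL, pairC, ← integral_sub_right_eq_self _ ζ, mul_right_comm, ← integral_const_mul]
    refine integral_congr_ae (Eventually.of_forall fun η => ?_)
    have e2 : cot (par x ζ) (η - ζ) = cot (1, (x, 0)) η := by simp [cot, par, smul_sub]
    simp only [K, e2]
  have hrr : ∀ η, ∫ ζ, K ζ η = (bess^[L] a) (cot (1, (x, 0)) η) *
      𝓕 (fun y => japC (-2 * L) y * opApply b u (x + y)) η := fun η => by
    rw [← fourier_mul_op hh hb hr u x η, ← integral_const_mul]
    refine integral_congr_ae (Eventually.of_forall fun ζ => ?_)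
    simp only [K]
    ring
  have ht : Tame (-n - 1) fun y => lift (opS b hb u) (aff y ((1, (x, 0)) : Par n)) :=
    Symb.tame_aff_one (lift_mem _ (-n - 1, 0)) (x, 0)
  have hL0 : (0 : ℝ) ≤ L := L.cast_nonneg
  rw [opApply_eq_comp ha, comp_eq_of_tame ha ht (L := L) (by linarith), opApply_eq,
    integral_congr_ae (Eventually.of_forall hl), integral_integral_swap hK,
    integral_congr_ae (Eventually.of_forall hrr), compL, pairC]
  refine integral_congr_ae (Eventually.of_forall fun η => ?_)
  simp only [innerF, aff_one]
  rfl

lemma opApply_one (u : 𝓢(Pos n, ℂ)) (x : Pos n) : opApply 1 u x = u x := by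
  have h := FourierTransform.fourierInv_fourier_eq (E := 𝓢(Pos n, ℂ)) (F := 𝓢(Pos n, ℂ)) u
  rw [← DFunLike.congr_fun h x, SchwartzMap.fourierInv_coe, Real.fourierInv_eq', opApply_eq]
  refine integral_congr_ae (Eventually.of_forall fun η => ?_)
  simp only [Pi.one_apply, mul_one, smul_eq_mul, SchwartzMap.fourier_coe, ex, real_inner_comm]

/-- `Op(1)` is the identity by Fourier inversion, and quantisation is injective. -/
lemma comp₁_one (ha : a ∈ Symb n m) : comp₁ a 1 = a := by
  have h1 : comp₁ a 1 ∈ Symb n m := by simpa using comp₁_mem ha Symb.one_mem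
  have h2 : comp₁ a 1 + (-1 : ℂ) • a = 0 := by
    refine eq_zero_of_opApply ((Symb n m).add_mem h1 ((Symb n m).smul_mem _ ha)) fun u x => ?_
    have h3 : opS 1 Symb.one_mem u = u := by
      ext y
      exact opApply_one u y
    rw [opApply_add h1 ((Symb n m).smul_mem _ ha), opApply_smul,
      ← opApply_comp ha Symb.one_mem, h3]
    ring
  rw [neg_one_smul] at h2
  exact add_neg_eq_zero.1 h2

/-- At `t = 0` the second symbol is frozen at `p`, so `b p` factors out. What remains is the
integral for the constant symbol `1`, which does not depend on `t` and was evaluated at `t = 1` by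
`comp₁_one`. No oscillatory integral is computed by hand. -/
lemma comp_zero (ha : a ∈ Symb n m) (hb : b ∈ Symb n k) (p : Phase n) :
    comp a b (0, p) = a p * b p := by
  obtain ⟨L, hL⟩ := exists_order (n := n) |k.1|
  have hL' : |(0 : ℝ × ℝ).1| - 2 * (L : ℝ) < -n := by
    have := abs_nonneg k.1
    simp only [Prod.fst_zero, abs_zero]
    linarith
  have h1 : comp a 1 (1, p) = a p := congrFun (comp₁_one ha) p
  rw [comp_eq ha Symb.one_mem (by simp) hL'] at h1
  rw [comp_eq ha hb (by simp) hL, ← h1, compL, compL, pairC, pairC, ← integral_mul_const]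
  refine integral_congr_ae (Eventually.of_forall fun η => ?_)
  have e : (fun y => japC (-2 * L) y * b (aff y ((0, p) : Par n)))
      = b p • fun y => japC (-2 * L) y * (1 : Phase n → ℂ) (aff y ((1, p) : Par n)) := by
    ext y
    simp [mul_comm]
  simp only [innerF, e, fourier_const_smul, Pi.smul_apply, smul_eq_mul]
  have : cot ((0, p) : Par n) η = cot (1, p) η := rfl
  rw [this]
  ring

end SGCalc

/-! ### Asymptotics of compositions, commutators and the isomorphism -/

namespace SGCalc

variable {n : ℕ}

variable {m k : ℝ × ℝ} {a b : Phase n → ℂ}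

/-! ### The asymptotic expansion of the composition -/

/-- The terms `(-i)^l ∑ ∂_ξ^α a ∂_x^α b` of the expansion of the composition. -/
noncomputable def term : ℕ → (Phase n → ℂ) → (Phase n → ℂ) → Phase n → ℂ
  | 0, a, b => a * b
  | l + 1, a, b => (-I) • ∑ j, term l (dXi j a) (dX j b)

lemma term_mem {F : OrderFamily n} (hF : MulMaps F F F) (hd : AllDerivMaps F) (ha : a ∈ F m)
    (hb : b ∈ F k) (l : ℕ) : term l a b ∈ F (m + k - (l : ℝ) • oneOne) := by
  induction l generalizing m k a b with
  | zero => simpa [term] using hF ha hb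
  | succ l ih =>
    refine Submodule.smul_mem _ _ (Submodule.sum_mem _ fun j _ => ?_)
    have h := ih ((hd j).2 ha) ((hd j).1 hb)
    have e : m - e₂ + (k - e₁) - (l : ℝ) • oneOne = m + k - ((l + 1 : ℕ) : ℝ) • oneOne := by
      ext <;> simp <;> ring
    rwa [e] at h

lemma term_contDiff (ha : ContDiff ℝ ∞ a) (hb : ContDiff ℝ ∞ b) (l : ℕ) :
    ContDiff ℝ ∞ (term l a b) := by
  induction l generalizing a b with
  | zero => exact ha.mul hb
  | succ l ih =>
    have h := smooth_sum (Finset.univ : Finset (Fin n)) fun j =>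
      ih (dXi_contDiff j ha) (dX_contDiff j hb)
    exact contDiff_const.smul h

lemma dV_term (v : Phase n) (ha : ContDiff ℝ ∞ a) (hb : ContDiff ℝ ∞ b) (l : ℕ) :
    dV v (term l a b) = term l (dV v a) b + term l a (dV v b) := by
  induction l generalizing a b with
  | zero => exact dV_mul v ha hb
  | succ l ih =>
    have h1 := fun j => term_contDiff (dXi_contDiff j ha) (dX_contDiff j hb) l
    simp only [term]
    rw [dV_smul v _ (smooth_sum _ h1), dV_sum _ _ h1, ← smul_add, ← Finset.sum_add_distrib]
    congr 1
    refine Finset.sum_congr rfl fun j _ => ?_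
    rw [ih (dXi_contDiff j ha) (dX_contDiff j hb)]
    simp only [dXi_eq_dV, dX_eq_dV]
    rw [dV_comm v _ ha, dV_comm v _ hb]

/-- The partial sums of the Taylor expansion of `comp` in `t`. -/
noncomputable def taylor (N : ℕ) (t : ℝ) (a b : Phase n → ℂ) : Phase n → ℂ :=
  ∑ l ∈ Finset.range N, ((t ^ l / l.factorial : ℝ) : ℂ) • term l a b

/-- The remainders of the Taylor expansion of `comp` in `t`. -/
noncomputable def rem (N : ℕ) (t : ℝ) (a b : Phase n → ℂ) : Phase n → ℂ :=
  (fun p => comp a b (t, p)) - taylor N t a b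

lemma taylor_term_contDiff (ha : ContDiff ℝ ∞ a) (hb : ContDiff ℝ ∞ b) (t : ℝ) (l : ℕ) :
    ContDiff ℝ ∞ (((t ^ l / l.factorial : ℝ) : ℂ) • term l a b) :=
  contDiff_const.smul (term_contDiff ha hb l)

lemma taylor_contDiff (ha : ContDiff ℝ ∞ a) (hb : ContDiff ℝ ∞ b) (N : ℕ) (t : ℝ) :
    ContDiff ℝ ∞ (taylor N t a b) := smooth_sum _ (taylor_term_contDiff ha hb t)

lemma dV_taylor (v : Phase n) (ha : ContDiff ℝ ∞ a) (hb : ContDiff ℝ ∞ b) (N : ℕ) (t : ℝ) :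
    dV v (taylor N t a b) = taylor N t (dV v a) b + taylor N t a (dV v b) := by
  rw [taylor, dV_sum _ _ (taylor_term_contDiff ha hb t), taylor, taylor, ← Finset.sum_add_distrib]
  refine Finset.sum_congr rfl fun l _ => ?_
  rw [dV_smul v _ (term_contDiff ha hb l), dV_term v ha hb, smul_add]

lemma comp_contDiff {t : ℝ} (ht : |t| < 2) (ha : a ∈ Symb n m) (hb : b ∈ Symb n k) :
    ContDiff ℝ ∞ fun p => comp a b (t, p) := (comp_isLeibniz ht).contDiff ha hb

lemma rem_isLeibniz (N : ℕ) {t : ℝ} (ht : |t| < 2) : IsLeibniz (n := n) (rem N t) where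
  diff _ _ _ _ ha hb := ((comp_contDiff ht ha hb).sub
    (taylor_contDiff (Symb.smooth ha) (Symb.smooth hb) N t)).differentiable (by simp)
  dX _ _ a b ha hb j := by
    have h := (comp_isLeibniz (n := n) ht).dX ha hb j
    have h' := dV_taylor (EuclideanSpace.single j 1, 0) (Symb.smooth ha) (Symb.smooth hb) N t
    rw [dX_eq_dV] at h ⊢
    rw [rem, dV_sub _ (comp_contDiff ht ha hb)
      (taylor_contDiff (Symb.smooth ha) (Symb.smooth hb) N t), h, h', rem, rem]
    abel
  dXi _ _ a b ha hb j := by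
    have h := (comp_isLeibniz (n := n) ht).dXi ha hb j
    have h' := dV_taylor (0, EuclideanSpace.single j 1) (Symb.smooth ha) (Symb.smooth hb) N t
    rw [dXi_eq_dV] at h ⊢
    rw [rem, dV_sub _ (comp_contDiff ht ha hb)
      (taylor_contDiff (Symb.smooth ha) (Symb.smooth hb) N t), h, h', rem, rem]
    abel

lemma hasDerivAt_taylor_coeff (l : ℕ) (t : ℝ) :
    HasDerivAt (fun t : ℝ => ((t ^ (l + 1) / (l + 1).factorial : ℝ) : ℂ))
      ((t ^ l / l.factorial : ℝ) : ℂ) t := by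
  have h := ((hasDerivAt_pow (l + 1) t).div_const ((l + 1).factorial : ℝ)).ofReal_comp
  convert h using 2
  have h1 : (l.factorial : ℝ) ≠ 0 := by positivity
  rw [Nat.factorial_succ]
  push_cast
  field_simp

lemma hasDerivAt_taylor (N : ℕ) (t : ℝ) (p : Phase n) :
    HasDerivAt (fun t => taylor (N + 1) t a b p)
      (-I * ∑ j, taylor N t (dXi j a) (dX j b) p) t := by
  have h1 : ∀ t, taylor (N + 1) t a b p = (∑ l ∈ Finset.range N,
      ((t ^ (l + 1) / (l + 1).factorial : ℝ) : ℂ) * term (l + 1) a b p) + term 0 a b p := by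
    intro t
    simp [taylor, Finset.sum_range_succ', Finset.sum_apply]
  have h2 : -I * ∑ j, taylor N t (dXi j a) (dX j b) p = ∑ l ∈ Finset.range N,
      ((t ^ l / l.factorial : ℝ) : ℂ) * term (l + 1) a b p := by
    simp only [taylor, Finset.sum_apply, term, Pi.smul_apply, smul_eq_mul, Finset.mul_sum]
    rw [Finset.sum_comm]
    exact Finset.sum_congr rfl fun l _ => Finset.sum_congr rfl fun j _ => by ring
  simp only [h1, h2]
  exact (HasDerivAt.fun_sum fun l _ => (hasDerivAt_taylor_coeff l t).mul_const _).add_const _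

/-- Composition and Taylor polynomial obey the same differential equation in `t`, with the level
lowered by one. The remainders therefore form a triangular system. -/
lemma rem_hasDerivAt (ha : a ∈ Symb n m) (hb : b ∈ Symb n k) (N : ℕ) {t : ℝ} (ht : |t| < 2)
    (p : Phase n) : HasDerivAt (fun t => rem (N + 1) t a b p)
      (-I * ∑ j, rem N t (dXi j a) (dX j b) p) t := by
  have h := (comp_hasDerivAt ha hb ht p).sub (hasDerivAt_taylor (a := a) (b := b) N t p)
  rw [← mul_sub, ← Finset.sum_sub_distrib] at h
  exact h

lemma rem_zero_time (ha : a ∈ Symb n m) (hb : b ∈ Symb n k) (N : ℕ) (p : Phase n) :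
    rem (N + 1) 0 a b p = 0 := by
  simp [rem, taylor, Finset.sum_range_succ', comp_zero ha hb, term]

/-- Integrate `rem_hasDerivAt` from `t = 0`, where the remainder vanishes. Each level differentiates
`a` in `ξ` and `b` in `x`, lowering both orders by one. -/
lemma rem_bound (ha : a ∈ Symb n m) (hb : b ∈ Symb n k) (N : ℕ) :
    ∃ C : ℝ, 0 ≤ C ∧ ∀ t ∈ Set.Icc (0 : ℝ) 1, ∀ p : Phase n,
      ‖rem N t a b p‖ ≤ C * wt (m + k - (N : ℝ) • oneOne) (0, p) := by
  have ht2 : ∀ t ∈ Set.Icc (0 : ℝ) 1, |t| < 2 := fun t ht => by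
    rw [abs_of_nonneg ht.1]
    linarith [ht.2]
  induction N generalizing m k a b with
  | zero =>
    obtain ⟨C, hC0, hC⟩ := comp_bound ha hb
    refine ⟨C, hC0, fun t ht p => ?_⟩
    have e : rem 0 t a b p = comp a b (t, p) := by simp [rem, taylor]
    rw [e, Nat.cast_zero, zero_smul, sub_zero]
    -- The weight does not depend on `t`, so the point `(0, p)` may stand for `(t, p)`.
    exact hC (t, p) (ht2 t ht)
  | succ N ih =>
    choose C hC0 hC using fun j => ih (Symb.dXi ha j) (Symb.dX hb j)
    refine ⟨∑ j, C j, Finset.sum_nonneg fun j _ => hC0 j, fun t ht p => ?_⟩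
    have hd : ∀ s ∈ Set.Icc (0 : ℝ) 1, ‖-I * ∑ j, rem N s (dXi j a) (dX j b) p‖
        ≤ (∑ j, C j) * wt (m + k - ((N + 1 : ℕ) : ℝ) • oneOne) (0, p) := by
      intro s hs
      rw [norm_mul, norm_neg, norm_I, one_mul, Finset.sum_mul]
      refine (norm_sum_le _ _).trans (Finset.sum_le_sum fun j _ => ?_)
      have e : m - e₂ + (k - e₁) - (N : ℝ) • oneOne = m + k - ((N + 1 : ℕ) : ℝ) • oneOne := by
        ext <;> simp <;> ring
      rw [← e]
      exact hC j s hs p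
    have h := norm_image_sub_le_of_norm_deriv_le_segment'
      (fun s hs => (rem_hasDerivAt ha hb N (ht2 s hs) p).hasDerivWithinAt)
      (fun s hs => hd s (Set.Ico_subset_Icc_self hs)) t ht
    rw [rem_zero_time ha hb, sub_zero, sub_zero] at h
    refine h.trans (mul_le_of_le_one_right ?_ ht.2)
    exact mul_nonneg (Finset.sum_nonneg fun j _ => hC0 j) (wt_pos _ _).le

lemma rem_mem_symb (ha : a ∈ Symb n m) (hb : b ∈ Symb n k) (N : ℕ) :
    rem N 1 a b ∈ Symb n (m + k - (N : ℝ) • oneOne) := by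
  refine (rem_isLeibniz N (by norm_num)).symb (fun m k a b ha hb => ?_) ha hb
  obtain ⟨C, -, hC⟩ := rem_bound ha hb N
  refine ⟨C, fun x ξ => (hC 1 (by simp) (x, ξ)).trans_eq ?_⟩
  simp only [wt]
  ring

/-- The further Taylor terms at `t = 1` are classical and expand the remainder, with errors
controlled by `rem_mem_symb`; `SG.asymptotic` does the rest. -/
lemma rem_mem (ha : a ∈ SG n m) (hb : b ∈ SG n k) (N : ℕ) :
    rem N 1 a b ∈ SG n (m + k - (N : ℝ) • oneOne) := by
  have e : ∀ M : ℕ, m + k - (N : ℝ) • oneOne - (M : ℝ) • oneOne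
      = m + k - ((N + M : ℕ) : ℝ) • oneOne := fun M => by
    ext <;> simp <;> ring
  refine SG.asymptotic
    (c := fun j => (((1 : ℝ) ^ (N + j) / (N + j).factorial : ℝ) : ℂ) • term (N + j) a b)
    (fun j => ?_) fun M => ?_
  · rw [e]
    exact Submodule.smul_mem _ _ (term_mem SG.mulMaps SG.allDerivMaps ha hb _)
  · rw [e]
    have h := rem_mem_symb (SG_le_Symb ha) (SG_le_Symb hb) (N + M)
    rw [rem, taylor, Finset.sum_range_add, ← sub_sub] at h
    exact h

lemma rem_one (a b : Phase n → ℂ) : rem 1 1 a b = comp₁ a b - a * b := by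
  simp [rem, taylor, term]
  rfl

lemma rem_two (a b : Phase n → ℂ) :
    rem 2 1 a b = comp₁ a b - (a * b - I • ∑ j, dXi j a * dX j b) := by
  simp [rem, taylor, term, Finset.sum_range_succ, sub_eq_add_neg]
  rfl

/-- The symbol of the commutator of `Op(a)` and `Op(b)`. -/
noncomputable def commSymbol (a b : Phase n → ℂ) : Phase n → ℂ := comp₁ a b - comp₁ b a

/-- The leading terms `a b` and `b a` cancel, which lowers the order from `(2, 2)` to `(1, 1)`. -/
lemma commSymbol_mem (ha : a ∈ SG n oneOne) (hb : b ∈ SG n oneOne) :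
    commSymbol a b ∈ SG n oneOne := by
  have h := (SG n _).sub_mem (rem_mem ha hb 1) (rem_mem hb ha 1)
  rw [rem_one, rem_one, mul_comm b a, sub_sub_sub_cancel_right, Nat.cast_one, one_smul,
    add_sub_cancel_right] at h
  exact h

/-- Expanding to second order, the terms `-i ∑ ∂_ξ a ∂_x b` antisymmetrise to `-i {a, b}`, and the
remainders have order `(0, 0)`. -/
lemma commSymbol_add_poisson_mem (ha : a ∈ SG n oneOne) (hb : b ∈ SG n oneOne) :
    commSymbol a b + I • poisson a b ∈ SG n 0 := by
  have h := (SG n _).sub_mem (rem_mem ha hb 2) (rem_mem hb ha 2)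
  have e : rem 2 1 a b - rem 2 1 b a = commSymbol a b + I • poisson a b := by
    rw [rem_two, rem_two, commSymbol]
    ext p
    simp only [poisson, Pi.add_apply, Pi.sub_apply, Pi.smul_apply, Pi.mul_apply, Finset.sum_apply,
      smul_eq_mul, Finset.sum_sub_distrib]
    simp only [mul_comm (dXi _ b p)]
    ring
  rw [e, show oneOne + oneOne - ((2 : ℕ) : ℝ) • oneOne = 0 by ext <;> norm_num] at h
  exact h

/-! ### Operators of order `𝟙` -/

/-- Quantisation as a linear map of symbols to operators. -/
noncomputable def opLin (n : ℕ) (m : ℝ × ℝ) : SG n m →ₗ[ℂ] LG n m where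
  toFun a := ⟨opS a.1 (SG_le_Symb a.2), a.1, a.2, opS_isOp _⟩
  map_add' a b := Subtype.ext <| LinearMap.ext fun u => by
    ext x
    exact opApply_add (SG_le_Symb a.2) (SG_le_Symb b.2) u x
  map_smul' z a := Subtype.ext <| LinearMap.ext fun u => by
    ext x
    exact opApply_smul z a.1 u x

lemma opLin_bijective : Function.Bijective (opLin n m) := by
  refine ⟨(injective_iff_map_eq_zero _).2 fun a h => Subtype.ext ?_, fun ⟨A, a, ha, hA⟩ =>
    ⟨⟨a, ha⟩, Subtype.ext ((opS_isOp (SG_le_Symb ha)).unique hA)⟩⟩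
  refine eq_zero_of_opApply (SG_le_Symb a.2) fun u x => ?_
  have h1 := LinearMap.congr_fun (Subtype.ext_iff.1 h) u
  exact DFunLike.congr_fun h1 x

/-- Quantisation as a linear isomorphism of symbols onto operators. -/
noncomputable def opEquiv (n : ℕ) (m : ℝ × ℝ) : SG n m ≃ₗ[ℂ] LG n m :=
  LinearEquiv.ofBijective (opLin n m) opLin_bijective

lemma opEquiv_isOp (a : SG n m) : IsOp (a : Phase n → ℂ) (opEquiv n m a).1 :=
  opS_isOp (SG_le_Symb a.2)

lemma opEquiv_eq {a : SG n m} {A : LG n m} (h : IsOp (a : Phase n → ℂ) A.1) :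
    opEquiv n m a = A := Subtype.ext ((opEquiv_isOp a).unique h)

lemma IsOp.mul {A B : Module.End ℂ 𝓢(Pos n, ℂ)} (ha : a ∈ Symb n m) (hb : b ∈ Symb n k)
    (hA : IsOp a A) (hB : IsOp b B) : IsOp (comp₁ a b) (A * B) := by
  intro u x
  rw [(opS_isOp hb).unique hB |>.symm, Module.End.mul_apply, hA, opApply_comp ha hb]

lemma IsOp.sub {A B : Module.End ℂ 𝓢(Pos n, ℂ)} (ha : a ∈ Symb n m) (hb : b ∈ Symb n m)
    (hA : IsOp a A) (hB : IsOp b B) : IsOp (a - b) (A - B) := by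
  intro u x
  have h := opApply_add ha ((Symb n m).smul_mem (-1) hb) u x
  rw [neg_one_smul, ← sub_eq_add_neg, ← neg_one_smul ℂ b, opApply_smul] at h
  rw [h, LinearMap.sub_apply, _root_.sub_apply, hA, hB]
  ring

lemma IsOp.commutator {A B : Module.End ℂ 𝓢(Pos n, ℂ)} (ha : a ∈ SG n m) (hb : b ∈ SG n k)
    (hA : IsOp a A) (hB : IsOp b B) : IsOp (commSymbol a b) (A * B - B * A) := by
  have h1 := SG_le_Symb ha
  have h2 := SG_le_Symb hb
  have h3 := comp₁_mem h2 h1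
  rw [add_comm] at h3
  exact IsOp.sub (comp₁_mem h1 h2) h3 (IsOp.mul h1 h2 hA hB) (IsOp.mul h2 h1 hB hA)

lemma commutator_mem {A B : Module.End ℂ 𝓢(Pos n, ℂ)} (hA : A ∈ LG n oneOne)
    (hB : B ∈ LG n oneOne) : A * B - B * A ∈ LG n oneOne := by
  obtain ⟨a, ha, hA⟩ := hA
  obtain ⟨b, hb, hB⟩ := hB
  exact ⟨commSymbol a b, commSymbol_mem ha hb, IsOp.commutator ha hb hA hB⟩

lemma isCommutatorLie_LG : IsCommutatorLie (LG n oneOne) := by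
  refine ⟨LinearMap.mk₂ ℂ (fun P Q => ⟨P.1 * Q.1 - Q.1 * P.1, commutator_mem P.2 Q.2⟩)
    (fun P P' Q => Subtype.ext ?_) (fun z P Q => Subtype.ext ?_) (fun P Q Q' => Subtype.ext ?_)
    (fun z P Q => Subtype.ext ?_), fun P Q => rfl, fun P => Subtype.ext ?_,
    fun P Q R => Subtype.ext ?_⟩
  · simp only [Submodule.coe_add]; noncomm_ring
  · simp only [Submodule.coe_smul, smul_mul_assoc, mul_smul_comm, smul_sub]
  · simp only [Submodule.coe_add]; noncomm_ring
  · simp only [Submodule.coe_smul, smul_mul_assoc, mul_smul_comm, smul_sub]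
  · exact sub_self _
  · simp only [LinearMap.mk₂_apply, Submodule.coe_add, Submodule.coe_zero]; noncomm_ring

lemma SG.zero_le_one : SG n 0 ≤ SG n oneOne := by
  have h := SG.shift (n := n) oneOne 1 1
  rw [show ((oneOne.1 - (1 : ℕ), oneOne.2 - (1 : ℕ)) : ℝ × ℝ) = 0 by ext <;> simp] at h
  exact h

lemma LG_zero_le_one : LG n 0 ≤ LG n oneOne := fun _ ⟨a, ha, hA⟩ => ⟨a, SG.zero_le_one ha, hA⟩

lemma mem_submoduleOf {V : Type*} [AddCommGroup V] [Module ℂ V] {S T : Submodule ℂ V} {v : T} :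
    v ∈ S.submoduleOf T ↔ (v : V) ∈ S := Iff.rfl

/-- Quantisation on the quotients by the operators of order `0`. -/
noncomputable def opQuotEquiv (n : ℕ) : SymG n oneOne ≃ₗ[ℂ] LGQuot n :=
  Submodule.Quotient.equiv _ _ (opEquiv n oneOne) (by
    ext A
    rw [Submodule.mem_map, mem_submoduleOf]
    constructor
    · rintro ⟨a, ha, rfl⟩
      rw [mem_submoduleOf, sub_self] at ha
      exact ⟨a, ha, opEquiv_isOp a⟩
    · rintro ⟨a, ha, hA⟩
      refine ⟨⟨a, SG.zero_le_one ha⟩, ?_, opEquiv_eq hA⟩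
      rw [mem_submoduleOf, sub_self]
      exact ha)

lemma opQuotEquiv_symCls (a : SG n oneOne) :
    opQuotEquiv n (symCls a) = opCls (opEquiv n oneOne a) := rfl

/-- The isomorphism that sends the class of `Op(a)` to minus the class of `a`. -/
noncomputable def negSymbolEquiv (n : ℕ) : LGQuot n ≃ₗ[ℂ] SymG n oneOne :=
  (opQuotEquiv n).symm.trans (LinearEquiv.neg ℂ)

lemma negSymbolEquiv_opCls {A : LG n oneOne} {a : SG n oneOne}
    (h : IsOp (a : Phase n → ℂ) (A : Module.End ℂ 𝓢(Pos n, ℂ))) :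
    negSymbolEquiv n (opCls A) = - symCls a := by
  rw [← opEquiv_eq h, ← opQuotEquiv_symCls]
  simp [negSymbolEquiv]

lemma IsLieBracket.smul {V : Type*} [AddCommGroup V] [Module ℂ V] {B : V →ₗ[ℂ] V →ₗ[ℂ] V}
    (hB : IsLieBracket B) (z : ℂ) : IsLieBracket (z • B) := by
  refine ⟨fun v => by simp [hB.1], fun u v w => ?_⟩
  simp only [LinearMap.smul_apply, map_smul, ← smul_add, hB.2, smul_zero]

lemma IsLieBracket.transport {V W : Type*} [AddCommGroup V] [Module ℂ V] [AddCommGroup W]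
    [Module ℂ W] {B : V →ₗ[ℂ] V →ₗ[ℂ] V} (hB : IsLieBracket B) (e : W ≃ₗ[ℂ] V) :
    IsLieBracket ((B.compl₁₂ e.toLinearMap e.toLinearMap).compr₂ e.symm.toLinearMap) := by
  refine ⟨fun v => by simp [hB.1], fun u v w => ?_⟩
  simp [← map_add, hB.2]

/-- The bracket on operators is defined by transport from the symbol side, so the Lie axioms and the
homomorphism property are automatic. It remains to see that it is induced by the commutator. The two
signs in the arguments cancel, and the sign in front of the commutator symbol turns `-i {a, b}` into
`i {a, b}`. -/
lemma exists_isInducedCommutator {BS : SymG n oneOne →ₗ[ℂ] SymG n oneOne →ₗ[ℂ] SymG n oneOne}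
    (hBS : IsInducedPoisson BS) : ∃ BL : LGQuot n →ₗ[ℂ] LGQuot n →ₗ[ℂ] LGQuot n,
      IsInducedCommutator BL ∧ ∀ X Y, negSymbolEquiv n (BL X Y)
        = (I • BS) (negSymbolEquiv n X) (negSymbolEquiv n Y) := by
  refine ⟨((I • BS).compl₁₂ (negSymbolEquiv n).toLinearMap
    (negSymbolEquiv n).toLinearMap).compr₂ (negSymbolEquiv n).symm.toLinearMap,
    ⟨(hBS.1.smul I).transport _, fun P Q => ?_⟩, fun X Y => by simp⟩
  have hC := commutator_mem P.2 Q.2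
  refine ⟨hC, ?_⟩
  obtain ⟨a, rfl⟩ := (opEquiv n oneOne).surjective P
  obtain ⟨b, rfl⟩ := (opEquiv n oneOne).surjective Q
  let c : SG n oneOne := ⟨commSymbol a b, commSymbol_mem a.2 b.2⟩
  have hc : IsOp (c : Phase n → ℂ) (⟨_, hC⟩ : LG n oneOne).1 :=
    IsOp.commutator a.2 b.2 (opEquiv_isOp a) (opEquiv_isOp b)
  obtain ⟨hp, hBp⟩ := hBS.2 a b
  apply (negSymbolEquiv n).injective
  rw [negSymbolEquiv_opCls hc]
  simp only [LinearMap.compr₂_apply, LinearMap.compl₁₂_apply, LinearEquiv.coe_coe,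
    LinearEquiv.apply_symm_apply, negSymbolEquiv_opCls (opEquiv_isOp a),
    negSymbolEquiv_opCls (opEquiv_isOp b), map_neg, LinearMap.neg_apply, neg_neg,
    LinearMap.smul_apply, hBp]
  rw [eq_neg_iff_add_eq_zero, add_comm]
  have h := (Submodule.Quotient.mk_eq_zero ((SG n (oneOne - oneOne)).submoduleOf (SG n oneOne))
    (x := c + I • ⟨poisson a b, hp⟩)).2 (by
      rw [mem_submoduleOf, sub_self]
      exact commSymbol_add_poisson_mem a.2 b.2)
  exact h

end SGCalc

theorem mainTheorem8 (n : ℕ) :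
    -- the commutative bi-filtered algebra of classical symbols
    (SGCalc.IsSmoothSubalgebra (SGCalc.SGInt n) ∧
      (SGCalc.SGInt n : Set (SGCalc.Phase n → ℂ)) =
        ⋃ m : ℤ × ℤ, (SGCalc.SG n ((m.1 : ℝ), (m.2 : ℝ)) : Set (SGCalc.Phase n → ℂ)) ∧
      SGCalc.IsSmoothSubalgebra (SGCalc.SGReal n) ∧
      (∀ (m : ℝ × ℝ) (i j : ℕ), SGCalc.SG n (m.1 - i, m.2 - j) ≤ SGCalc.SG n m) ∧
      (∀ m k : ℝ × ℝ, ∀ a ∈ SGCalc.SG n m, ∀ b ∈ SGCalc.SG n k, a * b ∈ SGCalc.SG n (m + k))) ∧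
    -- the Poisson bracket is a bi-filtered Lie bracket and biderivation
    (SGCalc.IsPoissonLie (SGCalc.SGInt n) ∧ SGCalc.IsPoissonBiderivation (SGCalc.SGInt n) ∧
      SGCalc.IsPoissonLie (SGCalc.SGReal n) ∧ SGCalc.IsPoissonBiderivation (SGCalc.SGReal n) ∧
      (∀ m k : ℝ × ℝ, ∀ a ∈ SGCalc.SG n m, ∀ b ∈ SGCalc.SG n k,
        SGCalc.poisson a b ∈ SGCalc.SG n (m + k - SGCalc.oneOne))) ∧
    -- order zero
    (SGCalc.IsSmoothSubalgebra (SGCalc.SG n 0) ∧ SGCalc.IsPoissonLie (SGCalc.SG n 0) ∧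
      SGCalc.IsInducedPoisson
        (0 : SGCalc.SymG n 0 →ₗ[ℂ] SGCalc.SymG n 0 →ₗ[ℂ] SGCalc.SymG n 0)) ∧
    -- the principal symbols are well defined
    (∀ m : ℝ × ℝ, ∀ a ∈ SGCalc.SG n m,
      SGCalc.HasExitSymbol m a (SGCalc.sigmaE m.1 a) ∧
      SGCalc.HasPsiSymbol m a (SGCalc.sigmaPsi m.2 a) ∧
      SGCalc.IsHomBi m (SGCalc.sigmaPsiE m a) ∧
      (∀ x ξ : SGCalc.Pos n, x ≠ 0 → Tendsto (fun μ : ℝ => ((μ ^ (-m.1) : ℝ) : ℂ) * a (μ • x, ξ))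
        atTop (𝓝 (SGCalc.sigmaE m.1 a (x, ξ)))) ∧
      (∀ x ξ : SGCalc.Pos n, ξ ≠ 0 → Tendsto (fun μ : ℝ => ((μ ^ (-m.2) : ℝ) : ℂ) * a (x, μ • ξ))
        atTop (𝓝 (SGCalc.sigmaPsi m.2 a (x, ξ)))) ∧
      (∀ x ξ : SGCalc.Pos n, x ≠ 0 → ξ ≠ 0 →
        Tendsto (fun μ : ℝ => ((μ ^ (-m.1) : ℝ) : ℂ) * SGCalc.sigmaPsi m.2 a (μ • x, ξ))
          atTop (𝓝 (SGCalc.sigmaPsiE m a (x, ξ)))) ∧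
      (a ∈ SGCalc.SG n (m - SGCalc.oneOne) →
        Set.EqOn (SGCalc.sigmaE m.1 a) 0 {p | p.1 ≠ 0} ∧
        Set.EqOn (SGCalc.sigmaPsi m.2 a) 0 {p | p.2 ≠ 0} ∧
        Set.EqOn (SGCalc.sigmaPsiE m a) 0 {p | p.1 ≠ 0 ∧ p.2 ≠ 0})) ∧
    -- order (1,1): Lie algebra structures, principal symbols, and the commutator of operators
    (SGCalc.IsPoissonLie (SGCalc.SG n SGCalc.oneOne) ∧
      (∀ a ∈ SGCalc.SG n SGCalc.oneOne, ∀ b ∈ SGCalc.SG n SGCalc.oneOne,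
        Set.EqOn (SGCalc.sigmaPsi 1 (SGCalc.poisson a b))
          (SGCalc.poisson (SGCalc.sigmaPsi 1 a) (SGCalc.sigmaPsi 1 b)) {p | p.2 ≠ 0} ∧
        Set.EqOn (SGCalc.sigmaE 1 (SGCalc.poisson a b))
          (SGCalc.poisson (SGCalc.sigmaE 1 a) (SGCalc.sigmaE 1 b)) {p | p.1 ≠ 0} ∧
        Set.EqOn (SGCalc.sigmaPsiE SGCalc.oneOne (SGCalc.poisson a b))
          (SGCalc.poisson (SGCalc.sigmaPsiE SGCalc.oneOne a) (SGCalc.sigmaPsiE SGCalc.oneOne b))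
          {p | p.1 ≠ 0 ∧ p.2 ≠ 0}) ∧
      (∀ m : ℝ × ℝ, ∀ a ∈ SGCalc.SG n m, ∃! A : Module.End ℂ 𝓢(SGCalc.Pos n, ℂ),
        SGCalc.IsOp a A) ∧
      SGCalc.IsCommutatorLie (SGCalc.LG n SGCalc.oneOne) ∧
      SGCalc.LG n 0 ≤ SGCalc.LG n SGCalc.oneOne ∧
      ∃ (BS : SGCalc.SymG n SGCalc.oneOne →ₗ[ℂ]
            SGCalc.SymG n SGCalc.oneOne →ₗ[ℂ] SGCalc.SymG n SGCalc.oneOne)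
        (BL : SGCalc.LGQuot n →ₗ[ℂ] SGCalc.LGQuot n →ₗ[ℂ] SGCalc.LGQuot n)
        (Φ : SGCalc.LGQuot n ≃ₗ[ℂ] SGCalc.SymG n SGCalc.oneOne),
        SGCalc.IsInducedPoisson BS ∧
        SGCalc.IsInducedCommutator BL ∧
        SGCalc.IsLieBracket (I • BS) ∧
        (∀ X Y : SGCalc.LGQuot n, Φ (BL X Y) = (I • BS) (Φ X) (Φ Y)) ∧
        -- the isomorphism is minus the principal symbol map
        (∀ (A : SGCalc.LG n SGCalc.oneOne) (a : SGCalc.SG n SGCalc.oneOne),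
          SGCalc.IsOp (a : SGCalc.Phase n → ℂ) (A : Module.End ℂ 𝓢(SGCalc.Pos n, ℂ)) →
          Φ (SGCalc.opCls A) = - SGCalc.symCls a)) := by
  have h0 : SGCalc.IsSmoothSubalgebra (SGCalc.SG n 0) :=
    ⟨fun _ => SGCalc.SG.smooth, SGCalc.SG.one_mem, fun a ha b hb => by
      simpa using SGCalc.SG.mulMaps ha hb⟩
  have hP0 : ∀ a ∈ SGCalc.SG n 0, ∀ b ∈ SGCalc.SG n 0, SGCalc.poisson a b ∈ SGCalc.SG n 0 := by
    intro a ha b hb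
    obtain ⟨h, -⟩ := SGCalc.isInducedPoisson_zero.2 ⟨a, ha⟩ ⟨b, hb⟩
    exact h
  refine ⟨⟨⟨SGCalc.SGInt.smooth, SGCalc.SGInt.one_mem, SGCalc.SGInt.mul_mem⟩, ?_,
    ⟨SGCalc.SGReal.smooth, SGCalc.SG.le_SGReal 0 SGCalc.SG.one_mem, SGCalc.SGReal.mul_mem⟩,
    fun m i j => SGCalc.SG.shift m i j, fun m k a ha b hb => SGCalc.SG.mulMaps ha hb⟩,
    ⟨SGCalc.isPoissonLie_of SGCalc.SGInt.smooth SGCalc.SGInt.poisson_mem,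
      SGCalc.isPoissonBiderivation_of SGCalc.SGInt.smooth,
      SGCalc.isPoissonLie_of SGCalc.SGReal.smooth SGCalc.SGReal.poisson_mem,
      SGCalc.isPoissonBiderivation_of SGCalc.SGReal.smooth,
      fun m k a ha b hb => SGCalc.SG.poisson_mem ha hb⟩,
    ⟨h0, SGCalc.isPoissonLie_of h0.1 hP0, SGCalc.isInducedPoisson_zero⟩,
    fun m a ha => ?_, ?_⟩
  · ext a
    simp only [Set.mem_iUnion, SetLike.mem_coe]
    exact SGCalc.mem_SGInt
  · obtain ⟨he, he'⟩ := SGCalc.SG.hasExitSymbol ha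
    obtain ⟨hψ, hψ'⟩ := SGCalc.SG.hasPsiSymbol ha
    obtain ⟨hc, hc'⟩ := SGCalc.SG.cornerSymbol ha
    exact ⟨he, hψ, hc, he', hψ', hc', fun h => SGCalc.sigma_eqOn_zero (SGCalc.SG_le_Symb h)⟩
  · obtain ⟨BS, hBS⟩ := SGCalc.exists_isInducedPoisson (n := n)
    obtain ⟨BL, hBL, hΦ⟩ := SGCalc.exists_isInducedCommutator hBS
    exact ⟨SGCalc.isPoissonLie_of (fun _ => SGCalc.SG.smooth)
        fun a ha b hb => SGCalc.SG.poisson_mem_one ha hb,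
      fun a ha b hb => ⟨SGCalc.sigmaPsi_poisson ha hb, SGCalc.sigmaE_poisson ha hb,
        SGCalc.sigmaPsiE_poisson ha hb⟩,
      fun m a ha => ⟨SGCalc.opS a (SGCalc.SG_le_Symb ha), SGCalc.opS_isOp _,
        fun B hB => hB.unique (SGCalc.opS_isOp _)⟩,
      SGCalc.isCommutatorLie_LG, SGCalc.LG_zero_le_one, BS, BL, SGCalc.negSymbolEquiv n, hBS, hBL,
      hBS.1.smul I, hΦ, fun A a h => SGCalc.negSymbolEquiv_opCls h⟩
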